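/- For $\varphi\in C_c^\infty((\tfrac12,2))$ (complex-valued), $\alpha>1$ and $s\ge 1$ let $H_s$ be the operator on functions $f:\mathbb Z\to\mathbb C$ given by $$H_sf(x)=\sum_{m>0}\varphi\Big(\frac ms\Big)\,\frac{f(x-[m^\alpha])-f(x+[m^\alpha])}{m},$$ where $m$ runs over the positive integers and $[\cdot]$ is the integer part. Let $H_s(x)=(H_s\delta_0)(x)$, $x\in\mathbb Z$, be its convolution kernel, where $\delta_0$ is the point mass at $0$. Fix $1<\alpha<1+\frac1{1000}$. For every $\delta_L>0$ there is an exponent $\gamma(\delta_L)>0$ (depending only on $\alpha$ and $\delta_L$), and for every $\varphi\in C_c^\infty((\tfrac12,2))$ there are constants $C\in\mathbb R$ and $c\in\mathbb C$ (depending only on $\alpha$ and $\varphi$), such that for every $\delta_L>0$ and every real $s\ge1$ there exist functions $G_s,E_s:\mathbb Z\to\mathbb C$ with $$H_s*H_s(x)=G_s(x)+E_s(x)+\frac{c}{s}\,\delta_0(x)\qquad(x\in\mathbb Z),$$ $$|G_s(x)|+|E_s(x)|\le C s^{-\alpha}\quad(x\in\mathbb Z),\qquad \operatorname{supp}E_s\subset[-s^{\alpha-1+\delta_L},\,s^{\alpha-1+\delta_L}],$$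 $$|G_s(x+u)-G_s(x)|\le C s^{-\alpha}\,\big|u\,s^{-\alpha}\big|^{\gamma(\delta_L)}\qquad(x,u\in\mathbb Z).$$ -/

import Mathlib

open scoped ContDiff

noncomputable section

/-- The operator `H_s f(x) = ∑_{m > 0} φ(m / s) (f(x - [m^α]) - f(x + [m^α])) / m` on functions on
`ℤ`. For `φ` supported in `(1/2, 2)` and `s > 0` only finitely many terms are nonzero. -/
def waringOp (φ : ℝ → ℂ) (α s : ℝ) (f : ℤ → ℂ) (x : ℤ) : ℂ :=
  ∑' m : ℕ+, φ ((m : ℝ) / s) * ((f (x - ⌊(m : ℝ) ^ α⌋) - f (x + ⌊(m : ℝ) ^ α⌋)) / (m : ℂ))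

/-- The point mass at `0` on `ℤ`. -/
def deltaZero : ℤ → ℂ := Pi.single 0 1

/-- The convolution kernel `H_s(x)` of the operator `H_s`, that is, `H_s δ_0`. -/
def waringKernel (φ : ℝ → ℂ) (α s : ℝ) : ℤ → ℂ :=
  waringOp φ α s deltaZero

/-- Convolution of functions on `ℤ`. -/
def intConv (K L : ℤ → ℂ) (x : ℤ) : ℂ :=
  ∑' y : ℤ, K (x - y) * L y

/-- The operator `H_s` is convolution with its kernel. -/
theorem waringOp_eq_intConv (φ : ℝ → ℂ) (α s : ℝ) (hs : 0 < s)
    (hφ : tsupport φ ⊆ Set.Ioo (1 / 2) 2) (f : ℤ → ℂ) (x : ℤ) :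
    waringOp φ α s f x = intConv (waringKernel φ α s) f x := by
  set F : Finset ℕ+ := Finset.Iic (Nat.toPNat ⌈2 * s⌉₊ (Nat.ceil_pos.2 (by positivity))) with hF
  have hz : ∀ m : ℕ+, m ∉ F → φ ((m : ℝ) / s) = 0 := by
    intro m hm
    by_contra hne
    have h2 := (hφ (subset_tsupport _ hne)).2
    rw [div_lt_iff₀ hs] at h2
    apply hm
    rw [hF, Finset.mem_Iic, ← PNat.coe_le_coe]
    have h3 : (m : ℝ) ≤ (⌈2 * s⌉₊ : ℝ) := h2.le.trans (Nat.le_ceil _)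
    exact_mod_cast h3
  have hop : ∀ (g : ℤ → ℂ) (z : ℤ), waringOp φ α s g z = ∑ m ∈ F,
      φ ((m : ℝ) / s) * ((g (z - ⌊(m : ℝ) ^ α⌋) - g (z + ⌊(m : ℝ) ^ α⌋)) / (m : ℂ)) := by
    intro g z
    refine tsum_eq_sum fun m hm => ?_
    rw [hz m hm, zero_mul]
  have hsingle : ∀ k : ℤ, HasSum (fun y : ℤ => deltaZero (x - y - k) * f y) (f (x - k)) := by
    intro k
    have h := hasSum_single (f := fun y : ℤ => deltaZero (x - y - k) * f y) (x - k) (by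
      intro y hy
      have : x - y - k ≠ 0 := by omega
      simp [deltaZero, this])
    simpa [deltaZero] using h
  have key : HasSum (fun y : ℤ => waringKernel φ α s (x - y) * f y) (waringOp φ α s f x) := by
    rw [hop f x]
    have h : HasSum (fun y : ℤ => ∑ m ∈ F, φ ((m : ℝ) / s) / (m : ℂ) *
        (deltaZero (x - y - ⌊(m : ℝ) ^ α⌋) * f y - deltaZero (x - y - -⌊(m : ℝ) ^ α⌋) * f y))
        (∑ m ∈ F, φ ((m : ℝ) / s) / (m : ℂ) *
          (f (x - ⌊(m : ℝ) ^ α⌋) - f (x - -⌊(m : ℝ) ^ α⌋))) :=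
      hasSum_sum fun m _ => ((hsingle _).sub (hsingle _)).mul_left _
    convert h using 1
    · funext y
      rw [waringKernel, hop, Finset.sum_mul]
      refine Finset.sum_congr rfl fun m _ => ?_
      rw [sub_neg_eq_add]
      ring
    · refine Finset.sum_congr rfl fun m _ => ?_
      rw [sub_neg_eq_add]
      ring
  exact key.tsum_eq.symm

end

/-!
The kernel of `H_s` is the odd extension `x ↦ a x - a (-x)` of the function `a = floorDensity g α s`,
which puts mass `g (m / s) / s` at `⌊m ^ α⌋`, where `g t = φ t / t`. Write `β = 1 / α`. An integer
`y ≥ 1` is of the form `⌊m ^ α⌋` exactly when the fractional part of `-y ^ β` is smaller than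
`(y + 1) ^ β - y ^ β`, so on average `a` is the smooth function `W = smoothDensity g α s`, of size
`s ^ (-α)` and varying at the scale `s ^ α`. Expanding the product, `H_s * H_s` at `x > 0` is a
combination of `∑ y, a y * a (x + y)` and `∑ y, a y * a (x - y)` (`intConv_oddExtension`).

The heart of the matter is `norm_selfCorr_sub_le`: once `x ≥ s ^ (α - 1 + δ)`, replacing `a` by `W` in
these two sums costs only `O (s ^ (-α - ε))`. On a block of consecutive `y`, shorter than `s ^ α` by
a small power of `s`, one has to count the `y` for which the pair `(-y ^ β, -(x ± y) ^ β)` lies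
modulo one in a box of side about `s ^ (1 - α)`. Since `α` is close to `1`, the box is so large that
it can be sandwiched between products of trapezoids, whose Fourier coefficients are explicit, with
frequencies `(k, l)` up to `s ^ (1 / 100)` (`abs_card_filter_sub_le`). The resulting exponential sums
have phase `k * y ^ β + l * (x ± y) ^ β`. Its second derivative is `y ^ (β - 2)` times a monotone
function, `curvature`, up to a constant. If `x` is comparable to `s ^ α` up to the size of the
frequencies, the curvature is small only on a short interval; if `x` is smaller, it is small only for
`l = -k`. Away from these exceptions van der Corput's second derivative test gives a power saving.
For `l = -k` and small `x` the derivative of the phase is itself small and comparable to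
`k * x * s ^ (1 - 2 * α)`, and the Kusmin–Landau inequality gives a saving as soon as `x` exceeds
`s ^ (α - 1)` by a power of `s`. This is where the window in the support of `E_s` comes from.

For `0 < x ≤ s` the bound `O (s ^ (-α))` for the correlation is elementary
(`norm_selfCorr_le_of_le`): for each difference `h` of the roots, the values `(n + h) ^ α - n ^ α`
are well spaced. At `x = 0` the self-convolution is a Riemann sum for `-2 / s * ∫ t, g t ^ 2`, which
is the term `c / s`. The error `O (s ^ (-2))` is admissible.

So `G_s` is taken to be the smooth main part, plus the difference between `H_s * H_s` and the main
part outside the window, and `E_s` is the rest. The main part is Lipschitz at the scale `s ^ α`, and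
the difference is `O (s ^ (-α - ε))`, which is below the required modulus of continuity since
`|u| ≥ 1` for every nonzero integer `u`. The constant must not depend on the exponent of the window,
while that of the power saving does; interpolation with the uniform bound moves this dependence into
the exponent (`exists_norm_intConv_sub_le`).
-/

/-! ### The Kusmin–Landau inequality -/

/-- The additive character `t ↦ exp (2πit)` on `ℝ`. -/
noncomputable def unitExp (t : ℝ) : ℂ := Complex.exp (2 * Real.pi * t * Complex.I)

lemma norm_unitExp (t : ℝ) : ‖unitExp t‖ = 1 := by
  have h : (2 * Real.pi * t * Complex.I : ℂ) = ((2 * Real.pi * t : ℝ) : ℂ) * Complex.I := by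
    push_cast; ring
  rw [unitExp, h, Complex.norm_exp_ofReal_mul_I]

lemma unitExp_add (t u : ℝ) : unitExp (t + u) = unitExp t * unitExp u := by
  simp only [unitExp, ← Complex.exp_add]
  push_cast
  ring_nf

lemma unitExp_zero : unitExp 0 = 1 := by simp [unitExp]

lemma unitExp_int (k : ℤ) : unitExp k = 1 := by
  rw [unitExp, Complex.exp_eq_one_iff]
  exact ⟨k, by push_cast; ring⟩

lemma unitExp_neg (t : ℝ) : unitExp (-t) = (starRingEnd ℂ) (unitExp t) := by
  rw [unitExp, unitExp, ← Complex.exp_conj]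
  congr 1
  simp [Complex.conj_ofReal, Complex.conj_ofNat]

lemma norm_sum_unitExp_neg {ι : Type*} (S : Finset ι) (F : ι → ℝ) :
    ‖∑ i ∈ S, unitExp (-F i)‖ = ‖∑ i ∈ S, unitExp (F i)‖ := by
  simp_rw [unitExp_neg]
  rw [← map_sum, RCLike.norm_conj]

lemma norm_sum_unitExp_le_card {ι : Type*} (S : Finset ι) (F : ι → ℝ) :
    ‖∑ i ∈ S, unitExp (F i)‖ ≤ S.card := by
  refine (norm_sum_le _ _).trans ?_
  simp [norm_unitExp]

lemma two_mul_le_sin_pi_mul {Δ g : ℝ} (hΔ : 0 < Δ) (h1 : Δ ≤ g) (h2 : g ≤ 1 - Δ) :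
    2 * Δ ≤ Real.sin (Real.pi * g) := by
  have hpi := Real.pi_pos
  rcases le_total g (1 / 2) with h | h
  · have := Real.mul_le_sin (x := Real.pi * g) (by nlinarith) (by nlinarith)
    have h3 : 2 / Real.pi * (Real.pi * g) = 2 * g := by field_simp
    linarith
  · have := Real.mul_le_sin (x := Real.pi * (1 - g)) (by nlinarith) (by nlinarith)
    have h3 : 2 / Real.pi * (Real.pi * (1 - g)) = 2 * (1 - g) := by field_simp
    have h4 : Real.sin (Real.pi * (1 - g)) = Real.sin (Real.pi * g) := by
      rw [mul_sub, mul_one, Real.sin_pi_sub]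
    linarith

/-- The reciprocal `1 / (unitExp g - 1)`, written through the cotangent. -/
noncomputable def geomRecip (g : ℝ) : ℂ :=
  -(1 / 2) - Complex.I / 2 * ((Real.cos (Real.pi * g) / Real.sin (Real.pi * g) : ℝ) : ℂ)

lemma unitExp_sub_one_mul_geomRecip {g : ℝ} (h : Real.sin (Real.pi * g) ≠ 0) :
    (unitExp g - 1) * geomRecip g = 1 := by
  have h1 : unitExp g =
      ((Real.cos (Real.pi * g) : ℂ) + (Real.sin (Real.pi * g) : ℂ) * Complex.I) ^ 2 := by
    have : unitExp g = Complex.exp (((Real.pi * g : ℝ) : ℂ) * Complex.I) ^ 2 := by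
      rw [unitExp, ← Complex.exp_nat_mul]
      push_cast
      ring_nf
    rw [this, Complex.exp_mul_I, Complex.ofReal_cos, Complex.ofReal_sin]
  have hs : ((Real.sin (Real.pi * g) : ℝ) : ℂ) ≠ 0 := by exact_mod_cast h
  have hcs : ((Real.cos (Real.pi * g) : ℝ) : ℂ) ^ 2 + ((Real.sin (Real.pi * g) : ℝ) : ℂ) ^ 2 = 1 := by
    exact_mod_cast Real.cos_sq_add_sin_sq (Real.pi * g)
  rw [h1, geomRecip, Complex.ofReal_div]
  generalize ((Real.cos (Real.pi * g) : ℝ) : ℂ) = c at *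
  generalize ((Real.sin (Real.pi * g) : ℝ) : ℂ) = d at *
  have hI : Complex.I ^ 2 = -1 := Complex.I_sq
  field_simp
  linear_combination (-d ^ 3 - d ^ 2 * c * Complex.I - 2 * c ^ 2 * d) * hI +
    (d - Complex.I * c) * hcs


lemma norm_geomRecip_le {Δ g : ℝ} (hΔ : 0 < Δ) (h1 : Δ ≤ g) (h2 : g ≤ 1 - Δ) :
    ‖geomRecip g‖ ≤ 1 / (4 * Δ) := by
  have hs := two_mul_le_sin_pi_mul hΔ h1 h2
  have hs0 : 0 < Real.sin (Real.pi * g) := by linarith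
  have hn : ‖unitExp g - 1‖ ^ 2 = (2 * Real.sin (Real.pi * g)) ^ 2 := by
    have : unitExp g - 1 = ((Real.cos (2 * (Real.pi * g)) - 1 : ℝ) : ℂ) +
        ((Real.sin (2 * (Real.pi * g)) : ℝ) : ℂ) * Complex.I := by
      have h : unitExp g = Complex.exp (((2 * (Real.pi * g) : ℝ) : ℂ) * Complex.I) := by
        rw [unitExp]; push_cast; ring_nf
      rw [h, Complex.exp_mul_I, ← Complex.ofReal_cos, ← Complex.ofReal_sin]
      push_cast; ring
    rw [← Complex.normSq_eq_norm_sq, this, Complex.normSq_add_mul_I, Real.cos_two_mul,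
      Real.sin_two_mul]
    have := Real.cos_sq_add_sin_sq (Real.pi * g)
    generalize Real.sin (Real.pi * g) = d at *
    generalize Real.cos (Real.pi * g) = c at *
    linear_combination (4 * c ^ 2 - 4) * this
  have hn' : ‖unitExp g - 1‖ = 2 * Real.sin (Real.pi * g) :=
    (pow_left_inj₀ (norm_nonneg _) (by linarith) two_ne_zero).1 hn
  have h := congrArg norm (unitExp_sub_one_mul_geomRecip hs0.ne')
  rw [norm_mul, hn', norm_one] at h
  rw [le_div_iff₀ (by positivity)]
  nlinarith [norm_nonneg (geomRecip g)]

/-- The cotangent decreases between consecutive zeros of the sine. -/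
lemma cot_sub_cot_nonneg {a b : ℝ} (ha : 0 < Real.sin a) (hb : 0 < Real.sin b)
    (hab : a ≤ b) (hba : b - a ≤ Real.pi) :
    Real.cos b / Real.sin b ≤ Real.cos a / Real.sin a := by
  have h := Real.sin_nonneg_of_nonneg_of_le_pi (sub_nonneg.2 hab) hba
  rw [Real.sin_sub] at h
  rw [div_le_div_iff₀ hb ha]
  linarith

/-- The Kusmin–Landau inequality, for increasing increments in `[Δ, 1 - Δ]`. -/
lemma norm_sum_unitExp_le_of_monotone_increment_aux (F : ℕ → ℝ) (n : ℕ) {Δ : ℝ} (hΔ : 0 < Δ)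
    (hmono : ∀ i, i + 1 < n → F (i + 1) - F i ≤ F (i + 2) - F (i + 1))
    (hlo : ∀ i < n, Δ ≤ F (i + 1) - F i) (hhi : ∀ i < n, F (i + 1) - F i ≤ 1 - Δ) :
    ‖∑ i ∈ Finset.range n, unitExp (F i)‖ ≤ 1 / Δ := by
  obtain _ | n := n
  · simp; positivity
  set g : ℕ → ℝ := fun i => F (i + 1) - F i with hg
  set c : ℕ → ℝ := fun i => Real.cos (Real.pi * g i) / Real.sin (Real.pi * g i) with hc
  have hsin : ∀ i < n + 1, 2 * Δ ≤ Real.sin (Real.pi * g i) := fun i hi =>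
    two_mul_le_sin_pi_mul hΔ (hlo i hi) (hhi i hi)
  have hcabs : ∀ i < n + 1, |c i| ≤ 1 / (2 * Δ) := by
    intro i hi
    have h := hsin i hi
    rw [hc, abs_div, abs_of_pos (show 0 < Real.sin (Real.pi * g i) by linarith)]
    exact div_le_div₀ zero_le_one (Real.abs_cos_le_one _) (by positivity) h
  have hE : ∀ i < n + 1,
      unitExp (F i) = (unitExp (F (i + 1)) - unitExp (F i)) * geomRecip (g i) := by
    intro i hi
    have h1 : unitExp (F (i + 1)) = unitExp (F i) * unitExp (g i) := by
      rw [← unitExp_add]; congr 1; simp only [hg]; ring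
    have h2 := unitExp_sub_one_mul_geomRecip (g := g i) (by have := hsin i hi; linarith)
    rw [h1]
    linear_combination -unitExp (F i) * h2
  -- Summation by parts, with the total variation of the cotangent telescoping.
  have key : ∀ m < n + 1, ‖∑ i ∈ Finset.range (m + 1), unitExp (F i) -
      unitExp (F (m + 1)) * geomRecip (g m)‖ ≤ 1 / (4 * Δ) + (c 0 - c m) / 2 := by
    intro m
    induction m with
    | zero =>
      intro hm
      have h1 : ∑ i ∈ Finset.range (0 + 1), unitExp (F i) - unitExp (F (0 + 1)) * geomRecip (g 0)
          = -(unitExp (F 0) * geomRecip (g 0)) := by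
        rw [zero_add, Finset.sum_range_one]
        linear_combination hE 0 hm
      rw [h1, norm_neg, norm_mul, norm_unitExp, one_mul, sub_self, zero_div, add_zero]
      exact norm_geomRecip_le hΔ (hlo 0 hm) (hhi 0 hm)
    | succ m ih =>
      intro hm
      have h1 : ∑ i ∈ Finset.range (m + 1 + 1), unitExp (F i) -
          unitExp (F (m + 1 + 1)) * geomRecip (g (m + 1)) =
          (∑ i ∈ Finset.range (m + 1), unitExp (F i) - unitExp (F (m + 1)) * geomRecip (g m)) +
          unitExp (F (m + 1)) * (geomRecip (g m) - geomRecip (g (m + 1))) := by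
        rw [Finset.sum_range_succ]
        linear_combination hE (m + 1) hm
      have h2 : geomRecip (g m) - geomRecip (g (m + 1)) =
          -(Complex.I / 2 * ((c m - c (m + 1) : ℝ) : ℂ)) := by
        simp only [geomRecip, hc]; push_cast; ring
      have h3 : c (m + 1) ≤ c m := by
        have hs1 := hsin m (by omega)
        have hs2 := hsin (m + 1) hm
        have hm1 : g m ≤ g (m + 1) := hmono m (by omega)
        have h4 : g (m + 1) ≤ 1 - Δ := hhi (m + 1) hm
        have h5 : Δ ≤ g m := hlo m (by omega)
        have := Real.pi_pos
        refine cot_sub_cot_nonneg (by linarith) (by linarith) (by gcongr) ?_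
        nlinarith
      have h4 : ‖unitExp (F (m + 1)) * (geomRecip (g m) - geomRecip (g (m + 1)))‖ =
          (c m - c (m + 1)) / 2 := by
        rw [norm_mul, norm_unitExp, one_mul, h2, norm_neg, norm_mul, Complex.norm_real,
          Real.norm_of_nonneg (by linarith)]
        simp
        ring
      rw [h1]
      refine (norm_add_le _ _).trans ?_
      rw [h4]
      have := ih (by omega)
      linarith
  have h1 := key n (by omega)
  have h2 : ‖unitExp (F (n + 1)) * geomRecip (g n)‖ ≤ 1 / (4 * Δ) := by
    rw [norm_mul, norm_unitExp, one_mul]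
    exact norm_geomRecip_le hΔ (hlo n (by omega)) (hhi n (by omega))
  have h3 := norm_add_le (∑ i ∈ Finset.range (n + 1), unitExp (F i) -
      unitExp (F (n + 1)) * geomRecip (g n)) (unitExp (F (n + 1)) * geomRecip (g n))
  rw [sub_add_cancel] at h3
  have h4 := abs_le.1 (hcabs 0 (by omega))
  have h5 := abs_le.1 (hcabs n (by omega))
  have h6 : 1 / (4 * Δ) = 1 / Δ / 4 := by ring
  have h7 : 1 / (2 * Δ) = 1 / Δ / 2 := by ring
  rw [h7] at h4 h5
  rw [h6] at h1 h2
  linarith [h4.2, h5.1]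

/-- The Kusmin–Landau inequality: an exponential sum whose increments are monotone and stay at
distance at least `Δ` from the integers is at most `1 / Δ`. -/
lemma norm_sum_unitExp_le_of_monotone_increment (F : ℕ → ℝ) (n : ℕ) {Δ : ℝ} (hΔ : 0 < Δ) (j : ℤ)
    (hmono : ∀ i, i + 1 < n → F (i + 1) - F i ≤ F (i + 2) - F (i + 1))
    (hlo : ∀ i < n, j + Δ ≤ F (i + 1) - F i) (hhi : ∀ i < n, F (i + 1) - F i ≤ j + 1 - Δ) :
    ‖∑ i ∈ Finset.range n, unitExp (F i)‖ ≤ 1 / Δ := by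
  have h : ∀ i : ℕ, unitExp (F i) = unitExp (F i - j * i) := by
    intro i
    have : F i = (F i - j * i) + ((j * i : ℤ) : ℝ) := by push_cast; ring
    conv_lhs => rw [this, unitExp_add, unitExp_int, mul_one]
  simp_rw [h]
  refine norm_sum_unitExp_le_of_monotone_increment_aux (fun i => F i - j * i) n hΔ ?_ ?_ ?_
  · intro i hi
    have := hmono i hi
    push_cast; linarith
  · intro i hi
    have := hlo i hi
    push_cast; linarith
  · intro i hi
    have := hhi i hi
    push_cast; linarith

/-- A property of the indices below `n` that is inherited by smaller indices holds exactly on an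
initial segment. -/
lemma exists_threshold (P : ℕ → Prop) (n : ℕ) (hP : ∀ i j, i ≤ j → j < n → P j → P i) :
    ∃ p ≤ n, ∀ i < n, (P i ↔ i < p) := by
  classical
  have hex : ∃ i, i = n ∨ ¬ P i := ⟨n, Or.inl rfl⟩
  refine ⟨Nat.find hex, Nat.find_min' hex (Or.inl rfl), fun i hi => ⟨fun h => ?_, fun h => ?_⟩⟩
  · by_contra hle
    push Not at hle
    rcases Nat.find_spec hex with h1 | h1
    · omega
    · exact h1 (hP _ _ hle hi h)
  · have := Nat.find_min hex h
    push Not at this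
    exact this.2

/-- The elements of `range n` where a monotone sequence takes values in `[a, b)` form an
interval. -/
lemma filter_range_monotone_eq_Ico (g : ℕ → ℝ) (n : ℕ) (hg : ∀ i j, i ≤ j → j < n → g i ≤ g j)
    {a b : ℝ} (hab : a ≤ b) :
    ∃ p q, p ≤ q ∧ q ≤ n ∧ (Finset.range n).filter (fun i => a ≤ g i ∧ g i < b) =
      Finset.Ico p q := by
  obtain ⟨p, hp, hp'⟩ := exists_threshold (fun i => g i < a) n
    fun i j hij hj h => (hg i j hij hj).trans_lt h
  obtain ⟨q, hq, hq'⟩ := exists_threshold (fun i => g i < b) n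
    fun i j hij hj h => (hg i j hij hj).trans_lt h
  refine ⟨p, q, ?_, hq, ?_⟩
  · by_contra h
    push Not at h
    have h1 := (hp' q (by omega)).2 h
    have h2 := (hq' q (by omega)).1 (h1.trans_le hab)
    omega
  · ext i
    simp only [Finset.mem_filter, Finset.mem_range, Finset.mem_Ico]
    constructor
    · rintro ⟨hi, h1, h2⟩
      refine ⟨?_, (hq' i hi).1 h2⟩
      by_contra h
      push Not at h
      exact absurd ((hp' i hi).2 h) (not_lt.2 h1)
    · rintro ⟨h1, h2⟩
      have hi : i < n := by omega
      refine ⟨hi, ?_, (hq' i hi).2 h2⟩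
      by_contra h
      push Not at h
      exact absurd ((hp' i hi).1 h) (not_lt.2 h1)

/-- Points of a monotone sequence with increments at least `lam` that fall into a window of
length `w`. -/
lemma card_filter_window_le (g : ℕ → ℝ) (n : ℕ) {lam : ℝ} (hlam : 0 < lam)
    (hg : ∀ i, i + 1 < n → lam ≤ g (i + 1) - g i) {a b : ℝ} (hab : a ≤ b) :
    (((Finset.range n).filter (fun i => a ≤ g i ∧ g i < b)).card : ℝ) ≤ (b - a) / lam + 1 := by
  have hinc : ∀ i k, i + k < n → g i + k * lam ≤ g (i + k) := by
    intro i k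
    induction k with
    | zero => intro _; simp
    | succ k ih =>
      intro h
      have h1 := ih (by omega)
      have h2 := hg (i + k) (by omega)
      push_cast
      rw [← add_assoc i k 1]
      linarith
  obtain ⟨p, q, hpq, hq, heq⟩ := filter_range_monotone_eq_Ico g n (fun i j hij hj => by
    obtain ⟨k, rfl⟩ := Nat.exists_eq_add_of_le hij
    have := hinc i k hj
    have h0 : 0 ≤ (k : ℝ) * lam := by positivity
    linarith) hab
  rw [heq, Nat.card_Ico]
  rcases hpq.eq_or_lt with rfl | hlt
  · simp
    have : 0 ≤ (b - a) / lam := div_nonneg (by linarith) hlam.le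
    linarith
  · have hp := (Finset.ext_iff.1 heq p).2 (Finset.mem_Ico.2 ⟨le_rfl, hlt⟩)
    have hq1 := (Finset.ext_iff.1 heq (q - 1)).2 (Finset.mem_Ico.2 ⟨by omega, by omega⟩)
    simp only [Finset.mem_filter] at hp hq1
    have h := hinc p (q - 1 - p) (by omega)
    rw [show p + (q - 1 - p) = q - 1 by omega] at h
    have h2 : ((q - 1 - p : ℕ) : ℝ) = ((q - p : ℕ) : ℝ) - 1 := by
      rw [show q - p = (q - 1 - p) + 1 by omega]; push_cast; ring
    rw [h2] at h
    rw [← sub_le_iff_le_add, le_div_iff₀ hlam]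
    linarith [hp.2.1, hq1.2.2]

/-! ### The second derivative test -/

lemma sum_filter_window_split (g : ℕ → ℝ) (f : ℕ → ℂ) (n : ℕ) {a b c : ℝ} (hab : a ≤ b)
    (hbc : b ≤ c) :
    ∑ i ∈ (Finset.range n).filter (fun i => a ≤ g i ∧ g i < c), f i =
      ∑ i ∈ (Finset.range n).filter (fun i => a ≤ g i ∧ g i < b), f i +
      ∑ i ∈ (Finset.range n).filter (fun i => b ≤ g i ∧ g i < c), f i := by
  rw [← Finset.sum_union]
  · congr 1
    ext i
    simp only [Finset.mem_filter, Finset.mem_union]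
    constructor
    · rintro ⟨h, h1, h2⟩
      rcases lt_or_ge (g i) b with h3 | h3
      · exact Or.inl ⟨h, h1, h3⟩
      · exact Or.inr ⟨h, h3, h2⟩
    · rintro (⟨h, h1, h2⟩ | ⟨h, h1, h2⟩)
      · exact ⟨h, h1, h2.trans_le hbc⟩
      · exact ⟨h, hab.trans h1, h2⟩
  · rw [Finset.disjoint_filter]
    rintro i _ ⟨_, h1⟩ ⟨h2, _⟩
    exact absurd h1 (not_lt.2 h2)

/-- Van der Corput's second derivative test, for sequences with second differences in
`[lam, Lam]`. The increments cross at most `Lam * n + 2` integers; near each of them the terms are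
counted, and in between the Kusmin–Landau inequality applies. -/
lemma norm_sum_unitExp_le_of_second_difference (F : ℕ → ℝ) (n : ℕ) {lam Lam Δ : ℝ}
    (hlam : 0 < lam) (hΔ : 0 < Δ) (hΔ' : Δ ≤ 1 / 2)
    (hlo : ∀ i, i + 1 < n → lam ≤ F (i + 2) - F (i + 1) - (F (i + 1) - F i))
    (hhi : ∀ i, i + 1 < n → F (i + 2) - F (i + 1) - (F (i + 1) - F i) ≤ Lam) (hLam : 0 ≤ Lam) :
    ‖∑ i ∈ Finset.range n, unitExp (F i)‖ ≤ (Lam * n + 2) * (1 / Δ + 2 * (Δ / lam + 1)) := by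
  rcases Nat.eq_zero_or_pos n with rfl | hn
  · simp; positivity
  set g : ℕ → ℝ := fun i => F (i + 1) - F i with hg
  have hmono : ∀ i j, i ≤ j → j < n → g i ≤ g j := by
    intro i j hij
    induction j, hij using Nat.le_induction with
    | base => intro _; exact le_rfl
    | succ j _ ih =>
      intro hj
      have h1 := ih (by omega)
      have h2 := hlo j hj
      simp only [hg] at h1 ⊢
      linarith
  have hupper : ∀ j, j < n → g j ≤ g 0 + Lam * j := by
    intro j
    induction j with
    | zero => intro _; simp
    | succ j ih =>
      intro hj
      have h1 := ih (by omega)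
      have h2 := hhi j hj
      simp only [hg] at h1 ⊢
      push_cast
      linarith
  set J : Finset ℤ := Finset.Icc ⌊g 0⌋ ⌊g (n - 1)⌋ with hJ
  have hmaps : ∀ i ∈ Finset.range n, ⌊g i⌋ ∈ J := by
    intro i hi
    rw [Finset.mem_range] at hi
    rw [hJ, Finset.mem_Icc]
    exact ⟨Int.floor_mono (hmono 0 i (by omega) hi), Int.floor_mono (hmono i (n - 1) (by omega)
      (by omega))⟩
  have hJcard : (J.card : ℝ) ≤ Lam * n + 2 := by
    have h1 : ⌊g 0⌋ ≤ ⌊g (n - 1)⌋ := Int.floor_mono (hmono 0 (n - 1) (by omega) (by omega))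
    rw [hJ, Int.card_Icc]
    have h2 : (((⌊g (n - 1)⌋ + 1 - ⌊g 0⌋).toNat : ℕ) : ℝ) = (⌊g (n - 1)⌋ : ℝ) + 1 - ⌊g 0⌋ := by
      have := Int.toNat_of_nonneg (show 0 ≤ ⌊g (n - 1)⌋ + 1 - ⌊g 0⌋ by omega)
      exact_mod_cast congrArg (Int.cast : ℤ → ℝ) this
    rw [h2]
    have h3 := Int.floor_le (g (n - 1))
    have h4 := Int.lt_floor_add_one (g 0)
    have h5 := hupper (n - 1) (by omega)
    have h6 : ((n - 1 : ℕ) : ℝ) ≤ n := by exact_mod_cast Nat.sub_le n 1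
    have h7 := mul_le_mul_of_nonneg_left h6 hLam
    linarith
  -- Split according to the integer part of the increment.
  rw [← Finset.sum_fiberwise_of_maps_to hmaps]
  refine (norm_sum_le _ _).trans ?_
  have hfib : ∀ j ∈ J, ‖∑ i ∈ (Finset.range n).filter (fun i => ⌊g i⌋ = j), unitExp (F i)‖ ≤
      1 / Δ + 2 * (Δ / lam + 1) := by
    intro j _
    have h1 : (Finset.range n).filter (fun i => ⌊g i⌋ = j) =
        (Finset.range n).filter (fun i => (j : ℝ) ≤ g i ∧ g i < (j : ℝ) + 1) := by
      refine Finset.filter_congr fun i _ => ?_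
      rw [Int.floor_eq_iff]
    rw [h1, sum_filter_window_split g _ n (b := j + Δ) (by linarith) (by linarith),
      sum_filter_window_split g _ n (a := j + Δ) (b := j + 1 - Δ) (by linarith) (by linarith)]
    -- Increments within `Δ` of an integer.
    have hcard : ∀ a b : ℝ, a ≤ b → b - a = Δ →
        ‖∑ i ∈ (Finset.range n).filter (fun i => a ≤ g i ∧ g i < b), unitExp (F i)‖ ≤
          Δ / lam + 1 := by
      intro a b hab hd
      refine (norm_sum_unitExp_le_card _ _).trans ?_
      rw [← hd]
      exact card_filter_window_le g n hlam hlo hab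
    have h2 := hcard j (j + Δ) (by linarith) (by ring)
    have h3 := hcard (j + 1 - Δ) (j + 1) (by linarith) (by ring)
    have h4 : ‖∑ i ∈ (Finset.range n).filter (fun i => (j : ℝ) + Δ ≤ g i ∧ g i < j + 1 - Δ),
        unitExp (F i)‖ ≤ 1 / Δ := by
      obtain ⟨p, q, hpq, hq, heq⟩ := filter_range_monotone_eq_Ico g n hmono
        (a := (j : ℝ) + Δ) (b := j + 1 - Δ) (by linarith)
      have hmem : ∀ i, i < q - p → (j : ℝ) + Δ ≤ g (p + i) ∧ g (p + i) < j + 1 - Δ := by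
        intro i hi
        have := (Finset.ext_iff.1 heq (p + i)).2 (Finset.mem_Ico.2 ⟨by omega, by omega⟩)
        exact (Finset.mem_filter.1 this).2
      rw [heq, Finset.sum_Ico_eq_sum_range]
      refine norm_sum_unitExp_le_of_monotone_increment (fun i => F (p + i)) (q - p) hΔ j ?_ ?_ ?_
      · intro i hi
        have := hlo (p + i) (by omega)
        simp only [← add_assoc] at this ⊢
        linarith
      · intro i hi
        exact (hmem i hi).1
      · intro i hi
        exact (hmem i hi).2.le
    refine (norm_add_le _ _).trans ?_
    have h5 := norm_add_le
      (∑ i ∈ (Finset.range n).filter (fun i => (j : ℝ) + Δ ≤ g i ∧ g i < j + 1 - Δ), unitExp (F i))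
      (∑ i ∈ (Finset.range n).filter (fun i => (j : ℝ) + 1 - Δ ≤ g i ∧ g i < j + 1), unitExp (F i))
    linarith
  refine (Finset.sum_le_card_nsmul _ _ _ hfib).trans ?_
  rw [nsmul_eq_mul]
  gcongr

/-! ### Periodic trapezoids and their Fourier expansion -/

/-- Half the periodized second Bernoulli polynomial. -/
noncomputable def halfBernoulli (t : ℝ) : ℝ :=
  (Int.fract t ^ 2 - Int.fract t) / 2 + 1 / 12

/-- The Fourier coefficients of `halfBernoulli`. The formula also gives the right value `0` at
`k = 0`, since `1 / 0 = 0`. -/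
noncomputable def halfBernoulliCoeff (k : ℤ) : ℂ := 1 / (4 * Real.pi ^ 2 * k ^ 2)

lemma sum_halfBernoulliCoeff (t : ℝ) (L : ℕ) :
    ∑ k ∈ Finset.Icc (-(L : ℤ)) L, halfBernoulliCoeff k * unitExp (k * t) =
      ((∑ n ∈ Finset.range (L + 1),
        1 / (n : ℝ) ^ 2 * Real.cos (2 * Real.pi * n * t) / (2 * Real.pi ^ 2) : ℝ) : ℂ) := by
  induction L with
  | zero => simp [halfBernoulliCoeff]
  | succ L ih =>
    have h : Finset.Icc (-((L + 1 : ℕ) : ℤ)) ((L + 1 : ℕ) : ℤ) =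
        insert (-((L + 1 : ℕ) : ℤ)) (insert ((L + 1 : ℕ) : ℤ) (Finset.Icc (-(L : ℤ)) L)) := by
      ext k
      simp only [Finset.mem_Icc, Finset.mem_insert]
      push_cast
      omega
    rw [h, Finset.sum_insert, Finset.sum_insert, ih, Finset.sum_range_succ _ (L + 1)]
    · have h1 : unitExp ((((L + 1 : ℕ) : ℤ) : ℝ) * t) + unitExp (((-((L + 1 : ℕ) : ℤ) : ℤ) : ℝ) * t)
          = 2 * (Real.cos (2 * Real.pi * ((L + 1 : ℕ) : ℝ) * t) : ℂ) := by
        rw [Complex.ofReal_cos, Complex.cos, unitExp, unitExp]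
        push_cast
        ring_nf
      have h2 : halfBernoulliCoeff (-((L + 1 : ℕ) : ℤ)) = halfBernoulliCoeff ((L + 1 : ℕ) : ℤ) := by
        simp [halfBernoulliCoeff]
        ring_nf
      have h3 : halfBernoulliCoeff ((L + 1 : ℕ) : ℤ) * 2 =
          1 / (((L + 1 : ℕ) : ℂ) ^ 2) / (2 * (Real.pi : ℂ) ^ 2) := by
        have : (Real.pi : ℂ) ≠ 0 := by exact_mod_cast Real.pi_ne_zero
        have : ((L + 1 : ℕ) : ℂ) ≠ 0 := by exact_mod_cast Nat.succ_ne_zero L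
        rw [halfBernoulliCoeff]
        rw [Int.cast_natCast]
        field_simp
        norm_num
      rw [h2, Complex.ofReal_add]
      simp only [Complex.ofReal_div, Complex.ofReal_mul, Complex.ofReal_pow, Complex.ofReal_one,
        Complex.ofReal_natCast, Complex.ofReal_ofNat]
      linear_combination halfBernoulliCoeff ((L + 1 : ℕ) : ℤ) * h1 +
        (Real.cos (2 * Real.pi * ((L + 1 : ℕ) : ℝ) * t) : ℂ) * h3
    · simp
    · simp only [Finset.mem_insert, Finset.mem_Icc]
      push_cast
      omega

lemma hasSum_halfBernoulli (t : ℝ) :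
    HasSum (fun n : ℕ => 1 / (n : ℝ) ^ 2 * Real.cos (2 * Real.pi * n * t) / (2 * Real.pi ^ 2))
      (halfBernoulli t) := by
  have h := hasSum_one_div_nat_pow_mul_cos (k := 1) one_ne_zero (x := Int.fract t)
    ⟨Int.fract_nonneg t, (Int.fract_lt_one t).le⟩
  have h2 := h.div_const (2 * Real.pi ^ 2)
  have hf : (fun n : ℕ => 1 / (n : ℝ) ^ 2 * Real.cos (2 * Real.pi * n * t) / (2 * Real.pi ^ 2)) =
      fun n : ℕ => 1 / (n : ℝ) ^ (2 * 1) * Real.cos (2 * Real.pi * n * Int.fract t) /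
        (2 * Real.pi ^ 2) := by
    funext n
    have h3 : 2 * Real.pi * n * t =
        2 * Real.pi * n * Int.fract t + ((n * ⌊t⌋ : ℤ) : ℝ) * (2 * Real.pi) := by
      have := Int.floor_add_fract t
      conv_lhs => rw [← this]
      push_cast; ring
    rw [h3, Real.cos_add_int_mul_two_pi]
  have hB : (Polynomial.map (algebraMap ℚ ℝ) (Polynomial.bernoulli (2 * 1))).eval (Int.fract t) =
      Int.fract t ^ 2 - Int.fract t + 1 / 6 := by
    simp [Polynomial.bernoulli, Finset.sum_range_succ, Polynomial.eval_add, bernoulli_one,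
      bernoulli_zero, bernoulli_two, ← Polynomial.C_mul_X_pow_eq_monomial]
    ring
  have hv : halfBernoulli t = (-1 : ℝ) ^ (1 + 1) * (2 * Real.pi) ^ (2 * 1) / 2 /
      ((2 * 1).factorial : ℝ) *
      (Polynomial.map (algebraMap ℚ ℝ) (Polynomial.bernoulli (2 * 1))).eval (Int.fract t) /
        (2 * Real.pi ^ 2) := by
    rw [hB, halfBernoulli]
    have := Real.pi_ne_zero
    simp
    field_simp
    ring
  rw [hf, hv]
  exact h2

lemma norm_halfBernoulli_sub_le (t : ℝ) {L : ℕ} (hL : 0 < L) :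
    ‖(halfBernoulli t : ℂ) - ∑ k ∈ Finset.Icc (-(L : ℤ)) L, halfBernoulliCoeff k * unitExp (k * t)‖
      ≤ 1 / (4 * L) := by
  rw [sum_halfBernoulliCoeff, ← Complex.ofReal_sub, Complex.norm_real, Real.norm_eq_abs]
  have hlim := ((hasSum_halfBernoulli t).tendsto_sum_nat.sub_const
    (∑ n ∈ Finset.range (L + 1),
      1 / (n : ℝ) ^ 2 * Real.cos (2 * Real.pi * n * t) / (2 * Real.pi ^ 2))).abs
  refine le_of_tendsto hlim ?_
  filter_upwards [Filter.eventually_ge_atTop (L + 1)] with m hm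
  rw [← Finset.sum_Ico_eq_sub _ hm]
  refine (Finset.abs_sum_le_sum_abs _ _).trans ?_
  have hpi : (4 : ℝ) ≤ 2 * Real.pi ^ 2 := by nlinarith [Real.pi_gt_three]
  have hbd : ∀ n ∈ Finset.Ico (L + 1) m,
      |1 / (n : ℝ) ^ 2 * Real.cos (2 * Real.pi * n * t) / (2 * Real.pi ^ 2)| ≤
        ((n : ℝ) ^ 2)⁻¹ * (1 / 4) := by
    intro n _
    rw [abs_div, abs_mul, abs_of_nonneg (show (0 : ℝ) ≤ 1 / (n : ℝ) ^ 2 by positivity),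
      abs_of_nonneg (show (0 : ℝ) ≤ 2 * Real.pi ^ 2 by positivity), div_eq_mul_one_div, ← one_div]
    have h1 := Real.abs_cos_le_one (2 * Real.pi * n * t)
    have h2 : 1 / (2 * Real.pi ^ 2) ≤ 1 / 4 := one_div_le_one_div_of_le (by norm_num) hpi
    have h3 : (0 : ℝ) ≤ 1 / (n : ℝ) ^ 2 := by positivity
    have h4 : 1 / (n : ℝ) ^ 2 * |Real.cos (2 * Real.pi * n * t)| ≤ 1 / (n : ℝ) ^ 2 * 1 := by gcongr
    rw [mul_one] at h4
    have h5 : (0 : ℝ) ≤ 1 / (2 * Real.pi ^ 2) := by positivity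
    gcongr
  refine (Finset.sum_le_sum hbd).trans ?_
  rw [← Finset.sum_mul]
  have hset : Finset.Ico (L + 1) m = Finset.Ioc L (m - 1) := by
    ext i; simp only [Finset.mem_Ico, Finset.mem_Ioc]; omega
  have h1 := sum_Ioc_inv_sq_le_sub (α := ℝ) (k := L) (n := m - 1) hL.ne' (by omega)
  rw [hset]
  have h2 : (0 : ℝ) ≤ (((m - 1 : ℕ) : ℝ))⁻¹ := by positivity
  have h3 : 1 / (4 * (L : ℝ)) = (L : ℝ)⁻¹ * (1 / 4) := by
    rw [one_div, mul_inv]; ring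
  rw [h3]
  gcongr
  linarith

/-- The trapezoid of period one with integral `p` that rises on `[0, κ]`, equals `1` on `[κ, p]`
and falls on `[p, p + κ]`. It is written as a second difference of Bernoulli polynomials, from which
its Fourier coefficients can be read off. -/
noncomputable def trapezoid (p κ t : ℝ) : ℝ :=
  p - (halfBernoulli t - halfBernoulli (t - p) - halfBernoulli (t - κ) +
    halfBernoulli (t - (p + κ))) / κ

lemma halfBernoulli_sub (t : ℝ) {c : ℝ} (h0 : 0 ≤ c) (h1 : c ≤ 1) :
    halfBernoulli (t - c) = ((Int.fract t - c) ^ 2 - |Int.fract t - c|) / 2 + 1 / 12 := by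
  rcases le_or_gt c (Int.fract t) with h | h
  · have : Int.fract (t - c) = Int.fract t - c := by
      rw [Int.fract_eq_iff]
      refine ⟨by linarith, by linarith [Int.fract_lt_one t], ⌊t⌋, ?_⟩
      rw [Int.fract]; ring
    rw [halfBernoulli, this, abs_of_nonneg (by linarith)]
  · have : Int.fract (t - c) = Int.fract t - c + 1 := by
      rw [Int.fract_eq_iff]
      refine ⟨by linarith [Int.fract_nonneg t], by linarith, ⌊t⌋ - 1, ?_⟩
      rw [Int.fract]; push_cast; ring
    rw [halfBernoulli, this, abs_of_neg (by linarith)]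
    ring

lemma trapezoid_eq {p κ : ℝ} (t : ℝ) (hp : 0 ≤ p) (hκ : 0 < κ) (h1 : p + κ ≤ 1) :
    trapezoid p κ t = (Int.fract t - |Int.fract t - κ| - |Int.fract t - p| +
      |Int.fract t - (p + κ)|) / (2 * κ) := by
  have h0 := halfBernoulli_sub t le_rfl zero_le_one
  rw [sub_zero, sub_zero, abs_of_nonneg (Int.fract_nonneg t)] at h0
  rw [trapezoid, h0, halfBernoulli_sub t hp (by linarith), halfBernoulli_sub t hκ.le (by linarith),
    halfBernoulli_sub t (by linarith) h1]
  field_simp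
  ring

lemma trapezoid_nonneg {p κ : ℝ} (t : ℝ) (hp : κ ≤ p) (hκ : 0 < κ) (h1 : p + κ ≤ 1) :
    0 ≤ trapezoid p κ t := by
  rw [trapezoid_eq t (hκ.le.trans hp) hκ h1]
  have h0 := Int.fract_nonneg t
  apply div_nonneg _ (by linarith)
  rcases abs_cases (Int.fract t - κ) with h | h <;> rcases abs_cases (Int.fract t - p) with h' | h'
    <;> rcases abs_cases (Int.fract t - (p + κ)) with h'' | h'' <;> linarith

lemma trapezoid_le_one {p κ : ℝ} (t : ℝ) (hp : κ ≤ p) (hκ : 0 < κ) (h1 : p + κ ≤ 1) :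
    trapezoid p κ t ≤ 1 := by
  rw [trapezoid_eq t (hκ.le.trans hp) hκ h1]
  have h0 := Int.fract_nonneg t
  rw [div_le_one (by linarith)]
  rcases abs_cases (Int.fract t - κ) with h | h <;> rcases abs_cases (Int.fract t - p) with h' | h'
    <;> rcases abs_cases (Int.fract t - (p + κ)) with h'' | h'' <;> linarith

lemma trapezoid_eq_one {p κ : ℝ} (t : ℝ) (hp : κ ≤ p) (hκ : 0 < κ) (h1 : p + κ ≤ 1)
    (h : κ ≤ Int.fract t) (h' : Int.fract t ≤ p) : trapezoid p κ t = 1 := by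
  rw [trapezoid_eq t (hκ.le.trans hp) hκ h1, abs_of_nonneg (by linarith),
    abs_of_nonpos (by linarith), abs_of_nonpos (by linarith), div_eq_one_iff_eq (by linarith)]
  ring

lemma trapezoid_eq_zero {p κ : ℝ} (t : ℝ) (hp : κ ≤ p) (hκ : 0 < κ) (h1 : p + κ ≤ 1)
    (h : p + κ ≤ Int.fract t) : trapezoid p κ t = 0 := by
  rw [trapezoid_eq t (hκ.le.trans hp) hκ h1, abs_of_nonneg (by linarith),
    abs_of_nonneg (by linarith), abs_of_nonneg (by linarith)]
  ring

/-- The Fourier coefficients of the trapezoid. -/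
noncomputable def trapezoidCoeff (p κ : ℝ) (k : ℤ) : ℂ :=
  if k = 0 then (p : ℂ) else
    -(halfBernoulliCoeff k * (1 - unitExp (-(k * p))) * (1 - unitExp (-(k * κ)))) / κ

lemma norm_one_sub_unitExp_le (t : ℝ) : ‖1 - unitExp t‖ ≤ 2 * Real.pi * |t| := by
  have h : unitExp t = Complex.exp (Complex.I * ((2 * Real.pi * t : ℝ) : ℂ)) := by
    rw [unitExp]; push_cast; ring_nf
  rw [norm_sub_rev, h]
  refine (Real.norm_exp_I_mul_ofReal_sub_one_le).trans ?_
  rw [Real.norm_eq_abs, abs_mul, abs_of_pos (by positivity)]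

lemma norm_trapezoidCoeff_le {p κ : ℝ} (hp : 0 ≤ p) (hκ : 0 < κ) (k : ℤ) :
    ‖trapezoidCoeff p κ k‖ ≤ p := by
  rw [trapezoidCoeff]
  split_ifs with hk
  · rw [Complex.norm_real, Real.norm_of_nonneg hp]
  · have hk' : 0 < |(k : ℝ)| := abs_pos.2 (by exact_mod_cast hk)
    have h1 := norm_one_sub_unitExp_le (-(k * p))
    have h2 := norm_one_sub_unitExp_le (-(k * κ))
    rw [abs_neg, abs_mul, abs_of_nonneg hp] at h1
    rw [abs_neg, abs_mul, abs_of_nonneg hκ.le] at h2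
    have h3 : ‖halfBernoulliCoeff k‖ = 1 / (4 * Real.pi ^ 2 * |(k : ℝ)| ^ 2) := by
      rw [halfBernoulliCoeff, norm_div, norm_mul, norm_mul, norm_pow, norm_pow, Complex.norm_intCast,
        Complex.norm_real, Real.norm_of_nonneg Real.pi_pos.le]
      simp
    rw [norm_div, norm_neg, norm_mul, norm_mul, Complex.norm_real, Real.norm_of_nonneg hκ.le,
      div_le_iff₀ hκ, h3]
    calc 1 / (4 * Real.pi ^ 2 * |(k : ℝ)| ^ 2) * ‖1 - unitExp (-(k * p))‖ *
          ‖1 - unitExp (-(k * κ))‖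
        ≤ 1 / (4 * Real.pi ^ 2 * |(k : ℝ)| ^ 2) * (2 * Real.pi * (|(k : ℝ)| * p)) *
          (2 * Real.pi * (|(k : ℝ)| * κ)) := by gcongr
      _ = p * κ := by
        have := Real.pi_ne_zero
        field_simp
        norm_num

lemma norm_trapezoid_sub_le {p κ : ℝ} (hκ : 0 < κ) (t : ℝ) {L : ℕ} (hL : 0 < L) :
    ‖(trapezoid p κ t : ℂ) - ∑ k ∈ Finset.Icc (-(L : ℤ)) L, trapezoidCoeff p κ k * unitExp (k * t)‖
      ≤ 1 / (κ * L) := by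
  set S : ℝ → ℂ := fun u =>
    ∑ k ∈ Finset.Icc (-(L : ℤ)) L, halfBernoulliCoeff k * unitExp (k * u) with hS
  have hκ' : (κ : ℂ) ≠ 0 := by exact_mod_cast hκ.ne'
  have h1 : ∑ k ∈ Finset.Icc (-(L : ℤ)) L, trapezoidCoeff p κ k * unitExp (k * t) =
      p - (S t - S (t - p) - S (t - κ) + S (t - (p + κ))) / κ := by
    have h2 : ∀ k ∈ Finset.Icc (-(L : ℤ)) L, trapezoidCoeff p κ k * unitExp (k * t) =
        (if k = 0 then (p : ℂ) else 0) - (halfBernoulliCoeff k * unitExp (k * t) -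
          halfBernoulliCoeff k * unitExp (k * (t - p)) -
          halfBernoulliCoeff k * unitExp (k * (t - κ)) +
          halfBernoulliCoeff k * unitExp (k * (t - (p + κ)))) / κ := by
      intro k _
      rw [trapezoidCoeff]
      split_ifs with hk
      · subst hk; simp [halfBernoulliCoeff, unitExp_zero]
      · have e1 : unitExp (k * (t - p)) = unitExp (k * t) * unitExp (-(k * p)) := by
          rw [← unitExp_add]; ring_nf
        have e2 : unitExp (k * (t - κ)) = unitExp (k * t) * unitExp (-(k * κ)) := by
          rw [← unitExp_add]; ring_nf
        have e3 : unitExp (k * (t - (p + κ))) =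
            unitExp (k * t) * unitExp (-(k * p)) * unitExp (-(k * κ)) := by
          rw [← unitExp_add, ← unitExp_add]; ring_nf
        rw [e1, e2, e3]
        field_simp
        ring
    rw [Finset.sum_congr rfl h2, Finset.sum_sub_distrib, Finset.sum_ite_eq', ← Finset.sum_div,
      Finset.sum_add_distrib, Finset.sum_sub_distrib, Finset.sum_sub_distrib, if_pos (by simp)]
  have e : (trapezoid p κ t : ℂ) - (p - (S t - S (t - p) - S (t - κ) + S (t - (p + κ))) / κ) =
      -(((halfBernoulli t : ℂ) - S t) - ((halfBernoulli (t - p) : ℂ) - S (t - p)) -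
        ((halfBernoulli (t - κ) : ℂ) - S (t - κ)) +
        ((halfBernoulli (t - (p + κ)) : ℂ) - S (t - (p + κ)))) / κ := by
    rw [trapezoid]; push_cast; ring
  have hb : ∀ u, ‖(halfBernoulli u : ℂ) - S u‖ ≤ 1 / (4 * L) := fun u =>
    norm_halfBernoulli_sub_le u hL
  rw [h1, e, norm_div, norm_neg, Complex.norm_real, Real.norm_of_nonneg hκ.le, div_le_iff₀ hκ]
  have h3 : 1 / (κ * L) * κ = 4 * (1 / (4 * (L : ℝ))) := by
    have : (0 : ℝ) < L := by exact_mod_cast hL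
    field_simp
  rw [h3]
  refine (norm_add_le _ _).trans ?_
  have h4 := (norm_sub_le ((halfBernoulli t : ℂ) - S t - ((halfBernoulli (t - p) : ℂ) - S (t - p)))
    ((halfBernoulli (t - κ) : ℂ) - S (t - κ)))
  have h5 := norm_sub_le ((halfBernoulli t : ℂ) - S t) ((halfBernoulli (t - p) : ℂ) - S (t - p))
  linarith [hb t, hb (t - p), hb (t - κ), hb (t - (p + κ))]

/-! ### Joint distribution of two sequences modulo one -/

/-- The exponential sums attached to the nonzero frequencies of a pair of sequences, added up in
absolute value over the box `|k|, |l| ≤ L`. -/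
noncomputable def weylTotal (u v : ℕ → ℝ) (B L : ℕ) : ℝ :=
  ∑ kl ∈ (Finset.Icc (-(L : ℤ)) L ×ˢ Finset.Icc (-(L : ℤ)) L).erase (0, 0),
    ‖∑ b ∈ Finset.range B, unitExp (kl.1 * u b + kl.2 * v b)‖

lemma weylTotal_nonneg (u v : ℕ → ℝ) (B L : ℕ) : 0 ≤ weylTotal u v B L :=
  Finset.sum_nonneg fun _ _ => norm_nonneg _

/-- Equidistribution of a pair of sequences, tested against a product of trapezoids. Truncating the
Fourier series at `L` costs `1 / (κ * L)`, and the frequency `(0, 0)` gives the main term. -/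
lemma abs_sum_trapezoid_mul_sub_le (u v : ℕ → ℝ) (B : ℕ) {L : ℕ} (hL : 0 < L) {p q κ : ℝ} (a : ℝ)
    (hκ : 0 < κ) (hp : κ ≤ p) (hp1 : p + κ ≤ 1) (hq : κ ≤ q) (hq1 : q + κ ≤ 1)
    (hτ : 1 / (κ * L) ≤ 1) :
    |∑ b ∈ Finset.range B, trapezoid p κ (u b + a) * trapezoid q κ (v b + a) - B * (p * q)| ≤
      3 * B * (1 / (κ * L)) + p * q * weylTotal u v B L := by
  set τ := 1 / (κ * L) with hτdef
  have hτ0 : 0 ≤ τ := by positivity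
  set K := Finset.Icc (-(L : ℤ)) L with hK
  set P : ℝ → ℂ := fun t => ∑ k ∈ K, trapezoidCoeff p κ k * unitExp (k * t) with hP
  set Q : ℝ → ℂ := fun t => ∑ k ∈ K, trapezoidCoeff q κ k * unitExp (k * t) with hQ
  have hp0 : 0 ≤ p := hκ.le.trans hp
  have hq0 : 0 ≤ q := hκ.le.trans hq
  have hPa : ∀ t, ‖(trapezoid p κ t : ℂ) - P t‖ ≤ τ := fun t => norm_trapezoid_sub_le hκ t hL
  have hQa : ∀ t, ‖(trapezoid q κ t : ℂ) - Q t‖ ≤ τ := fun t => norm_trapezoid_sub_le hκ t hL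
  have hTn : ∀ (r t : ℝ), κ ≤ r → r + κ ≤ 1 → ‖(trapezoid r κ t : ℂ)‖ ≤ 1 := by
    intro r t h1 h2
    rw [Complex.norm_real, Real.norm_of_nonneg (trapezoid_nonneg t h1 hκ h2)]
    exact trapezoid_le_one t h1 hκ h2
  have hprod : ∀ t t', ‖(trapezoid p κ t : ℂ) * trapezoid q κ t' - P t * Q t'‖ ≤ 3 * τ := by
    intro t t'
    have e : (trapezoid p κ t : ℂ) * trapezoid q κ t' - P t * Q t' =
        ((trapezoid p κ t : ℂ) - P t) * trapezoid q κ t' +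
          P t * ((trapezoid q κ t' : ℂ) - Q t') := by ring
    have h1 : ‖P t‖ ≤ 1 + τ := by
      have := norm_sub_norm_le (P t) (trapezoid p κ t : ℂ)
      rw [norm_sub_rev] at this
      linarith [hPa t, hTn p t hp hp1]
    rw [e]
    refine (norm_add_le _ _).trans ?_
    rw [norm_mul, norm_mul]
    have h2 := hTn q t' hq hq1
    have h3 := hPa t
    have h4 := hQa t'
    have h5 := mul_le_mul h3 h2 (norm_nonneg _) hτ0
    have h6 := mul_le_mul h1 h4 (norm_nonneg _) (by linarith)
    nlinarith
  have hexp : ∑ b ∈ Finset.range B, P (u b + a) * Q (v b + a) = ∑ kl ∈ K ×ˢ K,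
      trapezoidCoeff p κ kl.1 * trapezoidCoeff q κ kl.2 * unitExp (kl.1 * a + kl.2 * a) *
        ∑ b ∈ Finset.range B, unitExp (kl.1 * u b + kl.2 * v b) := by
    simp only [hP, hQ]
    simp_rw [Finset.sum_mul_sum, Finset.mul_sum]
    rw [Finset.sum_product, Finset.sum_comm]
    refine Finset.sum_congr rfl fun k _ => ?_
    rw [Finset.sum_comm]
    refine Finset.sum_congr rfl fun l _ => Finset.sum_congr rfl fun b _ => ?_
    have : unitExp (k * (u b + a)) * unitExp (l * (v b + a)) =
        unitExp (k * a + l * a) * unitExp (k * u b + l * v b) := by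
      rw [← unitExp_add, ← unitExp_add]; ring_nf
    linear_combination trapezoidCoeff p κ k * trapezoidCoeff q κ l * this
  have hmem : ((0 : ℤ), (0 : ℤ)) ∈ K ×ˢ K := by simp [hK]
  rw [← Finset.add_sum_erase _ _ hmem] at hexp
  have hzero : trapezoidCoeff p κ 0 * trapezoidCoeff q κ 0 *
      unitExp (((0 : ℤ) : ℝ) * a + ((0 : ℤ) : ℝ) * a) *
        ∑ b ∈ Finset.range B, unitExp (((0 : ℤ) : ℝ) * u b + ((0 : ℤ) : ℝ) * v b) =
      B * ((p : ℂ) * q) := by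
    simp [trapezoidCoeff, unitExp_zero]
    ring
  rw [hzero] at hexp
  have hrest : ‖∑ kl ∈ (K ×ˢ K).erase (0, 0),
      trapezoidCoeff p κ kl.1 * trapezoidCoeff q κ kl.2 * unitExp (kl.1 * a + kl.2 * a) *
        ∑ b ∈ Finset.range B, unitExp (kl.1 * u b + kl.2 * v b)‖ ≤ p * q * weylTotal u v B L := by
    refine (norm_sum_le _ _).trans ?_
    rw [weylTotal, Finset.mul_sum]
    refine Finset.sum_le_sum fun kl _ => ?_
    rw [norm_mul, norm_mul, norm_mul, norm_unitExp, mul_one]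
    gcongr
    · exact norm_trapezoidCoeff_le hp0 hκ _
    · exact norm_trapezoidCoeff_le hq0 hκ _
  have hdiff : ‖∑ b ∈ Finset.range B, ((trapezoid p κ (u b + a) : ℂ) * trapezoid q κ (v b + a) -
      P (u b + a) * Q (v b + a))‖ ≤ 3 * B * τ := by
    refine (norm_sum_le _ _).trans ((Finset.sum_le_card_nsmul _ _ _ fun b _ =>
      hprod (u b + a) (v b + a)).trans ?_)
    rw [nsmul_eq_mul, Finset.card_range]
    linarith
  rw [Finset.sum_sub_distrib, hexp] at hdiff
  have hcast : |∑ b ∈ Finset.range B, trapezoid p κ (u b + a) * trapezoid q κ (v b + a) -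
      B * (p * q)| = ‖∑ b ∈ Finset.range B, (trapezoid p κ (u b + a) : ℂ) *
        trapezoid q κ (v b + a) - B * ((p : ℂ) * q)‖ := by
    rw [← Real.norm_eq_abs, ← Complex.norm_real]
    push_cast
    rfl
  rw [hcast]
  refine le_trans ?_ (add_le_add hdiff hrest)
  refine le_trans (le_of_eq ?_) (norm_add_le _ _)
  congr 1
  ring

/-- Counting the indices at which two sequences both fall into prescribed arcs modulo one. The
arcs `[0, ρ)` and `[0, ρ')` are only prescribed up to `κ`. -/
lemma abs_card_filter_sub_le (u v : ℕ → ℝ) (B : ℕ) {L : ℕ} (hL : 0 < L) {ρ ρ' κ R : ℝ}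
    (i j : ℕ → Prop) [DecidablePred i] [DecidablePred j] (hκ : 0 < κ) (hρ : 3 * κ ≤ ρ)
    (hρ' : 3 * κ ≤ ρ') (hρR : ρ ≤ R) (hρR' : ρ' ≤ R) (hR : R + 3 * κ ≤ 1)
    (hτ : 1 / (κ * L) ≤ 1)
    (hilo : ∀ b < B, Int.fract (u b) < ρ - κ → i b) (hihi : ∀ b < B, i b → Int.fract (u b) < ρ + κ)
    (hjlo : ∀ b < B, Int.fract (v b) < ρ' - κ → j b)
    (hjhi : ∀ b < B, j b → Int.fract (v b) < ρ' + κ) :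
    |(((Finset.range B).filter (fun b => i b ∧ j b)).card : ℝ) - B * (ρ * ρ')| ≤
      B * (6 * κ * R) + 3 * B * (1 / (κ * L)) + 4 * R ^ 2 * weylTotal u v B L := by
  have hW := weylTotal_nonneg u v B L
  have hB : (0 : ℝ) ≤ B := Nat.cast_nonneg B
  have hcard : (((Finset.range B).filter (fun b => i b ∧ j b)).card : ℝ) =
      ∑ b ∈ Finset.range B, if i b ∧ j b then (1 : ℝ) else 0 := by
    rw [Finset.sum_boole]
  -- Majorize by trapezoids that equal `1` on the arcs.
  have hupper : ∑ b ∈ Finset.range B, (if i b ∧ j b then (1 : ℝ) else 0) ≤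
      ∑ b ∈ Finset.range B,
        trapezoid (ρ + 2 * κ) κ (u b + κ) * trapezoid (ρ' + 2 * κ) κ (v b + κ) := by
    refine Finset.sum_le_sum fun b hb => ?_
    rw [Finset.mem_range] at hb
    have hone : ∀ (r t : ℝ), 3 * κ ≤ r → r ≤ R → Int.fract t < r + κ →
        trapezoid (r + 2 * κ) κ (t + κ) = 1 := by
      intro r t h1 h2 h3
      have hf : Int.fract (t + κ) = Int.fract t + κ := by
        rw [Int.fract_eq_iff]
        refine ⟨by linarith [Int.fract_nonneg t], by linarith, ⌊t⌋, ?_⟩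
        rw [Int.fract]; ring
      refine trapezoid_eq_one _ (by linarith) hκ (by linarith) ?_ ?_
      · rw [hf]; linarith [Int.fract_nonneg t]
      · rw [hf]; linarith
    split_ifs with h
    · rw [hone ρ _ hρ hρR (hihi b hb h.1), hone ρ' _ hρ' hρR' (hjhi b hb h.2), one_mul]
    · exact mul_nonneg (trapezoid_nonneg _ (by linarith) hκ (by linarith))
        (trapezoid_nonneg _ (by linarith) hκ (by linarith))
  -- Minorize by trapezoids that vanish off the arcs.
  have hlower : ∑ b ∈ Finset.range B,
        trapezoid (ρ - 2 * κ) κ (u b + 0) * trapezoid (ρ' - 2 * κ) κ (v b + 0) ≤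
      ∑ b ∈ Finset.range B, (if i b ∧ j b then (1 : ℝ) else 0) := by
    refine Finset.sum_le_sum fun b hb => ?_
    rw [Finset.mem_range] at hb
    rw [add_zero, add_zero]
    split_ifs with h
    · exact mul_le_one₀ (trapezoid_le_one _ (by linarith) hκ (by linarith))
        (trapezoid_nonneg _ (by linarith) hκ (by linarith))
        (trapezoid_le_one _ (by linarith) hκ (by linarith))
    · have : ¬ i b ∨ ¬ j b := by tauto
      rcases this with h1 | h1
      · rw [trapezoid_eq_zero (u b) (by linarith) hκ (by linarith), zero_mul]
        by_contra h2
        exact h1 (hilo b hb (by linarith))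
      · rw [trapezoid_eq_zero (v b) (by linarith) hκ (by linarith), mul_zero]
        by_contra h2
        exact h1 (hjlo b hb (by linarith))
  have h1 := abs_le.1 (abs_sum_trapezoid_mul_sub_le u v B hL (p := ρ + 2 * κ) (q := ρ' + 2 * κ) κ hκ
    (by linarith) (by linarith) (by linarith) (by linarith) hτ)
  have h2 := abs_le.1 (abs_sum_trapezoid_mul_sub_le u v B hL (p := ρ - 2 * κ) (q := ρ' - 2 * κ) 0 hκ
    (by linarith) (by linarith) (by linarith) (by linarith) hτ)
  have h3 : (ρ + 2 * κ) * (ρ' + 2 * κ) ≤ ρ * ρ' + 6 * κ * R := by nlinarith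
  have h4 : ρ * ρ' - 6 * κ * R ≤ (ρ - 2 * κ) * (ρ' - 2 * κ) := by nlinarith
  have h5 : (ρ + 2 * κ) * (ρ' + 2 * κ) ≤ 4 * R ^ 2 := by
    have : (ρ + 2 * κ) * (ρ' + 2 * κ) ≤ (2 * R) * (2 * R) :=
      mul_le_mul (by linarith) (by linarith) (by linarith) (by linarith)
    linarith
  have h6 : (ρ - 2 * κ) * (ρ' - 2 * κ) ≤ 4 * R ^ 2 := by
    have : (ρ - 2 * κ) * (ρ' - 2 * κ) ≤ (2 * R) * (2 * R) :=
      mul_le_mul (by linarith) (by linarith) (by linarith) (by linarith)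
    linarith
  have h7 := mul_le_mul_of_nonneg_left h3 hB
  have h8 := mul_le_mul_of_nonneg_left h4 hB
  have h9 := mul_le_mul_of_nonneg_right h5 hW
  have h10 := mul_le_mul_of_nonneg_right h6 hW
  rw [hcard, abs_le]
  constructor
  · linarith [h2.1]
  · linarith [h1.2]

/-! ### The phase and its curvature -/

/-- The mean value theorem for second differences. -/
lemma exists_second_difference_eq (f f' f'' : ℝ → ℝ) (a : ℝ)
    (hf : ∀ y ∈ Set.Icc a (a + 2), HasDerivAt f (f' y) y)
    (hf' : ∀ y ∈ Set.Icc a (a + 2), HasDerivAt f' (f'' y) y) :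
    ∃ ξ ∈ Set.Icc a (a + 2), f (a + 2) - f (a + 1) - (f (a + 1) - f a) = f'' ξ := by
  have h1 : ∀ y ∈ Set.Icc a (a + 1), HasDerivAt (fun y => f (y + 1) - f y) (f' (y + 1) - f' y) y := by
    intro y hy
    have h2 := (hf (y + 1) ⟨by linarith [hy.1], by linarith [hy.2]⟩).comp_add_const y 1
    exact h2.sub (hf y ⟨hy.1, by linarith [hy.2]⟩)
  obtain ⟨ξ, hξ, hξ'⟩ := exists_hasDerivAt_eq_slope (fun y => f (y + 1) - f y)
    (fun y => f' (y + 1) - f' y) (show a < a + 1 by linarith)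
    (fun y hy => (h1 y hy).continuousAt.continuousWithinAt)
    (fun y hy => h1 y ⟨hy.1.le, hy.2.le⟩)
  have h3 : ∀ y ∈ Set.Icc ξ (ξ + 1), HasDerivAt f' (f'' y) y := fun y hy =>
    hf' y ⟨by linarith [hy.1, hξ.1], by linarith [hy.2, hξ.2]⟩
  obtain ⟨ζ, hζ, hζ'⟩ := exists_hasDerivAt_eq_slope f' f'' (show ξ < ξ + 1 by linarith)
    (fun y hy => (h3 y hy).continuousAt.continuousWithinAt)
    (fun y hy => h3 y ⟨hy.1.le, hy.2.le⟩)
  refine ⟨ζ, ⟨by linarith [hζ.1, hξ.1], by linarith [hζ.2, hξ.2]⟩, ?_⟩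
  rw [hζ']
  have e : ξ + 1 - ξ = 1 := by ring
  have e' : a + 1 - a = 1 := by ring
  rw [e, div_one]
  rw [e', div_one] at hξ'
  rw [hξ', add_assoc]
  norm_num

/-- Both `y` and `x + σ * y` are of size comparable to `N`. -/
def BothComparable (N x σ y : ℝ) : Prop :=
  N / 6 ≤ y ∧ y ≤ 6 * N ∧ N / 6 ≤ x + σ * y ∧ x + σ * y ≤ 6 * N

/-- The phase of the exponential sums. -/
noncomputable def phase (β x σ : ℝ) (k l : ℤ) (y : ℝ) : ℝ :=
  k * y ^ β + l * (x + σ * y) ^ β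

/-- The second derivative of `phase`, divided by `-β * (1 - β) * y ^ (β - 2)`. In contrast to the
second derivative itself it is monotone. -/
noncomputable def curvature (β x σ : ℝ) (k l : ℤ) (y : ℝ) : ℝ :=
  k + l * (σ + x / y) ^ (β - 2)

lemma phase_neg (β x σ : ℝ) (k l : ℤ) (y : ℝ) :
    phase β x σ (-k) (-l) y = -phase β x σ k l y := by
  simp [phase]; ring

lemma curvature_neg (β x σ : ℝ) (k l : ℤ) (y : ℝ) :
    curvature β x σ (-k) (-l) y = -curvature β x σ k l y := by
  simp [curvature]; ring

lemma ratio_bounds {N x σ y : ℝ} (hN : 0 < N) (h : BothComparable N x σ y) :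
    1 / 36 ≤ σ + x / y ∧ σ + x / y ≤ 36 := by
  obtain ⟨h1, h2, h3, h4⟩ := h
  have hy : 0 < y := by linarith
  have e : σ + x / y = (x + σ * y) / y := by field_simp; ring
  rw [e, le_div_iff₀ hy, div_le_iff₀ hy]
  constructor <;> linarith

lemma rpow_bounds_of_comparable {N y β : ℝ} (hN : 0 < N) (hβ : 0 < β) (hβ' : β < 1)
    (h1 : N / 6 ≤ y) (h2 : y ≤ 6 * N) :
    N ^ (β - 2) / 36 ≤ y ^ (β - 2) ∧ y ^ (β - 2) ≤ 36 * N ^ (β - 2) := by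
  have h36 : (6 : ℝ) ^ (2 - β) ≤ 36 := by
    calc (6 : ℝ) ^ (2 - β) ≤ 6 ^ (2 : ℝ) :=
          Real.rpow_le_rpow_of_exponent_le (by norm_num) (by linarith)
      _ = 36 := by norm_num
  have h0 : (0 : ℝ) < 6 ^ (2 - β) := by positivity
  have hD : 0 < N ^ (β - 2) := by positivity
  have e : (6 : ℝ) ^ (β - 2) = (6 ^ (2 - β))⁻¹ := by
    rw [← Real.rpow_neg (by norm_num)]; congr 1; ring
  constructor
  · have h := Real.rpow_le_rpow_of_nonpos (z := β - 2) (by linarith) h2 (by linarith)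
    rw [Real.mul_rpow (by norm_num) hN.le, e] at h
    refine le_trans ?_ h
    rw [div_eq_inv_mul]
    gcongr
  · have h := Real.rpow_le_rpow_of_nonpos (z := β - 2) (by linarith) h1 (by linarith)
    rw [Real.div_rpow hN.le (by norm_num), e, div_inv_eq_mul] at h
    refine h.trans ?_
    rw [mul_comm]
    gcongr

lemma exists_phase_second_difference {N β x σ : ℝ} (hN : 0 < N) (hσ : σ ^ 2 = 1) (k l : ℤ) (a : ℝ)
    (h : ∀ y ∈ Set.Icc a (a + 2), BothComparable N x σ y) :
    ∃ ξ ∈ Set.Icc a (a + 2), phase β x σ k l (a + 2) - phase β x σ k l (a + 1) -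
      (phase β x σ k l (a + 1) - phase β x σ k l a) =
        -(β * (1 - β) * ξ ^ (β - 2) * curvature β x σ k l ξ) := by
  have hd1 : ∀ y ∈ Set.Icc a (a + 2), HasDerivAt (phase β x σ k l)
      (k * (β * y ^ (β - 1)) + l * (β * σ * (x + σ * y) ^ (β - 1))) y := by
    intro y hy
    obtain ⟨h1, h2, h3, h4⟩ := h y hy
    have d1 := Real.hasDerivAt_rpow_const (x := y) (p := β) (Or.inl (by linarith))
    have d2 := (((hasDerivAt_id' y).const_mul σ).const_add x).rpow_const (p := β)
      (Or.inl (by linarith))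
    convert! (d1.const_mul (k : ℝ)).add (d2.const_mul (l : ℝ)) using 1
    ring
  have hd2 : ∀ y ∈ Set.Icc a (a + 2), HasDerivAt
      (fun y => k * (β * y ^ (β - 1)) + l * (β * σ * (x + σ * y) ^ (β - 1)))
      (k * (β * ((β - 1) * y ^ (β - 2))) +
        l * (β * σ * ((β - 1) * σ * (x + σ * y) ^ (β - 2)))) y := by
    intro y hy
    obtain ⟨h1, h2, h3, h4⟩ := h y hy
    have d1 := Real.hasDerivAt_rpow_const (x := y) (p := β - 1) (Or.inl (by linarith))
    have d2 := (((hasDerivAt_id' y).const_mul σ).const_add x).rpow_const (p := β - 1)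
      (Or.inl (by linarith))
    convert! ((d1.const_mul β).const_mul (k : ℝ)).add
      ((d2.const_mul (β * σ)).const_mul (l : ℝ)) using 1
    rw [show β - 1 - 1 = β - 2 by ring]
    ring
  obtain ⟨ξ, hξ, he⟩ := exists_second_difference_eq _ _ _ a hd1 hd2
  refine ⟨ξ, hξ, he.trans ?_⟩
  obtain ⟨h1, h2, h3, h4⟩ := h ξ hξ
  have hy : 0 < ξ := by linarith
  have e : x + σ * ξ = ξ * (σ + x / ξ) := by field_simp; ring
  have hq : 0 ≤ σ + x / ξ := by
    have := (ratio_bounds hN (h ξ hξ)).1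
    linarith
  rw [e, Real.mul_rpow hy.le hq, curvature]
  linear_combination (l * β * (β - 1) * (ξ ^ (β - 2) * (σ + x / ξ) ^ (β - 2))) * hσ

lemma curvature_abs_le {N β x σ y : ℝ} (hN : 0 < N) (hβ : 0 < β) (hβ' : β < 1) {k l : ℤ} {L : ℝ}
    (hk : |(k : ℝ)| ≤ L) (hl : |(l : ℝ)| ≤ L) (h : BothComparable N x σ y) :
    |curvature β x σ k l y| ≤ 1300 * L := by
  obtain ⟨h1, h2⟩ := ratio_bounds hN h
  have hL : 0 ≤ L := (abs_nonneg _).trans hk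
  have h3 : (σ + x / y) ^ (β - 2) ≤ 1296 := by
    calc (σ + x / y) ^ (β - 2) ≤ (1 / 36 : ℝ) ^ (β - 2) :=
          Real.rpow_le_rpow_of_nonpos (by norm_num) h1 (by linarith)
      _ ≤ (1 / 36 : ℝ) ^ (-2 : ℝ) :=
          Real.rpow_le_rpow_of_exponent_ge (by norm_num) (by norm_num) (by linarith)
      _ = 1296 := by
          rw [Real.rpow_neg (by norm_num)]; norm_num
  have h4 : 0 ≤ (σ + x / y) ^ (β - 2) := Real.rpow_nonneg (by linarith) _
  rw [curvature]
  refine (abs_add_le _ _).trans ?_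
  rw [abs_mul, abs_of_nonneg h4]
  have := mul_le_mul hl h3 h4 hL
  linarith

/-- The second derivative test where the curvature has one sign. -/
lemma norm_sum_phase_le_of_curvature_le {N β x σ : ℝ} (hN : 1 ≤ N) (hβ : 0 < β) (hβ' : β < 1)
    (hσ : σ ^ 2 = 1) {k l : ℤ} {L μ Δ : ℝ} (hk : |(k : ℝ)| ≤ L) (hl : |(l : ℝ)| ≤ L) (hμ : 0 < μ)
    (hΔ : 0 < Δ) (hΔ' : Δ ≤ 1 / 2) (a : ℝ) (n : ℕ)
    (h : ∀ y ∈ Set.Icc a (a + n), BothComparable N x σ y)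
    (hc : ∀ y ∈ Set.Icc a (a + n), curvature β x σ k l y ≤ -μ) :
    ‖∑ i ∈ Finset.range n, unitExp (phase β x σ k l (a + i))‖ ≤
      (β * (1 - β) * (36 * N ^ (β - 2)) * (1300 * L) * n + 2) *
        (1 / Δ + 2 * (Δ / (β * (1 - β) * (N ^ (β - 2) / 36) * μ) + 1)) := by
  have hN0 : 0 < N := by linarith
  have hL : 0 ≤ L := (abs_nonneg _).trans hk
  have hb1 : 0 < 1 - β := by linarith
  have hb : 0 < β * (1 - β) := mul_pos hβ hb1
  have hD : 0 < N ^ (β - 2) := by positivity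
  have key : ∀ i, i + 1 < n → β * (1 - β) * (N ^ (β - 2) / 36) * μ ≤
      phase β x σ k l (a + ((i + 2 : ℕ) : ℝ)) - phase β x σ k l (a + ((i + 1 : ℕ) : ℝ)) -
      (phase β x σ k l (a + ((i + 1 : ℕ) : ℝ)) - phase β x σ k l (a + (i : ℝ))) ∧
      phase β x σ k l (a + ((i + 2 : ℕ) : ℝ)) - phase β x σ k l (a + ((i + 1 : ℕ) : ℝ)) -
      (phase β x σ k l (a + ((i + 1 : ℕ) : ℝ)) - phase β x σ k l (a + (i : ℝ))) ≤
      β * (1 - β) * (36 * N ^ (β - 2)) * (1300 * L) := by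
    intro i hi
    have hin : (i : ℝ) + 2 ≤ n := by exact_mod_cast hi
    have hsub : ∀ y ∈ Set.Icc (a + i) (a + i + 2), y ∈ Set.Icc a (a + n) := fun y hy =>
      ⟨by have := hy.1; have : (0 : ℝ) ≤ i := Nat.cast_nonneg i; linarith, by linarith [hy.2]⟩
    obtain ⟨ξ, hξ, he⟩ := exists_phase_second_difference (β := β) hN0 hσ k l (a + i)
      fun y hy => h y (hsub y hy)
    have e1 : a + ((i + 2 : ℕ) : ℝ) = a + i + 2 := by push_cast; ring
    have e2 : a + ((i + 1 : ℕ) : ℝ) = a + i + 1 := by push_cast; ring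
    rw [e1, e2, he]
    have hcmp := h ξ (hsub ξ hξ)
    have hξ0 : 0 < ξ := by linarith [hcmp.1]
    obtain ⟨hr1, hr2⟩ := rpow_bounds_of_comparable hN0 hβ hβ' hcmp.1 hcmp.2.1
    have hc1 : μ ≤ -curvature β x σ k l ξ := by linarith [hc ξ (hsub ξ hξ)]
    have hc2 : -curvature β x σ k l ξ ≤ 1300 * L := by
      linarith [neg_abs_le (curvature β x σ k l ξ), curvature_abs_le hN0 hβ hβ' hk hl hcmp]
    rw [← mul_neg]
    constructor
    · exact mul_le_mul (mul_le_mul_of_nonneg_left hr1 hb.le) hc1 hμ.le (by positivity)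
    · exact mul_le_mul (mul_le_mul_of_nonneg_left hr2 hb.le) hc2 (by linarith) (by positivity)
  exact norm_sum_unitExp_le_of_second_difference (fun i => phase β x σ k l (a + i)) n
    (by positivity) hΔ hΔ' (fun i hi => (key i hi).1) (fun i hi => (key i hi).2) (by positivity)

/-- A simplified form of the second derivative test, with `Δ = N ^ (-1 / 2)`. -/
lemma norm_sum_phase_le_of_curvature_le' {β : ℝ} (hβ : 0 < β) (hβ' : β < 1) :
    ∃ C : ℝ, 0 < C ∧ ∀ {N x σ : ℝ}, 4 ≤ N → σ ^ 2 = 1 → ∀ {k l : ℤ} {L μ : ℝ},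
      1 ≤ L → |(k : ℝ)| ≤ L → |(l : ℝ)| ≤ L → 0 < μ → μ ≤ 1 → ∀ (a : ℝ) (n : ℕ), n ≤ N →
      (∀ y ∈ Set.Icc a (a + n), BothComparable N x σ y) →
      ((∀ y ∈ Set.Icc a (a + n), curvature β x σ k l y ≤ -μ) ∨
        ∀ y ∈ Set.Icc a (a + n), μ ≤ curvature β x σ k l y) →
      ‖∑ i ∈ Finset.range n, unitExp (phase β x σ k l (a + i))‖ ≤
        C * L * N ^ (3 / 2 - β) / μ := by
  have hb1 : 0 < 1 - β := by linarith
  have hb : 0 < β * (1 - β) := mul_pos hβ hb1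
  refine ⟨(β * (1 - β) * 36 * 1300 + 2) * (3 + 72 / (β * (1 - β))), by positivity, ?_⟩
  intro N x σ hN hσ k l L μ hL hk hl hμ hμ1 a n hn h hc
  have hN0 : 0 < N := by linarith
  have hΔ' : N ^ (-(1 / 2) : ℝ) ≤ 1 / 2 := by
    calc N ^ (-(1 / 2) : ℝ) ≤ 4 ^ (-(1 / 2) : ℝ) :=
          Real.rpow_le_rpow_of_nonpos (by norm_num) hN (by norm_num)
      _ = 1 / 2 := by
          rw [Real.rpow_neg (by norm_num), show (4 : ℝ) = 2 ^ (2 : ℝ) by norm_num,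
            ← Real.rpow_mul (by norm_num)]
          norm_num
  have main : ∀ {k l : ℤ}, |(k : ℝ)| ≤ L → |(l : ℝ)| ≤ L →
      (∀ y ∈ Set.Icc a (a + n), curvature β x σ k l y ≤ -μ) →
      ‖∑ i ∈ Finset.range n, unitExp (phase β x σ k l (a + i))‖ ≤
        (β * (1 - β) * 36 * 1300 + 2) * (3 + 72 / (β * (1 - β))) * L * N ^ (3 / 2 - β) / μ := by
    intro k l hk hl hc
    refine (norm_sum_phase_le_of_curvature_le (by linarith) hβ hβ' hσ hk hl hμ
      (by positivity : 0 < N ^ (-(1 / 2) : ℝ)) hΔ' a n h hc).trans ?_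
    have e1 : N ^ (β - 2) * N ≤ 1 := by
      have : N ^ (β - 2) * N = N ^ (β - 1) := by
        rw [← Real.rpow_add_one hN0.ne']; congr 1; ring
      rw [this]
      exact Real.rpow_le_one_of_one_le_of_nonpos (by linarith) (by linarith)
    have f1 : β * (1 - β) * (36 * N ^ (β - 2)) * (1300 * L) * n + 2 ≤
        (β * (1 - β) * 36 * 1300 + 2) * L := by
      have h1 : N ^ (β - 2) * n ≤ 1 := le_trans (by gcongr) e1
      have h2 : β * (1 - β) * 36 * 1300 * L * (N ^ (β - 2) * n) ≤ β * (1 - β) * 36 * 1300 * L * 1 := by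
        gcongr
      linarith
    set M := N ^ (3 / 2 - β) with hM
    have hMpos : 0 < M := by positivity
    have e2 : 1 / N ^ (-(1 / 2) : ℝ) ≤ M := by
      rw [one_div, ← Real.rpow_neg hN0.le]
      exact Real.rpow_le_rpow_of_exponent_le (by linarith) (by linarith)
    have e3 : 1 ≤ M := Real.one_le_rpow (by linarith) (by linarith)
    have e4 : N ^ (-(1 / 2) : ℝ) / (β * (1 - β) * (N ^ (β - 2) / 36) * μ) =
        36 / (β * (1 - β)) * M / μ := by
      have : M = N ^ (-(1 / 2) : ℝ) / N ^ (β - 2) := by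
        rw [hM, ← Real.rpow_sub hN0]; congr 1; ring
      rw [this]
      have : N ^ (β - 2) ≠ 0 := by positivity
      field_simp
    rw [e4]
    have e5 : M ≤ M / μ := by
      rw [le_div_iff₀ hμ]
      nlinarith
    have f2 : 1 / N ^ (-(1 / 2) : ℝ) + 2 * (36 / (β * (1 - β)) * M / μ + 1) ≤
        (3 + 72 / (β * (1 - β))) * (M / μ) := by
      have : 36 / (β * (1 - β)) * M / μ = 36 / (β * (1 - β)) * (M / μ) := by ring
      have h72 : 72 / (β * (1 - β)) = 2 * (36 / (β * (1 - β))) := by ring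
      rw [this, h72]
      linarith
    have f3 : 0 ≤ 1 / N ^ (-(1 / 2) : ℝ) + 2 * (36 / (β * (1 - β)) * M / μ + 1) := by positivity
    refine (mul_le_mul f1 f2 f3 (by positivity)).trans (le_of_eq ?_)
    ring
  rcases hc with hc | hc
  · exact main hk hl hc
  · have h1 := main (k := -k) (l := -l) (by simpa using hk) (by simpa using hl) (fun y hy => by
      rw [curvature_neg]
      linarith [hc y hy])
    simp_rw [phase_neg] at h1
    rwa [norm_sum_unitExp_neg] at h1

/-! ### Exponential sums with a sum of two powers in the phase -/

/-- The curvature increases at a rate of at least about `x / N ^ 2`. -/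
lemma slope_le_ratio_rpow_sub {N β x σ y₁ y₂ : ℝ} (hN : 0 < N) (hβ : 0 < β) (hβ' : β < 1)
    (hx : 0 < x) (hy : y₁ ≤ y₂) (h : ∀ y ∈ Set.Icc y₁ y₂, BothComparable N x σ y) :
    x / (36 ^ 4 * N ^ 2) * (y₂ - y₁) ≤ (σ + x / y₂) ^ (β - 2) - (σ + x / y₁) ^ (β - 2) := by
  rcases hy.eq_or_lt with rfl | hlt
  · simp
  have hd : ∀ y ∈ Set.Icc y₁ y₂, HasDerivAt (fun y => (σ + x / y) ^ (β - 2))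
      ((2 - β) * (σ + x / y) ^ (β - 3) * (x / y ^ 2)) y := by
    intro y hy
    have hy0 : 0 < y := by linarith [(h y hy).1]
    have hr := (ratio_bounds hN (h y hy)).1
    have d1 := (((hasDerivAt_inv hy0.ne').const_mul x).const_add σ).rpow_const (p := β - 2)
      (Or.inl (by rw [← div_eq_mul_inv]; linarith))
    convert! d1 using 1
    rw [← div_eq_mul_inv, show β - 2 - 1 = β - 3 by ring]
    field_simp
    ring
  obtain ⟨ξ, hξ, he⟩ := exists_hasDerivAt_eq_slope _ _ hlt
    (fun y hy => (hd y hy).continuousAt.continuousWithinAt)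
    (fun y hy => hd y ⟨hy.1.le, hy.2.le⟩)
  have hcmp := h ξ ⟨hξ.1.le, hξ.2.le⟩
  obtain ⟨hr1, hr2⟩ := ratio_bounds hN hcmp
  have hξ0 : 0 < ξ := by linarith [hcmp.1]
  have h1 : (1 : ℝ) / 36 ^ 3 ≤ (σ + x / ξ) ^ (β - 3) := by
    calc (1 : ℝ) / 36 ^ 3 = 36 ^ (-3 : ℝ) := by
          rw [Real.rpow_neg (by norm_num)]; norm_num
      _ ≤ 36 ^ (β - 3) := Real.rpow_le_rpow_of_exponent_le (by norm_num) (by linarith)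
      _ ≤ (σ + x / ξ) ^ (β - 3) :=
          Real.rpow_le_rpow_of_nonpos (by linarith) hr2 (by linarith)
  have h2 : x / (36 * N ^ 2) ≤ x / ξ ^ 2 := by
    apply div_le_div_of_nonneg_left hx.le (by positivity)
    nlinarith [hcmp.2.1]
  have h3 : x / (36 ^ 4 * N ^ 2) ≤ (2 - β) * (σ + x / ξ) ^ (β - 3) * (x / ξ ^ 2) := by
    calc x / (36 ^ 4 * N ^ 2) = 1 * (1 / 36 ^ 3) * (x / (36 * N ^ 2)) := by
          field_simp
      _ ≤ (2 - β) * (σ + x / ξ) ^ (β - 3) * (x / ξ ^ 2) := by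
          gcongr
          · exact mul_nonneg (by linarith) (by positivity)
          · linarith
          · linarith
  rw [he, le_div_iff₀ (by linarith)] at h3
  exact h3

/-- The exponential sum where the curvature may change sign: the indices with curvature in
`(-μ, μ)` form a short interval and are counted. -/
lemma norm_sum_phase_le_of_ne_zero {β : ℝ} (hβ : 0 < β) (hβ' : β < 1) :
    ∃ C : ℝ, 0 < C ∧ ∀ {N x σ : ℝ}, 4 ≤ N → σ ^ 2 = 1 → 0 < x → ∀ {k l : ℤ} {L μ : ℝ},
      1 ≤ L → |(k : ℝ)| ≤ L → |(l : ℝ)| ≤ L → (k ≠ 0 ∨ l ≠ 0) → 0 < μ → μ ≤ 1 →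
      ∀ (a : ℝ) (n : ℕ), n ≤ N →
      (∀ y ∈ Set.Icc a (a + n), BothComparable N x σ y) →
      ‖∑ i ∈ Finset.range n, unitExp (phase β x σ k l (a + i))‖ ≤
        C * (L * N ^ (3 / 2 - β) / μ + μ * N ^ 2 / x + 1) := by
  obtain ⟨C, hC, hV⟩ := norm_sum_phase_le_of_curvature_le' hβ hβ'
  refine ⟨2 * C + 2 * 36 ^ 4 + 2, by positivity, ?_⟩
  intro N x σ hN hσ hx k l L μ hL hk hl hkl hμ hμ1 a n hn h
  have hN0 : 0 < N := by linarith
  have hM : 0 < L * N ^ (3 / 2 - β) / μ := by positivity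
  have hX : 0 < μ * N ^ 2 / x := by positivity
  have main : ∀ {k l : ℤ}, |(k : ℝ)| ≤ L → |(l : ℝ)| ≤ L → 0 < l →
      ‖∑ i ∈ Finset.range n, unitExp (phase β x σ k l (a + i))‖ ≤
        (2 * C + 2 * 36 ^ 4 + 2) * (L * N ^ (3 / 2 - β) / μ + μ * N ^ 2 / x + 1) := by
    intro k l hk hl hl0
    have hl1 : (1 : ℝ) ≤ l := by exact_mod_cast hl0
    have hslope : ∀ y₁ y₂, a ≤ y₁ → y₁ ≤ y₂ → y₂ ≤ a + n →
        x / (36 ^ 4 * N ^ 2) * (y₂ - y₁) ≤ curvature β x σ k l y₂ - curvature β x σ k l y₁ := by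
      intro y₁ y₂ h1 h2 h3
      have h4 := slope_le_ratio_rpow_sub hN0 hβ hβ' hx h2
        (fun y hy => h y ⟨h1.trans hy.1, hy.2.trans h3⟩)
      have h5 : 0 ≤ x / (36 ^ 4 * N ^ 2) * (y₂ - y₁) :=
        mul_nonneg (by positivity) (by linarith)
      have h6 : curvature β x σ k l y₂ - curvature β x σ k l y₁ =
          l * ((σ + x / y₂) ^ (β - 2) - (σ + x / y₁) ^ (β - 2)) := by
        simp only [curvature]; ring
      rw [h6]
      nlinarith
    have hmono : ∀ y₁ y₂, a ≤ y₁ → y₁ ≤ y₂ → y₂ ≤ a + n →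
        curvature β x σ k l y₁ ≤ curvature β x σ k l y₂ := by
      intro y₁ y₂ h1 h2 h3
      have h4 := hslope y₁ y₂ h1 h2 h3
      have h5 : 0 ≤ x / (36 ^ 4 * N ^ 2) * (y₂ - y₁) :=
        mul_nonneg (by positivity) (by linarith)
      linarith
    have hmono' : ∀ i j : ℕ, i ≤ j → j < n →
        curvature β x σ k l (a + i) ≤ curvature β x σ k l (a + j) := by
      intro i j hij hj
      have h1 : (i : ℝ) ≤ j := by exact_mod_cast hij
      have h2 : (j : ℝ) ≤ n := by exact_mod_cast hj.le
      have h3 : (0 : ℝ) ≤ i := Nat.cast_nonneg i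
      exact hmono _ _ (by linarith) (by linarith) (by linarith)
    obtain ⟨p, hp, hp'⟩ := exists_threshold (fun i => curvature β x σ k l (a + i) ≤ -μ) n
      fun i j hij hj hP => (hmono' i j hij hj).trans hP
    obtain ⟨q, hq, hq'⟩ := exists_threshold (fun i => curvature β x σ k l (a + i) < μ) n
      fun i j hij hj hP => (hmono' i j hij hj).trans_lt hP
    have hpq : p ≤ q := by
      by_contra hlt
      push Not at hlt
      have h1 := (hp' q (by omega)).2 hlt
      have h2 := (hq' q (by omega)).1 (by linarith)
      omega
    have hp1 : (p : ℝ) ≤ n := by exact_mod_cast hp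
    have hq1 : (q : ℝ) ≤ n := by exact_mod_cast hq
    -- The bound for the first part is applied without its last index, as the sign of the curvature
    -- is only known up to there.
    have hpart1 : ‖∑ i ∈ Finset.range p, unitExp (phase β x σ k l (a + i))‖ ≤
        C * L * N ^ (3 / 2 - β) / μ + 1 := by
      rcases p with _ | p
      · simp; positivity
      · rw [Finset.sum_range_succ]
        push_cast at hp1
        refine (norm_add_le _ _).trans (add_le_add ?_ (norm_unitExp _).le)
        refine hV hN hσ hL hk hl hμ hμ1 a p (by linarith)
          (fun y hy => h y ⟨hy.1, by linarith [hy.2]⟩) (Or.inl fun y hy => ?_)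
        exact (hmono y (a + p) hy.1 hy.2 (by linarith)).trans ((hp' p (by omega)).2 (by omega))
    have hpart2 : ‖∑ i ∈ Finset.Ico p q, unitExp (phase β x σ k l (a + i))‖ ≤
        2 * 36 ^ 4 * (μ * N ^ 2 / x) + 1 := by
      refine (norm_sum_unitExp_le_card _ _).trans ?_
      rw [Nat.card_Ico]
      rcases hpq.eq_or_lt with rfl | hlt
      · simp; positivity
      · have h1 : -μ < curvature β x σ k l (a + p) := by
          by_contra hle
          push Not at hle
          have := (hp' p (by omega)).1 hle
          omega
        have h2 := (hq' (q - 1) (by omega)).2 (by omega)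
        have e : ((q - 1 : ℕ) : ℝ) = q - 1 := by
          rw [Nat.cast_sub (by omega)]; simp
        have hpq1 : (p : ℝ) + 1 ≤ q := by exact_mod_cast hlt
        rw [e] at h2
        have h3 := hslope (a + p) (a + (q - 1)) (by linarith [(Nat.cast_nonneg p : (0 : ℝ) ≤ p)])
          (by linarith) (by linarith)
        have h4 : x / (36 ^ 4 * N ^ 2) * (a + (q - 1) - (a + p)) ≤ 2 * μ := by linarith
        rw [Nat.cast_sub hpq]
        have h5 : (q : ℝ) - 1 - p ≤ 2 * μ / (x / (36 ^ 4 * N ^ 2)) := by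
          rw [le_div_iff₀ (by positivity)]
          linarith
        have h6 : 2 * μ / (x / (36 ^ 4 * N ^ 2)) = 2 * 36 ^ 4 * (μ * N ^ 2 / x) := by
          field_simp
        linarith
    have hpart3 : ‖∑ i ∈ Finset.Ico q n, unitExp (phase β x σ k l (a + i))‖ ≤
        C * L * N ^ (3 / 2 - β) / μ := by
      rw [Finset.sum_Ico_eq_sum_range]
      rcases hq.eq_or_lt with rfl | hlt
      · simp; positivity
      · have e : ∀ i : ℕ, a + ((q + i : ℕ) : ℝ) = a + q + i := by intro i; push_cast; ring
        simp_rw [e]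
        have hnq : ((n - q : ℕ) : ℝ) = n - q := Nat.cast_sub hq
        have hq0 : (0 : ℝ) ≤ q := Nat.cast_nonneg q
        refine hV hN hσ hL hk hl hμ hμ1 (a + q) (n - q) (by rw [hnq]; linarith)
          (fun y hy => h y ⟨by linarith [hy.1], by have := hy.2; rw [hnq] at this; linarith⟩)
          (Or.inr fun y hy => ?_)
        refine le_trans ?_ (hmono (a + q) y (by linarith) hy.1
          (by have := hy.2; rw [hnq] at this; linarith))
        by_contra hlt2
        push Not at hlt2
        have := (hq' q hlt).1 hlt2
        omega
    have hsplit : ∑ i ∈ Finset.range n, unitExp (phase β x σ k l (a + i)) =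
        ∑ i ∈ Finset.range p, unitExp (phase β x σ k l (a + i)) +
        (∑ i ∈ Finset.Ico p q, unitExp (phase β x σ k l (a + i)) +
        ∑ i ∈ Finset.Ico q n, unitExp (phase β x σ k l (a + i))) := by
      rw [Finset.sum_Ico_consecutive _ hpq hq, Finset.sum_range_add_sum_Ico _ hp]
    rw [hsplit]
    refine (norm_add_le _ _).trans ?_
    have h7 := norm_add_le (∑ i ∈ Finset.Ico p q, unitExp (phase β x σ k l (a + i)))
      (∑ i ∈ Finset.Ico q n, unitExp (phase β x σ k l (a + i)))
    have h8 : C * L * N ^ (3 / 2 - β) / μ = C * (L * N ^ (3 / 2 - β) / μ) := by ring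
    rw [h8] at hpart1 hpart3
    have h9 : 0 < C * (μ * N ^ 2 / x) := by positivity
    linarith
  rcases lt_trichotomy l 0 with hneg | rfl | hpos
  · have h1 := main (k := -k) (l := -l) (by simpa using hk) (by simpa using hl) (by omega)
    simp_rw [phase_neg] at h1
    rwa [norm_sum_unitExp_neg] at h1
  · have hk0 : k ≠ 0 := by tauto
    have h1 : ‖∑ i ∈ Finset.range n, unitExp (phase β x σ k 0 (a + i))‖ ≤
        C * L * N ^ (3 / 2 - β) / μ := by
      refine hV hN hσ hL hk hl hμ hμ1 a n hn h ?_
      have hc : ∀ y, curvature β x σ k 0 y = k := by intro y; simp [curvature]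
      simp_rw [hc]
      rcases lt_or_gt_of_ne hk0 with h2 | h2
      · left
        intro _ _
        have : (k : ℝ) ≤ -1 := by exact_mod_cast (by omega : k ≤ -1)
        linarith
      · right
        intro _ _
        have : (1 : ℝ) ≤ k := by exact_mod_cast h2
        linarith
    have h8 : C * L * N ^ (3 / 2 - β) / μ = C * (L * N ^ (3 / 2 - β) / μ) := by ring
    rw [h8] at h1
    have h9 : 0 < C * (μ * N ^ 2 / x) := by positivity
    have h10 : 0 < C * (L * N ^ (3 / 2 - β) / μ) := by positivity
    linarith
  · exact main hk hl hpos

/-- For `x` small compared with `N / L`, the curvature is close to the integer `k + l`. -/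
lemma norm_sum_phase_le_of_add_ne_zero {β : ℝ} (hβ : 0 < β) (hβ' : β < 1) :
    ∃ C : ℝ, 0 < C ∧ ∀ {N x : ℝ}, 4 ≤ N → 0 < x → ∀ {k l : ℤ} {L : ℝ},
      1 ≤ L → |(k : ℝ)| ≤ L → |(l : ℝ)| ≤ L → k + l ≠ 0 → x ≤ N / (24 * L) →
      ∀ (a : ℝ) (n : ℕ), n ≤ N →
      (∀ y ∈ Set.Icc a (a + n), BothComparable N x 1 y) →
      ‖∑ i ∈ Finset.range n, unitExp (phase β x 1 k l (a + i))‖ ≤ C * (L * N ^ (3 / 2 - β)) := by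
  obtain ⟨C, hC, hV⟩ := norm_sum_phase_le_of_curvature_le' hβ hβ'
  refine ⟨2 * C, by positivity, ?_⟩
  intro N x hN hx k l L hL hk hl hkl hxN a n hn h
  have hN0 : 0 < N := by linarith
  have hclose : ∀ y ∈ Set.Icc a (a + n), |curvature β x 1 k l y - (k + l : ℤ)| ≤ 1 / 2 := by
    intro y hy
    have hcmp := h y hy
    have hy0 : 0 < y := by linarith [hcmp.1]
    set t := x / y with ht
    have ht0 : 0 < t := by positivity
    have htle : t ≤ 6 * x / N := by
      rw [ht, div_le_div_iff₀ hy0 hN0]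
      nlinarith [hcmp.1]
    have hq1 : (1 + t) ^ (β - 2) ≤ 1 :=
      Real.rpow_le_one_of_one_le_of_nonpos (by linarith) (by linarith)
    have hq2 : 1 - 2 * t ≤ (1 + t) ^ (β - 2) := by
      have h1 : Real.exp (-(2 * t)) ≤ (1 + t) ^ (β - 2) := by
        rw [Real.rpow_def_of_pos (by linarith)]
        apply Real.exp_le_exp.2
        have h2 := Real.log_le_sub_one_of_pos (show 0 < 1 + t by linarith)
        have h3 := Real.log_nonneg (show 1 ≤ 1 + t by linarith)
        nlinarith
      have h2 := Real.add_one_le_exp (-(2 * t))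
      linarith
    have e : curvature β x 1 k l y - (k + l : ℤ) = l * ((1 + t) ^ (β - 2) - 1) := by
      rw [curvature]; push_cast; ring
    rw [e, abs_mul, abs_of_nonpos (show (1 + t) ^ (β - 2) - 1 ≤ 0 by linarith)]
    have h3 : L * (12 * x / N) ≤ 1 / 2 := by
      rw [le_div_iff₀ (by positivity)] at hxN
      have : L * (12 * x / N) = (x * (24 * L)) / N / 2 := by ring
      rw [this]
      have : x * (24 * L) / N ≤ 1 := (div_le_one hN0).2 hxN
      linarith
    calc |(l : ℝ)| * -((1 + t) ^ (β - 2) - 1) ≤ L * (12 * x / N) := by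
          apply mul_le_mul hl _ (by linarith) (by linarith)
          have : 12 * x / N = 2 * (6 * x / N) := by ring
          linarith
      _ ≤ 1 / 2 := h3
  have h1 := hV (μ := 1 / 2) hN (by norm_num) hL hk hl (by norm_num) (by norm_num) a n hn h ?_
  · refine h1.trans (le_of_eq ?_); ring
  · rcases lt_or_gt_of_ne hkl with h2 | h2
    · left
      intro y hy
      have h3 : ((k + l : ℤ) : ℝ) ≤ -1 := by exact_mod_cast (by omega : k + l ≤ -1)
      have h4 := (abs_le.1 (hclose y hy)).2
      linarith
    · right
      intro y hy
      have h3 : (1 : ℝ) ≤ ((k + l : ℤ) : ℝ) := by exact_mod_cast (by omega : 1 ≤ k + l)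
      have h4 := (abs_le.1 (hclose y hy)).1
      linarith

/-- The degenerate frequencies `l = -k`: the increments of the phase are small, and comparable to
`k * x * N ^ (β - 2)`, so the Kusmin–Landau inequality applies directly. -/
lemma norm_sum_phase_diagonal_le {β : ℝ} (hβ : 0 < β) (hβ' : β < 1) :
    ∃ C : ℝ, 0 < C ∧ ∀ {N x : ℝ}, 4 ≤ N → 0 < x → ∀ {k : ℤ} {L : ℝ},
      1 ≤ L → |(k : ℝ)| ≤ L → k ≠ 0 → x ≤ N / (24 * L) →
      ∀ (a : ℝ) (n : ℕ),
      (∀ y ∈ Set.Icc a (a + n), BothComparable N x 1 y) →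
      ‖∑ i ∈ Finset.range n, unitExp (phase β x 1 k (-k) (a + i))‖ ≤
        C * (N ^ (2 - β) / x) / |(k : ℝ)| := by
  have hb1 : 0 < 1 - β := by linarith
  have hb : 0 < β * (1 - β) := mul_pos hβ hb1
  refine ⟨36 / (β * (1 - β)), by positivity, ?_⟩
  intro N x hN hx k L hL hk hk0 hxN a n h
  have hN0 : 0 < N := by linarith
  have hD : 0 < N ^ (β - 2) := by positivity
  -- For `k > 0` and the frequencies `(-k, k)` the increments increase, and lie in `[-1 / 2, -Δ]`.
  have main : ∀ {k : ℤ}, (k : ℝ) ≤ L → 0 < k →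
      ‖∑ i ∈ Finset.range n, unitExp (phase β x 1 (-k) (- -k) (a + i))‖ ≤
        36 / (β * (1 - β)) * (N ^ (2 - β) / x) / (k : ℝ) := by
    intro k hk hk0
    have hk1 : (1 : ℝ) ≤ k := by exact_mod_cast hk0
    have hinc : ∀ y, a ≤ y → y + 1 ≤ a + n → ∃ ζ, N / 6 ≤ ζ ∧ ζ ≤ 6 * N ∧
        phase β x 1 (-k) (- -k) (y + 1) - phase β x 1 (-k) (- -k) y =
          -(k * (β * (1 - β)) * x * ζ ^ (β - 2)) := by
      intro y hy hy'
      have hd1 : ∀ z ∈ Set.Icc y (y + 1), HasDerivAt (phase β x 1 (-k) (- -k))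
          (k * (β * ((x + z) ^ (β - 1) - z ^ (β - 1)))) z := by
        intro z hz
        obtain ⟨h1, h2, h3, h4⟩ := h z ⟨hy.trans hz.1, hz.2.trans hy'⟩
        have d1 := Real.hasDerivAt_rpow_const (x := z) (p := β) (Or.inl (by linarith))
        have d2 := (((hasDerivAt_id' z).const_mul 1).const_add x).rpow_const (p := β)
          (Or.inl (by linarith))
        convert! (d1.const_mul ((-k : ℤ) : ℝ)).add (d2.const_mul ((- -k : ℤ) : ℝ)) using 1
        push_cast
        ring_nf
      obtain ⟨ξ, hξ, he⟩ := exists_hasDerivAt_eq_slope _ _ (show y < y + 1 by linarith)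
        (fun z hz => (hd1 z hz).continuousAt.continuousWithinAt)
        (fun z hz => hd1 z ⟨hz.1.le, hz.2.le⟩)
      obtain ⟨h1, h2, h3, h4⟩ := h ξ ⟨hy.trans hξ.1.le, hξ.2.le.trans hy'⟩
      have hd2 : ∀ z ∈ Set.Icc ξ (ξ + x), HasDerivAt (fun z : ℝ => z ^ (β - 1))
          ((β - 1) * z ^ (β - 2)) z := by
        intro z hz
        have := Real.hasDerivAt_rpow_const (x := z) (p := β - 1) (Or.inl (by linarith [hz.1]))
        rwa [show β - 1 - 1 = β - 2 by ring] at this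
      obtain ⟨ζ, hζ, he'⟩ := exists_hasDerivAt_eq_slope _ _ (show ξ < ξ + x by linarith)
        (fun z hz => (hd2 z hz).continuousAt.continuousWithinAt)
        (fun z hz => hd2 z ⟨hz.1.le, hz.2.le⟩)
      refine ⟨ζ, by linarith [hζ.1], by linarith [hζ.2], ?_⟩
      rw [show y + 1 - y = 1 by ring, div_one] at he
      rw [show ξ + x - ξ = x by ring, eq_div_iff hx.ne'] at he'
      rw [← he, add_comm x ξ]
      linear_combination -(k * β) * he'
    set Δ := k * (β * (1 - β)) * x * (N ^ (β - 2) / 36) with hΔdef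
    have hΔ : 0 < Δ := by positivity
    have hbound : ∀ i : ℕ, i + 1 ≤ n → Δ ≤ -(phase β x 1 (-k) (- -k) (a + ((i + 1 : ℕ) : ℝ)) -
        phase β x 1 (-k) (- -k) (a + i)) ∧ -(phase β x 1 (-k) (- -k) (a + ((i + 1 : ℕ) : ℝ)) -
        phase β x 1 (-k) (- -k) (a + i)) ≤ 1 / 2 := by
      intro i hi
      have hi' : (i : ℝ) + 1 ≤ n := by exact_mod_cast hi
      obtain ⟨ζ, h1, h2, he⟩ := hinc (a + i) (by linarith [(Nat.cast_nonneg i : (0 : ℝ) ≤ i)])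
        (by linarith)
      obtain ⟨hr1, hr2⟩ := rpow_bounds_of_comparable hN0 hβ hβ' h1 h2
      have e : a + ((i + 1 : ℕ) : ℝ) = a + i + 1 := by push_cast; ring
      rw [e, he, neg_neg]
      have hpos : 0 < k * (β * (1 - β)) * x := by positivity
      refine ⟨mul_le_mul_of_nonneg_left hr1 hpos.le,
        (mul_le_mul_of_nonneg_left hr2 hpos.le).trans ?_⟩
      have h3 : N ^ (β - 2) ≤ 1 / N := by
        rw [one_div, ← Real.rpow_neg_one]
        exact Real.rpow_le_rpow_of_exponent_le (by linarith) (by linarith)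
      have h4 : k * x ≤ N / 24 := by
        rw [le_div_iff₀ (by positivity)] at hxN
        nlinarith
      have h5 : β * (1 - β) ≤ 1 / 4 := by nlinarith [sq_nonneg (β - 1 / 2)]
      calc k * (β * (1 - β)) * x * (36 * N ^ (β - 2))
          = 36 * (k * x) * (β * (1 - β)) * N ^ (β - 2) := by ring
        _ ≤ 36 * (N / 24) * (1 / 4) * (1 / N) := by gcongr
        _ ≤ 1 / 2 := by field_simp; norm_num
    have hres : ‖∑ i ∈ Finset.range n, unitExp (phase β x 1 (-k) (- -k) (a + i))‖ ≤ 1 / Δ := by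
      refine norm_sum_unitExp_le_of_monotone_increment
        (fun i : ℕ => phase β x 1 (-k) (- -k) (a + i)) n hΔ (-1) ?_ ?_ ?_
      · intro i hi
        have hi' : (i : ℝ) + 2 ≤ n := by exact_mod_cast hi
        have hi0 : (0 : ℝ) ≤ i := Nat.cast_nonneg i
        have hsub : ∀ y ∈ Set.Icc (a + i) (a + i + 2), y ∈ Set.Icc a (a + n) := fun y hy =>
          ⟨by linarith [hy.1], by linarith [hy.2]⟩
        obtain ⟨ξ, hξ, he⟩ := exists_phase_second_difference (β := β) hN0 (one_pow 2) (-k) (- -k)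
          (a + i) fun y hy => h y (hsub y hy)
        have hcmp := h ξ (hsub ξ hξ)
        have hξ0 : 0 < ξ := by linarith [hcmp.1]
        have hc : curvature β x 1 (-k) (- -k) ξ ≤ 0 := by
          have : (1 + x / ξ) ^ (β - 2) ≤ 1 := by
            apply Real.rpow_le_one_of_one_le_of_nonpos _ (by linarith)
            have : 0 < x / ξ := by positivity
            linarith
          rw [curvature]
          push_cast
          nlinarith
        have h5 : 0 ≤ β * (1 - β) * ξ ^ (β - 2) := by positivity
        have h6 := mul_nonneg h5 (neg_nonneg.2 hc)
        have e1 : a + ((i + 2 : ℕ) : ℝ) = a + i + 2 := by push_cast; ring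
        have e2 : a + ((i + 1 : ℕ) : ℝ) = a + i + 1 := by push_cast; ring
        simp only [e1, e2]
        linarith
      · intro i hi
        have := hbound i hi
        push_cast at this ⊢
        linarith [this.1, this.2]
      · intro i hi
        have := hbound i hi
        push_cast at this ⊢
        linarith [this.1, this.2]
    refine hres.trans (le_of_eq ?_)
    have : N ^ (2 - β) = (N ^ (β - 2))⁻¹ := by
      rw [← Real.rpow_neg hN0.le]; congr 1; ring
    rw [hΔdef, this]
    field_simp
  rcases lt_or_gt_of_ne hk0 with hneg | hpos
  · have h1 := main (k := -k) (by push_cast; exact (neg_le_abs _).trans hk) (by omega)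
    rw [neg_neg] at h1
    have e : |(k : ℝ)| = ((-k : ℤ) : ℝ) := by
      rw [abs_of_neg (by exact_mod_cast hneg)]; push_cast; ring
    rwa [e]
  · have h1 := main (k := k) ((le_abs_self _).trans hk) hpos
    simp_rw [phase_neg] at h1
    rw [norm_sum_unitExp_neg] at h1
    rwa [abs_of_pos (by exact_mod_cast hpos)]

/-! ### The sum over all frequencies -/

lemma sum_inv_abs_Icc_le (L : ℕ) :
    ∑ k ∈ Finset.Icc (-(L : ℤ)) L, 1 / |(k : ℝ)| ≤ 2 * (1 + Real.log L) := by
  have h : ∑ k ∈ Finset.Icc (-(L : ℤ)) L, 1 / |(k : ℝ)| = 2 * ((harmonic L : ℚ) : ℝ) := by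
    induction L with
    | zero => simp
    | succ L ih =>
      have h : Finset.Icc (-((L + 1 : ℕ) : ℤ)) ((L + 1 : ℕ) : ℤ) =
          insert (-((L + 1 : ℕ) : ℤ)) (insert ((L + 1 : ℕ) : ℤ) (Finset.Icc (-(L : ℤ)) L)) := by
        ext k
        simp only [Finset.mem_Icc, Finset.mem_insert]
        push_cast
        omega
      rw [h, Finset.sum_insert, Finset.sum_insert, ih, harmonic_succ]
      · have e : |((L + 1 : ℕ) : ℝ)| = (L : ℝ) + 1 := by
          rw [abs_of_nonneg (Nat.cast_nonneg _)]; push_cast; ring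
        rw [Int.cast_neg, abs_neg, Int.cast_natCast, e]
        push_cast
        ring
      · simp
      · simp only [Finset.mem_insert, Finset.mem_Icc]
        push_cast
        omega
  rw [h]
  have := harmonic_le_one_add_log L
  linarith

/-- The exponential sum bound for the pair `y ↦ -y ^ β`, `y ↦ -(x + σ * y) ^ β`. The last term
comes from the degenerate frequencies `l = -k`, and is the only one that gets worse as `x`
decreases. -/
lemma weylTotal_le {β : ℝ} (hβ : 0 < β) (hβ' : β < 1) :
    ∃ C : ℝ, 0 < C ∧ ∀ {N x σ : ℝ}, 4 ≤ N → (σ = 1 ∨ σ = -1) → 0 < x → ∀ {L : ℕ}, 1 ≤ L →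
      ∀ (a : ℝ) (n : ℕ), n ≤ N → (∀ y ∈ Set.Icc a (a + n), BothComparable N x σ y) →
      weylTotal (fun b => -(a + b) ^ β) (fun b => -(x + σ * (a + b)) ^ β) n L ≤
        C * (L ^ 7 * N ^ (3 / 2 - β) + N / L + N ^ (2 - β) / x * (1 + Real.log L)) := by
  obtain ⟨C₁, hC₁, hV₁⟩ := norm_sum_phase_le_of_ne_zero hβ hβ'
  obtain ⟨C₂, hC₂, hV₂⟩ := norm_sum_phase_le_of_add_ne_zero hβ hβ'
  obtain ⟨C₃, hC₃, hV₃⟩ := norm_sum_phase_diagonal_le hβ hβ'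
  refine ⟨9 * 25 * C₁ + 9 * C₂ + 2 * C₃, by positivity, ?_⟩
  intro N x σ hN hσ hx L hL a n hn h
  have hN0 : 0 < N := by linarith
  have hL1 : (1 : ℝ) ≤ L := by exact_mod_cast hL
  have hL0 : (0 : ℝ) < L := by linarith
  set M := N ^ (3 / 2 - β) with hM
  have hM1 : 1 ≤ M := Real.one_le_rpow (by linarith) (by linarith)
  have hM0 : 0 < M := by linarith
  have hlog : 0 ≤ Real.log L := Real.log_nonneg hL1
  have hD : 0 < N ^ (2 - β) / x := by positivity
  have hσ2 : σ ^ 2 = 1 := by rcases hσ with rfl | rfl <;> norm_num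
  set K := Finset.Icc (-(L : ℤ)) L with hK
  have hKabs : ∀ k ∈ K, |(k : ℝ)| ≤ L := by
    intro k hk
    rw [hK, Finset.mem_Icc] at hk
    rw [abs_le]
    exact ⟨by exact_mod_cast hk.1, by exact_mod_cast hk.2⟩
  have hKcard : ((K ×ˢ K).card : ℝ) ≤ 9 * (L : ℝ) ^ 2 := by
    have : K.card = 2 * L + 1 := by rw [hK, Int.card_Icc]; omega
    rw [Finset.card_product, this]
    push_cast
    nlinarith
  have hterm : ∀ kl : ℤ × ℤ, ‖∑ b ∈ Finset.range n,
      unitExp (kl.1 * -(a + b) ^ β + kl.2 * -(x + σ * (a + b)) ^ β)‖ =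
      ‖∑ b ∈ Finset.range n, unitExp (phase β x σ kl.1 kl.2 (a + b))‖ := by
    intro kl
    rw [← norm_sum_unitExp_neg]
    congr 1
    refine Finset.sum_congr rfl fun b _ => ?_
    rw [phase]; ring_nf
  rw [weylTotal]
  simp_rw [hterm]
  rcases le_or_gt x (N / (24 * L)) with hsmall | hlarge
  -- For small `x`, the values `y` and `x - y` cannot both be comparable to `N`.
  · have hσ1 : σ = 1 := by
      rcases hσ with rfl | rfl
      · rfl
      · exfalso
        obtain ⟨h1, h2, h3, h4⟩ := h a ⟨le_rfl, by linarith [(Nat.cast_nonneg n : (0 : ℝ) ≤ n)]⟩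
        have h5 : N / (24 * L) ≤ N / 24 := by
          apply div_le_div_of_nonneg_left hN0.le (by norm_num)
          linarith
        linarith
    subst hσ1
    have hb : ∀ kl ∈ (K ×ˢ K).erase (0, 0),
        ‖∑ b ∈ Finset.range n, unitExp (phase β x 1 kl.1 kl.2 (a + b))‖ ≤
          C₂ * (L * M) + if kl.2 = -kl.1 then C₃ * (N ^ (2 - β) / x) * (1 / |(kl.1 : ℝ)|) else 0 := by
      rintro ⟨k, l⟩ hkl
      simp only [Finset.mem_erase, Finset.mem_product, ne_eq, Prod.mk.injEq] at hkl
      obtain ⟨hne, hk, hl⟩ := hkl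
      simp only
      split_ifs with heq
      · subst heq
        have := hV₃ hN hx hL1 (hKabs k hk) (by
          intro h0; apply hne; simp [h0]) hsmall a n h
        have h0 : 0 < C₂ * (L * M) := by positivity
        rw [mul_one_div]
        linarith
      · rw [add_zero]
        exact hV₂ hN hx hL1 (hKabs k hk) (hKabs l hl) (by omega) hsmall a n hn h
    refine (Finset.sum_le_sum hb).trans ?_
    refine (Finset.sum_le_sum_of_subset_of_nonneg (Finset.erase_subset _ _) (by
      intro kl _ _; split_ifs <;> positivity)).trans ?_
    rw [Finset.sum_add_distrib, Finset.sum_const, nsmul_eq_mul, Finset.sum_product]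
    have h1 : ∑ k ∈ K, ∑ l ∈ K,
        (if l = -k then C₃ * (N ^ (2 - β) / x) * (1 / |(k : ℝ)|) else 0) ≤
          C₃ * (N ^ (2 - β) / x) * (2 * (1 + Real.log L)) := by
      refine le_trans ?_ (mul_le_mul_of_nonneg_left (sum_inv_abs_Icc_le L) (by positivity))
      rw [Finset.mul_sum]
      refine Finset.sum_le_sum fun k _ => ?_
      rw [Finset.sum_ite_eq']
      split_ifs
      · exact le_rfl
      · positivity
    have h2 : ((K ×ˢ K).card : ℝ) * (C₂ * (L * M)) ≤ 9 * C₂ * (L ^ 7 * M) := by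
      have h3 : (L : ℝ) ^ 3 ≤ L ^ 7 := pow_le_pow_right₀ hL1 (by norm_num)
      calc ((K ×ˢ K).card : ℝ) * (C₂ * (L * M)) ≤ 9 * (L : ℝ) ^ 2 * (C₂ * (L * M)) := by gcongr
        _ = 9 * C₂ * (L ^ 3 * M) := by ring
        _ ≤ 9 * C₂ * (L ^ 7 * M) := by gcongr
    have h4 : 0 < (L : ℝ) ^ 7 * M := by positivity
    have h5 : 0 < N / (L : ℝ) := by positivity
    have h6 : 0 ≤ N ^ (2 - β) / x * (1 + Real.log L) := by positivity
    have h7 : 0 ≤ C₁ * (L ^ 7 * M) := by positivity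
    have h8 : 0 ≤ C₁ * (N / L) := by positivity
    have h9 : 0 ≤ C₁ * (N ^ (2 - β) / x * (1 + Real.log L)) := by positivity
    have h10 : 0 ≤ C₂ * (N / L) := by positivity
    have h11 : 0 ≤ C₂ * (N ^ (2 - β) / x * (1 + Real.log L)) := by positivity
    have h12 : 0 ≤ C₃ * (N / L) := by positivity
    have h13 : 0 ≤ C₃ * (L ^ 7 * M) := by positivity
    linarith
  -- With `μ = L ^ (-4)`, the `9 * L ^ 2` frequencies contribute `O (N / L)` through the indices
  -- of small curvature.
  · have hb : ∀ kl ∈ (K ×ˢ K).erase (0, 0),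
        ‖∑ b ∈ Finset.range n, unitExp (phase β x σ kl.1 kl.2 (a + b))‖ ≤
          25 * C₁ * (L ^ 5 * M + N / L ^ 3) := by
      rintro ⟨k, l⟩ hkl
      simp only [Finset.mem_erase, Finset.mem_product, ne_eq, Prod.mk.injEq] at hkl
      obtain ⟨hne, hk, hl⟩ := hkl
      have h1 := hV₁ (μ := 1 / (L : ℝ) ^ 4) hN hσ2 hx hL1 (hKabs k hk) (hKabs l hl) (by tauto)
        (by positivity) ((div_le_one (by positivity)).2 (one_le_pow₀ hL1)) a n hn h
      refine h1.trans ?_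
      have h2 : L * N ^ (3 / 2 - β) / (1 / (L : ℝ) ^ 4) = L ^ 5 * M := by
        rw [hM]; field_simp
      have h3 : 1 / (L : ℝ) ^ 4 * N ^ 2 / x ≤ 24 * (N / L ^ 3) := by
        rw [div_lt_iff₀ (by positivity)] at hlarge
        rw [div_le_iff₀ hx]
        have h4 : N * N ≤ N * (x * (24 * L)) := by gcongr
        calc 1 / (L : ℝ) ^ 4 * N ^ 2 = 1 / (L : ℝ) ^ 4 * (N * N) := by ring
          _ ≤ 1 / (L : ℝ) ^ 4 * (N * (x * (24 * L))) := by gcongr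
          _ = 24 * (N / L ^ 3) * x := by field_simp
      have h4 : 1 ≤ (L : ℝ) ^ 5 * M := one_le_mul_of_one_le_of_one_le (one_le_pow₀ hL1) hM1
      rw [h2]
      have h5 : 0 < N / (L : ℝ) ^ 3 := by positivity
      have : C₁ * (L ^ 5 * M + 1 / (L : ℝ) ^ 4 * N ^ 2 / x + 1) ≤
          C₁ * (25 * (L ^ 5 * M + N / L ^ 3)) := by
        apply mul_le_mul_of_nonneg_left _ hC₁.le
        linarith
      linarith
    refine (Finset.sum_le_card_nsmul _ _ _ hb).trans ?_
    rw [nsmul_eq_mul]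
    have h1 : (((K ×ˢ K).erase (0, 0)).card : ℝ) ≤ 9 * (L : ℝ) ^ 2 :=
      le_trans (by exact_mod_cast Finset.card_erase_le) hKcard
    calc (((K ×ˢ K).erase (0, 0)).card : ℝ) * (25 * C₁ * (L ^ 5 * M + N / L ^ 3))
        ≤ 9 * (L : ℝ) ^ 2 * (25 * C₁ * (L ^ 5 * M + N / L ^ 3)) := by gcongr
      _ = 9 * 25 * C₁ * (L ^ 7 * M + N / L + 0) := by field_simp; ring
      _ ≤ (9 * 25 * C₁ + 9 * C₂ + 2 * C₃) *
          (L ^ 7 * M + N / L + N ^ (2 - β) / x * (1 + Real.log L)) := by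
        gcongr
        · linarith
        · positivity

/-! ### Pairs of integers of the form `⌊m ^ α⌋` in short blocks -/

/-- For `y ≥ 1` and `β = 1 / α < 1`, this says that `y` is of the form `⌊m ^ α⌋`, that is, that
`⌈y ^ β⌉ < (y + 1) ^ β`. The fractional part makes it a condition modulo one. -/
def IsFloorPower (β : ℝ) (y : ℤ) : Prop :=
  Int.fract (-(y : ℝ) ^ β) < ((y : ℝ) + 1) ^ β - (y : ℝ) ^ β

lemma abs_rpow_sub_rpow_le_of_comparable {N β y z : ℝ} (hN : 0 < N) (hβ : 0 < β) (hβ' : β < 1)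
    (hy : N / 6 ≤ y) (hy' : y ≤ 6 * N) (hz : N / 6 ≤ z) (hz' : z ≤ 6 * N) :
    |y ^ (β - 1) - z ^ (β - 1)| ≤ 36 * N ^ (β - 2) * |y - z| := by
  have h := Convex.norm_image_sub_le_of_norm_hasDerivWithin_le (f := fun t : ℝ => t ^ (β - 1))
    (f' := fun t : ℝ => (β - 1) * t ^ (β - 2)) (s := Set.Icc (N / 6) (6 * N))
    (C := 36 * N ^ (β - 2)) (x := z) (y := y) ?_ ?_ (convex_Icc _ _) ⟨hz, hz'⟩ ⟨hy, hy'⟩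
  · simpa [Real.norm_eq_abs] using h
  · intro t ht
    have := Real.hasDerivAt_rpow_const (x := t) (p := β - 1) (Or.inl (by linarith [ht.1]))
    rw [show β - 1 - 1 = β - 2 by ring] at this
    exact this.hasDerivWithinAt
  · intro t ht
    obtain ⟨h1, h2⟩ := rpow_bounds_of_comparable hN hβ hβ' ht.1 ht.2
    have h0 : 0 < t := by linarith [ht.1]
    have h3 : 0 < t ^ (β - 2) := by positivity
    rw [Real.norm_eq_abs, abs_mul, abs_of_neg (by linarith), abs_of_pos h3]
    nlinarith

lemma abs_increment_sub_le {N β y z D : ℝ} (hN : 0 < N) (hβ : 0 < β) (hβ' : β < 1)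
    (hy : N / 6 ≤ y) (hy' : y + 1 ≤ 6 * N) (hz : N / 6 ≤ z) (hz' : z ≤ 6 * N)
    (hyz : |y - z| ≤ D) :
    |(y + 1) ^ β - y ^ β - β * z ^ (β - 1)| ≤ 36 * N ^ (β - 2) * (D + 1) := by
  obtain ⟨ξ, hξ, he⟩ := exists_hasDerivAt_eq_slope (fun t : ℝ => t ^ β)
    (fun t : ℝ => β * t ^ (β - 1)) (show y < y + 1 by linarith)
    (fun t ht => (Real.hasDerivAt_rpow_const (x := t) (p := β)
      (Or.inl (by linarith [ht.1]))).continuousAt.continuousWithinAt)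
    (fun t ht => Real.hasDerivAt_rpow_const (Or.inl (by linarith [ht.1])))
  rw [show y + 1 - y = 1 by ring, div_one] at he
  rw [← he, ← mul_sub, abs_mul, abs_of_pos hβ]
  have h1 := abs_rpow_sub_rpow_le_of_comparable (y := ξ) (z := z) hN hβ hβ' (by linarith [hξ.1])
    (by linarith [hξ.2]) hz hz'
  have h2 : |ξ - z| ≤ D + 1 := by
    have h3 := abs_le.1 hyz
    rw [abs_le]
    exact ⟨by linarith [hξ.1], by linarith [hξ.2]⟩
  have h4 : 0 < N ^ (β - 2) := by positivity
  have h5 : |ξ ^ (β - 1) - z ^ (β - 1)| ≤ 36 * N ^ (β - 2) * (D + 1) :=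
    h1.trans (by gcongr)
  nlinarith [abs_nonneg (ξ ^ (β - 1) - z ^ (β - 1))]

lemma density_bounds {N β y : ℝ} (hN : 0 < N) (hβ : 1 / 2 ≤ β) (hβ' : β < 1)
    (hy : N / 5 ≤ y) (hy' : y ≤ 5 * N) :
    N ^ (β - 1) / 10 ≤ β * y ^ (β - 1) ∧ β * y ^ (β - 1) ≤ 5 * N ^ (β - 1) := by
  have hD : 0 < N ^ (β - 1) := by positivity
  have h5 : (5 : ℝ) ^ (1 - β) ≤ 5 := by
    calc (5 : ℝ) ^ (1 - β) ≤ 5 ^ (1 : ℝ) :=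
          Real.rpow_le_rpow_of_exponent_le (by norm_num) (by linarith)
      _ = 5 := by norm_num
  have h0 : (0 : ℝ) < 5 ^ (1 - β) := by positivity
  have e : (5 : ℝ) ^ (β - 1) = (5 ^ (1 - β))⁻¹ := by
    rw [← Real.rpow_neg (by norm_num)]; congr 1; ring
  have hy0 : 0 < y := by linarith
  constructor
  · have h := Real.rpow_le_rpow_of_nonpos (z := β - 1) (by linarith) hy' (by linarith)
    rw [Real.mul_rpow (by norm_num) hN.le, e] at h
    have h1 : N ^ (β - 1) / 5 ≤ y ^ (β - 1) := by
      refine le_trans ?_ h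
      rw [div_eq_inv_mul]
      gcongr
    calc N ^ (β - 1) / 10 = 1 / 2 * (N ^ (β - 1) / 5) := by ring
      _ ≤ β * y ^ (β - 1) := by gcongr
  · have h := Real.rpow_le_rpow_of_nonpos (z := β - 1) (by linarith) hy (by linarith)
    rw [Real.div_rpow hN.le (by norm_num), e, div_inv_eq_mul] at h
    have h1 : y ^ (β - 1) ≤ 5 * N ^ (β - 1) := by
      refine h.trans ?_
      rw [mul_comm]
      gcongr
    have h2 : 0 < y ^ (β - 1) := by positivity
    nlinarith

/-- The exponential sum bound with frequencies up to `s ^ (1 / 100)` and `N = s ^ α`. -/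
lemma weylTotal_le_rpow {α δ : ℝ} (hα : 1 < α) (hα' : α < 1 + 1 / 1000) (hδ : 0 < δ)
    (hδ' : δ ≤ 1 / 1000) :
    ∃ K : ℝ, 0 < K ∧ ∀ {s x σ : ℝ}, 4 ≤ s → (σ = 1 ∨ σ = -1) → 0 < x → s ^ (α - 1 + δ) ≤ x →
      ∀ (a : ℝ) (n : ℕ), n ≤ s ^ α →
      (∀ y ∈ Set.Icc a (a + n), BothComparable (s ^ α) x σ y) →
      weylTotal (fun b => -(a + b) ^ (1 / α)) (fun b => -(x + σ * (a + b)) ^ (1 / α)) n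
        ⌊s ^ (1 / 100 : ℝ)⌋₊ ≤ K * s ^ (α - 2 * (δ / 4)) := by
  set η := δ / 4 with hη
  set β := 1 / α with hβdef
  have hη0 : 0 < η := by positivity
  have hα0 : 0 < α := by linarith
  have hαβ : α * β = 1 := by rw [hβdef]; field_simp
  have hβ' : β < 1 := by rw [hβdef, div_lt_one hα0]; exact hα
  have hβ : 0 < β := by rw [hβdef]; positivity
  obtain ⟨C, hC, hW⟩ := weylTotal_le hβ hβ'
  refine ⟨C * (4 + (1 + 1 / (2 * η))), by positivity, ?_⟩
  intro s x σ hs4 hσ hx0' hxs a n hn hcmp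
  have hs1 : 1 ≤ s := by linarith
  have hs0 : 0 < s := by linarith
  have hpow : ∀ {a b : ℝ}, a ≤ b → s ^ a ≤ s ^ b := fun h =>
    Real.rpow_le_rpow_of_exponent_le hs1 h
  set N := s ^ α with hN
  have hN0 : 0 < N := by positivity
  have hNs : s ≤ N := by
    calc s = s ^ (1 : ℝ) := (Real.rpow_one s).symm
      _ ≤ s ^ α := hpow hα.le
  have hNpow : ∀ t : ℝ, N ^ t = s ^ (α * t) := fun t => (Real.rpow_mul hs0.le α t).symm
  obtain ⟨L, hLdef⟩ : ∃ L : ℕ, L = ⌊s ^ (1 / 100 : ℝ)⌋₊ := ⟨_, rfl⟩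
  rw [← hLdef]
  have hLle : (L : ℝ) ≤ s ^ (1 / 100 : ℝ) := by rw [hLdef]; exact Nat.floor_le (by positivity)
  have hLone : 1 ≤ s ^ (1 / 100 : ℝ) := Real.one_le_rpow hs1 (by norm_num)
  have hL1 : 1 ≤ L := by rw [hLdef]; exact (Nat.one_le_floor_iff _).2 hLone
  have hLge : s ^ (1 / 100 : ℝ) / 2 ≤ L := by
    have h4 := Nat.lt_floor_add_one (s ^ (1 / 100 : ℝ))
    have h5 : (1 : ℝ) ≤ L := by exact_mod_cast hL1
    rw [← hLdef] at h4
    linarith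
  have hL0 : (0 : ℝ) < L := by exact_mod_cast hL1
  have hweyl := hW (N := N) (x := x) (σ := σ) (by linarith) hσ hx0' hL1 a n hn hcmp
  have w1 : (L : ℝ) ^ 7 * N ^ (3 / 2 - β) ≤ s ^ (α - 2 * η) := by
    have e1 : N ^ (3 / 2 - β) = s ^ (3 / 2 * α - 1) := by
      rw [hNpow]; congr 1; rw [mul_sub, hαβ]; ring
    have e2 : (s ^ (1 / 100 : ℝ)) ^ 7 = s ^ (7 / 100 : ℝ) := by
      rw [← Real.rpow_natCast, ← Real.rpow_mul hs0.le]; norm_num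
    calc (L : ℝ) ^ 7 * N ^ (3 / 2 - β) ≤ (s ^ (1 / 100 : ℝ)) ^ 7 * s ^ (3 / 2 * α - 1) := by
          rw [e1]; gcongr
      _ = s ^ (7 / 100 + (3 / 2 * α - 1)) := by rw [e2, ← Real.rpow_add hs0]
      _ ≤ s ^ (α - 2 * η) := hpow (by linarith)
  have w2 : N / L ≤ 2 * s ^ (α - 2 * η) := by
    rw [div_le_iff₀ hL0]
    have e1 : N = s ^ (α - 1 / 100) * s ^ (1 / 100 : ℝ) := by
      rw [hN, ← Real.rpow_add hs0]; congr 1; ring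
    calc N = 2 * s ^ (α - 1 / 100) * (s ^ (1 / 100 : ℝ) / 2) := by rw [e1]; ring
      _ ≤ 2 * s ^ (α - 2 * η) * L := by
        have := hpow (show α - 1 / 100 ≤ α - 2 * η by linarith)
        gcongr
  have w3 : N ^ (2 - β) / x * (1 + Real.log L) ≤ (1 + 1 / (2 * η)) * s ^ (α - 2 * η) := by
    have e1 : N ^ (2 - β) = s ^ (2 * α - 1) := by
      rw [hNpow]; congr 1; rw [mul_sub, hαβ]; ring
    have h4 : N ^ (2 - β) / x ≤ s ^ (α - 4 * η) := by
      rw [div_le_iff₀ hx0', e1]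
      calc s ^ (2 * α - 1) = s ^ (α - 4 * η) * s ^ (α - 1 + δ) := by
            rw [← Real.rpow_add hs0]; congr 1; rw [hη]; ring
        _ ≤ s ^ (α - 4 * η) * x := by gcongr
    have h5 : Real.log L ≤ s ^ (2 * η) / (2 * η) := by
      calc Real.log L ≤ Real.log s := by
            apply Real.log_le_log hL0
            refine hLle.trans ?_
            calc s ^ (1 / 100 : ℝ) ≤ s ^ (1 : ℝ) := hpow (by norm_num)
              _ = s := Real.rpow_one s
        _ ≤ s ^ (2 * η) / (2 * η) := Real.log_le_rpow_div hs0.le (by positivity)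
    have h6 : 1 ≤ s ^ (2 * η) := Real.one_le_rpow hs1 (by positivity)
    have h7 : 1 + Real.log L ≤ (1 + 1 / (2 * η)) * s ^ (2 * η) := by
      have : (1 + 1 / (2 * η)) * s ^ (2 * η) = s ^ (2 * η) + s ^ (2 * η) / (2 * η) := by ring
      linarith
    have h8 : 0 ≤ 1 + Real.log L := by
      have := Real.log_nonneg (show (1 : ℝ) ≤ L by exact_mod_cast hL1)
      linarith
    calc N ^ (2 - β) / x * (1 + Real.log L)
        ≤ s ^ (α - 4 * η) * ((1 + 1 / (2 * η)) * s ^ (2 * η)) := by gcongr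
      _ = (1 + 1 / (2 * η)) * (s ^ (α - 4 * η) * s ^ (2 * η)) := by ring
      _ = (1 + 1 / (2 * η)) * s ^ (α - 2 * η) := by
        rw [← Real.rpow_add hs0]; congr 2; ring
  refine hweyl.trans ?_
  have : 0 < s ^ (α - 2 * η) := by positivity
  rw [mul_assoc]
  gcongr
  linarith

/-- Counting on a block of consecutive integers, in terms of exponential sums. -/
lemma abs_card_block_sub_le_weylTotal {N β κ : ℝ} (hN : 0 < N) (hβ : 1 / 2 ≤ β) (hβ' : β < 1)
    {B L : ℕ} (hBN : (B : ℝ) + 1 ≤ N / 30) (hL1 : 1 ≤ L) (hκ0 : 0 < κ)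
    (hκB : 36 * N ^ (β - 2) * (B + 1) ≤ κ) (hκN : 3 * κ ≤ N ^ (β - 1) / 10)
    (hN1 : 5 * N ^ (β - 1) + 3 * κ ≤ 1) (hτ : 1 / (κ * L) ≤ 1) {σ : ℤ} (hσ : σ = 1 ∨ σ = -1)
    {x y z : ℤ} (hz : z = x + σ * y) (hy1 : N / 5 ≤ y) (hy2 : y ≤ 5 * N) (hz1 : N / 5 ≤ z)
    (hz2 : z ≤ 5 * N) [DecidablePred (IsFloorPower β)] :
    |(((Finset.range B).filter (fun b : ℕ => IsFloorPower β (y + b) ∧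
        IsFloorPower β (x + σ * (y + b)))).card : ℝ) -
      B * ((β * (y : ℝ) ^ (β - 1)) * (β * (z : ℝ) ^ (β - 1)))| ≤
      B * (6 * κ * (5 * N ^ (β - 1))) + 3 * B * (1 / (κ * L)) + 4 * (5 * N ^ (β - 1)) ^ 2 *
        weylTotal (fun b => -((y : ℝ) + b) ^ β) (fun b => -((x : ℝ) + σ * (y + b)) ^ β) B L := by
  have hβ0 : 0 < β := by linarith
  have hB0 : (0 : ℝ) ≤ B := Nat.cast_nonneg B
  have hσr : ((σ : ℝ) = 1 ∨ (σ : ℝ) = -1) := by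
    rcases hσ with rfl | rfl <;> simp
  have hzcast : (z : ℝ) = x + σ * y := by rw [hz]; push_cast; ring
  have hcast : ∀ b : ℕ, ((x + σ * (y + b) : ℤ) : ℝ) = z + σ * b := by
    intro b; rw [hzcast]; push_cast; ring
  have hσb : ∀ t : ℝ, |(σ : ℝ) * t| = |t| := by
    intro t
    rcases hσr with h | h <;> rw [h] <;> simp
  -- The increments of `t ^ β` are constant on the block up to `κ`.
  have hinc : ∀ w v : ℝ, N / 5 ≤ w → w ≤ 5 * N → |v - w| ≤ B →
      |(v + 1) ^ β - v ^ β - β * w ^ (β - 1)| ≤ κ := by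
    intro w v hw1 hw2 hvw
    have h4 := abs_le.1 hvw
    exact (abs_increment_sub_le hN hβ0 hβ' (by linarith) (by linarith) (by linarith)
      (by linarith) hvw).trans hκB
  obtain ⟨dy1, dy2⟩ := density_bounds hN hβ hβ' hy1 hy2
  obtain ⟨dz1, dz2⟩ := density_bounds hN hβ hβ' hz1 hz2
  have hyb : ∀ b : ℕ, ((y + b : ℤ) : ℝ) = (y : ℝ) + b := by intro b; push_cast; ring
  have hbB : ∀ b : ℕ, b < B → |((y : ℝ) + b) - y| ≤ B ∧ |((z : ℝ) + σ * b) - z| ≤ B := by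
    intro b hb
    have hb' : (b : ℝ) ≤ B := by exact_mod_cast hb.le
    rw [add_sub_cancel_left, add_sub_cancel_left, hσb, Nat.abs_cast]
    exact ⟨hb', hb'⟩
  have e : ∀ b : ℕ, (x : ℝ) + σ * (y + b) = z + σ * b := by intro b; rw [hzcast]; ring
  refine abs_card_filter_sub_le (fun b : ℕ => -((y : ℝ) + b) ^ β)
    (fun b : ℕ => -((x : ℝ) + σ * (y + b)) ^ β) B hL1 (fun b : ℕ => IsFloorPower β (y + b))
    (fun b : ℕ => IsFloorPower β (x + σ * (y + b))) hκ0 (by linarith) (by linarith) dy2 dz2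
    hN1 hτ ?_ ?_ ?_ ?_
  · intro b hb hlt
    have h4 := abs_le.1 (hinc y ((y : ℝ) + b) hy1 hy2 (hbB b hb).1)
    rw [IsFloorPower, hyb]
    linarith [h4.1]
  · intro b hb hlt
    have h4 := abs_le.1 (hinc y ((y : ℝ) + b) hy1 hy2 (hbB b hb).1)
    rw [IsFloorPower, hyb] at hlt
    linarith [h4.2]
  · intro b hb hlt
    have h4 := abs_le.1 (hinc z ((z : ℝ) + σ * b) hz1 hz2 (hbB b hb).2)
    rw [e] at hlt
    rw [IsFloorPower, hcast]
    linarith [h4.1]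
  · intro b hb hlt
    have h4 := abs_le.1 (hinc z ((z : ℝ) + σ * b) hz1 hz2 (hbB b hb).2)
    rw [IsFloorPower, hcast] at hlt
    rw [e]
    linarith [h4.2]

set_option maxHeartbeats 1000000 in
open Filter in
/-- On a block of `s ^ (α - δ / 4)` consecutive integers `y` of size `s ^ α`, the number of `y` for
which both `y` and `x + σ * y` are of the form `⌊m ^ α⌋` is the expected one, up to a relative error
that is a negative power of `s`. -/
lemma abs_card_block_sub_le {α δ : ℝ} (hα : 1 < α) (hα' : α < 1 + 1 / 1000) (hδ : 0 < δ)
    (hδ' : δ ≤ 1 / 1000) :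
    ∃ K s₀ : ℝ, 0 < K ∧ 1 ≤ s₀ ∧ ∀ s, s₀ ≤ s → ∀ σ : ℤ, (σ = 1 ∨ σ = -1) → ∀ x y : ℤ,
      0 < x → s ^ (α - 1 + δ) ≤ x → s ^ α / 5 ≤ y → y ≤ 5 * s ^ α →
      s ^ α / 5 ≤ ((x + σ * y : ℤ) : ℝ) → ((x + σ * y : ℤ) : ℝ) ≤ 5 * s ^ α →
      ∀ [DecidablePred (IsFloorPower (1 / α))],
      |(((Finset.range ⌊s ^ (α - δ / 4)⌋₊).filter (fun b : ℕ => IsFloorPower (1 / α) (y + b) ∧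
          IsFloorPower (1 / α) (x + σ * (y + b)))).card : ℝ) -
        ⌊s ^ (α - δ / 4)⌋₊ * ((1 / α * (y : ℝ) ^ (1 / α - 1)) *
          (1 / α * ((x + σ * y : ℤ) : ℝ) ^ (1 / α - 1)))| ≤ K * s ^ (2 - α - 2 * (δ / 4)) := by
  set η := δ / 4 with hη
  set β := 1 / α with hβdef
  have hη0 : 0 < η := by positivity
  have hα0 : 0 < α := by linarith
  have hαβ : α * β = 1 := by rw [hβdef]; field_simp
  have hβ' : β < 1 := by rw [hβdef, div_lt_one hα0]; exact hα
  have hβ2 : 1 / 2 ≤ β := by rw [hβdef]; apply one_div_le_one_div_of_le hα0; linarith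
  have hβ : 0 < β := by linarith
  obtain ⟨C, hC, hW⟩ := weylTotal_le_rpow hα hα' hδ hδ'
  have ev1 : ∀ᶠ s : ℝ in atTop, s ^ (-η) ≤ 1 / 2160 :=
    (tendsto_rpow_neg_atTop hη0).eventually (ge_mem_nhds (by norm_num))
  have ev2 : ∀ᶠ s : ℝ in atTop, s ^ (-(α - 1)) ≤ 1 / 221 :=
    (tendsto_rpow_neg_atTop (show 0 < α - 1 by linarith)).eventually (ge_mem_nhds (by norm_num))
  obtain ⟨s₁, hs₁⟩ := eventually_atTop.1 (ev1.and ev2)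
  refine ⟨2160 + 3 + 100 * C, max s₁ 60, by positivity,
    le_trans (by norm_num) (le_max_right _ _), ?_⟩
  intro s hs σ hσ x y hx0 hxs hy1 hy2 hz1 hz2 _
  obtain ⟨h1, h2⟩ := hs₁ s ((le_max_left _ _).trans hs)
  have hs60 : 60 ≤ s := (le_max_right _ _).trans hs
  have hs1 : 1 ≤ s := by linarith
  have hs0 : 0 < s := by linarith
  have hpow : ∀ {a b : ℝ}, a ≤ b → s ^ a ≤ s ^ b := fun h =>
    Real.rpow_le_rpow_of_exponent_le hs1 h
  set N := s ^ α with hN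
  have hN0 : 0 < N := by positivity
  have hNs : s ≤ N := by
    calc s = s ^ (1 : ℝ) := (Real.rpow_one s).symm
      _ ≤ s ^ α := hpow hα.le
  have hNpow : ∀ t : ℝ, N ^ t = s ^ (α * t) := fun t => (Real.rpow_mul hs0.le α t).symm
  have hNβ1 : N ^ (β - 1) = s ^ (1 - α) := by
    rw [hNpow]; congr 1; rw [mul_sub, hαβ, mul_one]
  have hNβ2 : N ^ (β - 2) = s ^ (1 - 2 * α) := by
    rw [hNpow]; congr 1; rw [mul_sub, hαβ]; ring
  obtain ⟨B, hB⟩ : ∃ B : ℕ, B = ⌊s ^ (α - η)⌋₊ := ⟨_, rfl⟩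
  rw [← hB]
  have hBle : (B : ℝ) ≤ s ^ (α - η) := by rw [hB]; exact Nat.floor_le (by positivity)
  have hsη : s ^ (α - η) = N * s ^ (-η) := by
    rw [hN, ← Real.rpow_add hs0]; congr 1
  have hBN : (B : ℝ) ≤ N / 2160 := by
    rw [hsη] at hBle
    have := mul_le_mul_of_nonneg_left h1 hN0.le
    linarith
  have hB0 : (0 : ℝ) ≤ B := Nat.cast_nonneg B
  have hone : 1 ≤ s ^ (α - η) := Real.one_le_rpow hs1 (by linarith)
  obtain ⟨L, hLdef⟩ : ∃ L : ℕ, L = ⌊s ^ (1 / 100 : ℝ)⌋₊ := ⟨_, rfl⟩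
  have hLone : 1 ≤ s ^ (1 / 100 : ℝ) := Real.one_le_rpow hs1 (by norm_num)
  have hL1 : 1 ≤ L := by rw [hLdef]; exact (Nat.one_le_floor_iff _).2 hLone
  have hLge : s ^ (1 / 100 : ℝ) / 2 ≤ L := by
    have h4 := Nat.lt_floor_add_one (s ^ (1 / 100 : ℝ))
    have h5 : (1 : ℝ) ≤ L := by exact_mod_cast hL1
    rw [← hLdef] at h4
    linarith
  have hL0 : (0 : ℝ) < L := by exact_mod_cast hL1
  -- `κ` bounds the variation of the increments of `t ^ β` over the block.
  obtain ⟨κ, hκ⟩ : ∃ κ : ℝ, κ = 72 * s ^ (1 - α - η) := ⟨_, rfl⟩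
  have hκ0 : 0 < κ := by rw [hκ]; positivity
  have hσr : ((σ : ℝ) = 1 ∨ (σ : ℝ) = -1) := by
    rcases hσ with rfl | rfl <;> simp
  have hsplit : s ^ (1 - α - η) = s ^ (1 - α) * s ^ (-η) := by
    rw [← Real.rpow_add hs0]; congr 1
  have hρs : 0 < s ^ (1 - α) := by positivity
  have hκB : 36 * N ^ (β - 2) * (B + 1) ≤ κ := by
    rw [hNβ2, hκ]
    have : s ^ (1 - α - η) = s ^ (1 - 2 * α) * s ^ (α - η) := by
      rw [← Real.rpow_add hs0]; congr 1; ring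
    rw [this]
    have h5 : (B : ℝ) + 1 ≤ 2 * s ^ (α - η) := by linarith
    have h6 : 0 < s ^ (1 - 2 * α) := by positivity
    nlinarith
  have hκρ : 3 * κ ≤ s ^ (1 - α) / 10 := by
    rw [hκ, hsplit]
    have := mul_le_mul_of_nonneg_left h1 hρs.le
    linarith
  have hρ1 : s ^ (1 - α) ≤ 1 / 221 := by
    rwa [neg_sub] at h2
  have hτ : 1 / (κ * L) ≤ s ^ (2 - 2 * α - η) := by
    rw [div_le_iff₀ (by positivity)]
    have h4 : κ * L ≥ 72 * s ^ (1 - α - η) * (s ^ (1 / 100 : ℝ) / 2) := by rw [hκ]; gcongr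
    have h5 : s ^ (2 - 2 * α - η) * (s ^ (1 - α - η) * s ^ (1 / 100 : ℝ)) =
        s ^ (3 - 3 * α - 2 * η + 1 / 100) := by
      rw [← Real.rpow_add hs0, ← Real.rpow_add hs0]; congr 1; ring
    have h6 : 1 ≤ s ^ (3 - 3 * α - 2 * η + 1 / 100) := Real.one_le_rpow hs1 (by linarith)
    have h7 : 0 < s ^ (2 - 2 * α - η) := by positivity
    have h8 := mul_le_mul_of_nonneg_left h4.le h7.le
    linarith
  have hτ1 : 1 / (κ * L) ≤ 1 :=
    hτ.trans (Real.rpow_le_one_of_one_le_of_nonpos hs1 (by linarith))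
  refine (abs_card_block_sub_le_weylTotal hN0 hβ2 hβ' (by linarith) hL1 hκ0 hκB
    (by rw [hNβ1]; exact hκρ) (by rw [hNβ1]; linarith) hτ1 hσ rfl hy1 hy2 hz1 hz2).trans ?_
  rw [hNβ1]
  have hx0' : (0 : ℝ) < x := by exact_mod_cast hx0
  have hweyl := hW (s := s) (x := x) (σ := σ) (by linarith) hσr hx0' hxs y B (by linarith) (by
    intro t ht
    have e : (x : ℝ) + σ * t = (x + σ * y : ℤ) + σ * (t - y) := by push_cast; ring
    have h4 : |(σ : ℝ) * (t - y)| ≤ B := by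
      have h6 : |(σ : ℝ)| = 1 := by rcases hσr with h | h <;> rw [h] <;> simp
      rw [abs_mul, h6, one_mul, abs_of_nonneg (by linarith [ht.1])]
      linarith [ht.2]
    have h5 := abs_le.1 h4
    refine ⟨by linarith [ht.1], by linarith [ht.2], ?_, ?_⟩
    · rw [e]; linarith [h5.1]
    · rw [e]; linarith [h5.2])
  rw [← hLdef] at hweyl
  have t1 : (B : ℝ) * (6 * κ * (5 * s ^ (1 - α))) ≤ 2160 * s ^ (2 - α - 2 * η) := by
    calc (B : ℝ) * (6 * κ * (5 * s ^ (1 - α))) ≤ s ^ (α - η) * (6 * κ * (5 * s ^ (1 - α))) := by gcongr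
      _ = 2160 * (s ^ (α - η) * s ^ (1 - α - η) * s ^ (1 - α)) := by rw [hκ]; ring
      _ = 2160 * s ^ (2 - α - 2 * η) := by
        rw [← Real.rpow_add hs0, ← Real.rpow_add hs0]; congr 2; ring
  have t2 : 3 * (B : ℝ) * (1 / (κ * L)) ≤ 3 * s ^ (2 - α - 2 * η) := by
    calc 3 * (B : ℝ) * (1 / (κ * L)) ≤ 3 * s ^ (α - η) * s ^ (2 - 2 * α - η) := by gcongr
      _ = 3 * s ^ (2 - α - 2 * η) := by
        rw [mul_assoc, ← Real.rpow_add hs0]; congr 2; ring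
  have t3 : 4 * (5 * s ^ (1 - α)) ^ 2 * weylTotal (fun b => -((y : ℝ) + b) ^ β)
      (fun b => -((x : ℝ) + σ * (y + b)) ^ β) B L ≤
      100 * C * s ^ (2 - α - 2 * η) := by
    calc 4 * (5 * s ^ (1 - α)) ^ 2 * weylTotal (fun b => -((y : ℝ) + b) ^ β)
          (fun b => -((x : ℝ) + σ * (y + b)) ^ β) B L
        ≤ 4 * (5 * s ^ (1 - α)) ^ 2 * (C * s ^ (α - 2 * η)) := by gcongr
      _ = 100 * C * (s ^ (1 - α) * s ^ (1 - α) * s ^ (α - 2 * η)) := by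
        ring
      _ = 100 * C * s ^ (2 - α - 2 * η) := by
        rw [← Real.rpow_add hs0, ← Real.rpow_add hs0]; congr 2; ring
  linarith

/-! ### Densities on the integers and their correlations -/

/-- Bounded Lipschitz weights on `ℝ` supported in `[1/2, 2]`, with bound and Lipschitz constant
`M`. -/
structure IsWeight (g : ℝ → ℂ) (M : ℝ) : Prop where
  norm_le : ∀ t, ‖g t‖ ≤ M
  lipschitz : ∀ t u, ‖g t - g u‖ ≤ M * |t - u|
  support : ∀ t, g t ≠ 0 → 1 / 2 ≤ t ∧ t ≤ 2

lemma IsWeight.nonneg {g : ℝ → ℂ} {M : ℝ} (h : IsWeight g M) : 0 ≤ M :=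
  (norm_nonneg _).trans (h.norm_le 0)

open Classical in
/-- The push-forward of the weights `g (m / s) / s` under `m ↦ ⌊m ^ α⌋`, in a closed form that is
available since `m = ⌈y ^ (1 / α)⌉` whenever `y = ⌊m ^ α⌋`. -/
noncomputable def floorDensity (g : ℝ → ℂ) (α s : ℝ) (y : ℤ) : ℂ :=
  if 1 ≤ y ∧ IsFloorPower (1 / α) y then g ((⌈(y : ℝ) ^ (1 / α)⌉ : ℝ) / s) / s else 0

/-- The density with which `floorDensity` is distributed on average. -/
noncomputable def smoothDensity (g : ℝ → ℂ) (α s : ℝ) (y : ℤ) : ℂ :=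
  if 1 ≤ y then g ((y : ℝ) ^ (1 / α) / s) / s * ((1 / α * (y : ℝ) ^ (1 / α - 1) : ℝ) : ℂ) else 0

/-- The correlation (`σ = 1`) or self-convolution (`σ = -1`) of a function on `ℤ`. -/
noncomputable def selfCorr (f : ℤ → ℂ) (σ x : ℤ) : ℂ := ∑' y : ℤ, f y * f (x + σ * y)

lemma ceil_lt_of_isFloorPower {β : ℝ} {y : ℤ} (h : IsFloorPower β y) :
    (⌈(y : ℝ) ^ β⌉ : ℝ) < ((y : ℝ) + 1) ^ β := by
  have h1 : Int.fract (-(y : ℝ) ^ β) = (⌈(y : ℝ) ^ β⌉ : ℝ) - (y : ℝ) ^ β := by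
    rw [Int.fract, Int.floor_neg]; push_cast; ring
  rw [IsFloorPower, h1] at h
  linarith

lemma rpow_inv_rpow' {α y : ℝ} (hα : 0 < α) (hy : 0 ≤ y) : (y ^ (1 / α)) ^ α = y := by
  rw [← Real.rpow_mul hy, one_div_mul_cancel hα.ne', Real.rpow_one]

lemma two_rpow_le_four {α : ℝ} (hα' : α ≤ 2) : (2 : ℝ) ^ α ≤ 4 := by
  calc (2 : ℝ) ^ α ≤ 2 ^ (2 : ℝ) := Real.rpow_le_rpow_of_exponent_le (by norm_num) hα'
    _ = 4 := by norm_num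

lemma size_of_rpow_bounds {α s t : ℝ} (hα : 0 < α) (hα' : α ≤ 2) (hs : 0 < s)
    (h1 : 1 / 2 ≤ t / s) (h2 : t / s ≤ 2) : s ^ α / 4 ≤ t ^ α ∧ t ^ α ≤ 4 * s ^ α := by
  rw [le_div_iff₀ hs] at h1
  rw [div_le_iff₀ hs] at h2
  have h4 := two_rpow_le_four hα'
  have hsα : 0 < s ^ α := by positivity
  have h20 : (0 : ℝ) < 2 ^ α := by positivity
  constructor
  · calc s ^ α / 4 ≤ s ^ α / 2 ^ α := by gcongr
      _ = (1 / 2 * s) ^ α := by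
        rw [← Real.div_rpow hs.le (by norm_num)]; congr 1; ring
      _ ≤ t ^ α := Real.rpow_le_rpow (by positivity) h1 hα.le
  · calc t ^ α ≤ (2 * s) ^ α := Real.rpow_le_rpow (by linarith) h2 hα.le
      _ = 2 ^ α * s ^ α := Real.mul_rpow (by norm_num) hs.le
      _ ≤ 4 * s ^ α := by gcongr

section Densities

variable {g : ℝ → ℂ} {M α s : ℝ}

lemma floorDensity_support (hg : IsWeight g M) (hα : 1 < α) (hα' : α ≤ 2) (hs : 0 < s) {y : ℤ}
    (h : floorDensity g α s y ≠ 0) :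
    1 ≤ y ∧ s ^ α / 4 ≤ y + 1 ∧ (y : ℝ) ≤ 4 * s ^ α := by
  rw [floorDensity] at h
  split_ifs at h with hc
  · obtain ⟨hy, hfl⟩ := hc
    have hα0 : 0 < α := by linarith
    have hy0 : (0 : ℝ) ≤ y := by exact_mod_cast (by omega : (0 : ℤ) ≤ y)
    have hne : g ((⌈(y : ℝ) ^ (1 / α)⌉ : ℝ) / s) ≠ 0 := by
      intro h0; rw [h0, zero_div] at h; exact h rfl
    obtain ⟨h1, h2⟩ := hg.support _ hne
    obtain ⟨h3, h4⟩ := size_of_rpow_bounds hα0 hα' hs h1 h2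
    have h5 := Int.le_ceil ((y : ℝ) ^ (1 / α))
    have h6 := ceil_lt_of_isFloorPower hfl
    have h7 : (0 : ℝ) ≤ (y : ℝ) ^ (1 / α) := by positivity
    refine ⟨hy, h3.trans ?_, le_trans ?_ h4⟩
    · calc (⌈(y : ℝ) ^ (1 / α)⌉ : ℝ) ^ α ≤ (((y : ℝ) + 1) ^ (1 / α)) ^ α :=
            Real.rpow_le_rpow (h7.trans h5) h6.le hα0.le
        _ = y + 1 := rpow_inv_rpow' hα0 (by linarith)
    · calc (y : ℝ) = ((y : ℝ) ^ (1 / α)) ^ α := (rpow_inv_rpow' hα0 hy0).symm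
        _ ≤ (⌈(y : ℝ) ^ (1 / α)⌉ : ℝ) ^ α := Real.rpow_le_rpow h7 h5 hα0.le
  · exact absurd rfl h

lemma smoothDensity_support (hg : IsWeight g M) (hα : 1 < α) (hα' : α ≤ 2) (hs : 0 < s) {y : ℤ}
    (h : smoothDensity g α s y ≠ 0) :
    1 ≤ y ∧ s ^ α / 4 ≤ y ∧ (y : ℝ) ≤ 4 * s ^ α := by
  rw [smoothDensity] at h
  split_ifs at h with hc
  · have hα0 : 0 < α := by linarith
    have hy0 : (0 : ℝ) ≤ y := by exact_mod_cast (by omega : (0 : ℤ) ≤ y)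
    have hne : g ((y : ℝ) ^ (1 / α) / s) ≠ 0 := by
      intro h0; rw [h0, zero_div, zero_mul] at h; exact h rfl
    obtain ⟨h1, h2⟩ := hg.support _ hne
    obtain ⟨h3, h4⟩ := size_of_rpow_bounds hα0 hα' hs h1 h2
    rw [rpow_inv_rpow' hα0 hy0] at h3 h4
    exact ⟨hc, h3, h4⟩
  · exact absurd rfl h

lemma norm_floorDensity_le (hg : IsWeight g M) (hs : 0 < s) (y : ℤ) :
    ‖floorDensity g α s y‖ ≤ M / s := by
  have hM := hg.nonneg
  rw [floorDensity]
  split_ifs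
  · rw [norm_div, Complex.norm_real, Real.norm_of_nonneg hs.le]
    gcongr
    exact hg.norm_le _
  · rw [norm_zero]; positivity

lemma norm_smoothDensity_le (hg : IsWeight g M) (hα : 1 < α) (hs : 0 < s) (y : ℤ) :
    ‖smoothDensity g α s y‖ ≤ M / s := by
  have hM := hg.nonneg
  rw [smoothDensity]
  split_ifs with hy
  · have hα0 : 0 < α := by linarith
    have hy1 : (1 : ℝ) ≤ y := by exact_mod_cast hy
    have h1 : 1 / α < 1 := (div_lt_one hα0).2 hα
    have h2 : (y : ℝ) ^ (1 / α - 1) ≤ 1 :=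
      Real.rpow_le_one_of_one_le_of_nonpos hy1 (by linarith)
    have h3 : 0 ≤ (y : ℝ) ^ (1 / α - 1) := by positivity
    have h4 : 1 / α * (y : ℝ) ^ (1 / α - 1) ≤ 1 := by
      have : 0 < 1 / α := by positivity
      nlinarith
    rw [norm_mul, norm_div, Complex.norm_real, Complex.norm_real, Real.norm_of_nonneg hs.le,
      Real.norm_of_nonneg (by positivity)]
    calc ‖g ((y : ℝ) ^ (1 / α) / s)‖ / s * (1 / α * (y : ℝ) ^ (1 / α - 1)) ≤ M / s * 1 := by
          gcongr
          exact hg.norm_le _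
      _ = M / s := mul_one _
  · rw [norm_zero]; positivity

lemma eq_zero_of_notMem_Icc {f : ℤ → ℂ} {R : ℝ} (hf : ∀ y, f y ≠ 0 → 1 ≤ y ∧ (y : ℝ) ≤ R) {y : ℤ}
    (hy : y ∉ Finset.Icc 1 ⌊R⌋) : f y = 0 := by
  by_contra h
  obtain ⟨h1, h2⟩ := hf y h
  exact hy (Finset.mem_Icc.2 ⟨h1, Int.le_floor.2 h2⟩)

/-- The trivial bound, by the size of the support. -/
lemma norm_selfCorr_le {f : ℤ → ℂ} {R A : ℝ} (hR : 0 ≤ R) (hA : 0 ≤ A)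
    (hf : ∀ y, f y ≠ 0 → 1 ≤ y ∧ (y : ℝ) ≤ R) (hfA : ∀ y, ‖f y‖ ≤ A) (σ x : ℤ) :
    ‖selfCorr f σ x‖ ≤ R * A ^ 2 := by
  rw [selfCorr, tsum_eq_sum (s := Finset.Icc 1 ⌊R⌋) (fun y hy => by
    rw [eq_zero_of_notMem_Icc hf hy, zero_mul])]
  have h1 : ∀ y ∈ Finset.Icc 1 ⌊R⌋, ‖f y * f (x + σ * y)‖ ≤ A ^ 2 := by
    intro y _
    rw [norm_mul, sq]
    exact mul_le_mul (hfA _) (hfA _) (norm_nonneg _) hA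
  refine (norm_sum_le _ _).trans ((Finset.sum_le_card_nsmul _ _ _ h1).trans ?_)
  rw [nsmul_eq_mul]
  gcongr
  rw [Int.card_Icc, add_sub_cancel_right]
  have h2 : ((⌊R⌋.toNat : ℕ) : ℝ) = (⌊R⌋ : ℝ) := by
    exact_mod_cast congrArg (Int.cast : ℤ → ℝ) (Int.toNat_of_nonneg (Int.floor_nonneg.2 hR))
  rw [h2]
  exact Int.floor_le R

end Densities

lemma abs_rpow_sub_le_of_comparable {N β y z : ℝ} (hN : 0 < N) (hβ : 0 < β) (hβ' : β < 1)
    (hy : N / 6 ≤ y) (hz : N / 6 ≤ z) : |y ^ β - z ^ β| ≤ 6 * N ^ (β - 1) * |y - z| := by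
  have h := Convex.norm_image_sub_le_of_norm_hasDerivWithin_le (f := fun t : ℝ => t ^ β)
    (f' := fun t : ℝ => β * t ^ (β - 1)) (s := Set.Ici (N / 6))
    (C := 6 * N ^ (β - 1)) (x := z) (y := y) ?_ ?_ (convex_Ici _) hz hy
  · simpa [Real.norm_eq_abs] using h
  · intro t ht
    have ht' : N / 6 ≤ t := ht
    exact (Real.hasDerivAt_rpow_const (Or.inl (by linarith))).hasDerivWithinAt
  · intro t ht
    have ht' : N / 6 ≤ t := ht
    have h0 : 0 < t := by linarith
    have h1 := Real.rpow_le_rpow_of_nonpos (z := β - 1) (by linarith) ht' (by linarith)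
    have e : (6 : ℝ) ^ (β - 1) = (6 ^ (1 - β))⁻¹ := by
      rw [← Real.rpow_neg (by norm_num)]; congr 1; ring
    rw [Real.div_rpow hN.le (by norm_num), e, div_inv_eq_mul] at h1
    have h2 : (6 : ℝ) ^ (1 - β) ≤ 6 := by
      calc (6 : ℝ) ^ (1 - β) ≤ 6 ^ (1 : ℝ) :=
            Real.rpow_le_rpow_of_exponent_le (by norm_num) (by linarith)
        _ = 6 := by norm_num
    have h3 : 0 < t ^ (β - 1) := by positivity
    have h4 : 0 < N ^ (β - 1) := by positivity
    rw [Real.norm_eq_abs, abs_mul, abs_of_pos hβ, abs_of_pos h3]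
    nlinarith

/-- Sums of `floorDensity` products over a block are close to those of `smoothDensity`. -/
lemma norm_block_sum_sub_le {α δ : ℝ} (hα : 1 < α) (hα' : α < 1 + 1 / 1000) (hδ : 0 < δ)
    (hδ' : δ ≤ 1 / 1000) :
    ∃ K s₀ : ℝ, 0 < K ∧ 1 ≤ s₀ ∧ ∀ {g : ℝ → ℂ} {M : ℝ}, IsWeight g M → ∀ s, s₀ ≤ s →
      ∀ σ : ℤ, (σ = 1 ∨ σ = -1) → ∀ x y : ℤ,
      0 < x → s ^ (α - 1 + δ) ≤ x → s ^ α / 5 ≤ y → y ≤ 5 * s ^ α →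
      s ^ α / 5 ≤ ((x + σ * y : ℤ) : ℝ) → ((x + σ * y : ℤ) : ℝ) ≤ 5 * s ^ α →
      ‖∑ b ∈ Finset.range ⌊s ^ (α - δ / 4)⌋₊,
          floorDensity g α s (y + b) * floorDensity g α s (x + σ * (y + b)) -
        ⌊s ^ (α - δ / 4)⌋₊ * (smoothDensity g α s y * smoothDensity g α s (x + σ * y))‖ ≤
        K * M ^ 2 * s ^ (-α - 2 * (δ / 4)) := by
  classical
  obtain ⟨K, s₀, hK, hs₀, hcount⟩ := abs_card_block_sub_le hα hα' hδ hδ'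
  set η := δ / 4 with hη
  set β := 1 / α with hβdef
  have hη0 : 0 < η := by positivity
  have hα0 : 0 < α := by linarith
  have hαβ : α * β = 1 := by rw [hβdef]; field_simp
  have hβ' : β < 1 := by rw [hβdef, div_lt_one hα0]; exact hα
  have hβ2 : 1 / 2 ≤ β := by rw [hβdef]; apply one_div_le_one_div_of_le hα0; linarith
  have hβ : 0 < β := by linarith
  have ev1 : ∀ᶠ s : ℝ in Filter.atTop, s ^ (-η) ≤ 1 / 2160 :=
    (tendsto_rpow_neg_atTop hη0).eventually (ge_mem_nhds (by norm_num))
  obtain ⟨s₁, hs₁⟩ := Filter.eventually_atTop.1 ev1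
  refine ⟨14 * (25 + K) + K, max (max s₀ s₁) 60, by positivity,
    le_trans (by norm_num) (le_max_right _ _), ?_⟩
  intro g M hg s hs σ hσ x y hx0 hxs hy1 hy2 hz1 hz2
  have hM := hg.nonneg
  have h1 := hs₁ s (((le_max_right _ _).trans (le_max_left _ _)).trans hs)
  have hs60 : 60 ≤ s := (le_max_right _ _).trans hs
  have hs1 : 1 ≤ s := by linarith
  have hs0 : 0 < s := by linarith
  have hcard := hcount s (((le_max_left _ _).trans (le_max_left _ _)).trans hs) σ hσ x y hx0 hxs
    hy1 hy2 hz1 hz2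
  clear hcount hs₁ ev1
  have hpow : ∀ {a b : ℝ}, a ≤ b → s ^ a ≤ s ^ b := fun h =>
    Real.rpow_le_rpow_of_exponent_le hs1 h
  obtain ⟨N, hN⟩ : ∃ N : ℝ, N = s ^ α := ⟨_, rfl⟩
  rw [← hN] at hy1 hy2 hz1 hz2
  have hN0 : 0 < N := by rw [hN]; positivity
  have hNs : s ≤ N := by
    rw [hN]
    calc s = s ^ (1 : ℝ) := (Real.rpow_one s).symm
      _ ≤ s ^ α := hpow hα.le
  have hNβ1 : N ^ (β - 1) = s ^ (1 - α) := by
    rw [hN, ← Real.rpow_mul hs0.le]; congr 1; rw [mul_sub, hαβ, mul_one]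
  obtain ⟨B, hB⟩ : ∃ B : ℕ, B = ⌊s ^ (α - η)⌋₊ := ⟨_, rfl⟩
  rw [← hB] at hcard ⊢
  have hBle : (B : ℝ) ≤ s ^ (α - η) := by rw [hB]; exact Nat.floor_le (by positivity)
  have hBN : (B : ℝ) ≤ N / 2160 := by
    have hsη : s ^ (α - η) = N * s ^ (-η) := by
      rw [hN, ← Real.rpow_add hs0]; congr 1
    rw [hsη] at hBle
    have := mul_le_mul_of_nonneg_left h1 hN0.le
    linarith
  have hB0 : (0 : ℝ) ≤ B := Nat.cast_nonneg B
  obtain ⟨z, hz⟩ : ∃ z : ℤ, z = x + σ * y := ⟨_, rfl⟩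
  rw [← hz] at hz1 hz2 hcard ⊢
  have hσr : ((σ : ℝ) = 1 ∨ (σ : ℝ) = -1) := by
    rcases hσ with rfl | rfl <;> simp
  have hσ1 : |(σ : ℝ)| = 1 := by rcases hσr with h | h <;> rw [h] <;> simp
  have hzb : ∀ b : ℕ, x + σ * (y + b) = z + σ * b := by intro b; rw [hz]; ring
  -- The weight varies little over the block.
  have hwt : ∀ v w : ℤ, N / 5 ≤ (w : ℝ) → |(v : ℝ) - w| ≤ B →
      ‖g ((⌈(v : ℝ) ^ β⌉ : ℝ) / s) - g ((w : ℝ) ^ β / s)‖ ≤ 7 * M * s ^ (-η) := by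
    intro v w hw hvw
    have h2 := abs_le.1 hvw
    refine (hg.lipschitz _ _).trans ?_
    rw [← sub_div, abs_div, abs_of_pos hs0]
    have h3 := abs_rpow_sub_le_of_comparable (y := v) (z := w) hN0 hβ hβ' (by linarith)
      (by linarith)
    have h4 : |(⌈(v : ℝ) ^ β⌉ : ℝ) - (w : ℝ) ^ β| ≤ 1 + |(v : ℝ) ^ β - (w : ℝ) ^ β| := by
      have h5 := Int.le_ceil ((v : ℝ) ^ β)
      have h6 := Int.ceil_lt_add_one ((v : ℝ) ^ β)
      have e : (⌈(v : ℝ) ^ β⌉ : ℝ) - (w : ℝ) ^ β =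
          ((⌈(v : ℝ) ^ β⌉ : ℝ) - (v : ℝ) ^ β) + ((v : ℝ) ^ β - (w : ℝ) ^ β) := by ring
      rw [e]
      refine (abs_add_le _ _).trans ?_
      gcongr
      rw [abs_of_nonneg (by linarith)]
      linarith
    have h7 : 6 * N ^ (β - 1) * |(v : ℝ) - w| ≤ 6 * s ^ (1 - η) := by
      rw [hNβ1]
      calc 6 * s ^ (1 - α) * |(v : ℝ) - w| ≤ 6 * s ^ (1 - α) * s ^ (α - η) := by
            gcongr; exact hvw.trans hBle
        _ = 6 * s ^ (1 - η) := by
            rw [mul_assoc, ← Real.rpow_add hs0]; congr 2; ring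
    have h8 : 1 ≤ s ^ (1 - η) := Real.one_le_rpow hs1 (by linarith)
    have h9 : s ^ (-η) = s ^ (1 - η) / s := by
      rw [show -η = (1 - η) - 1 by ring, Real.rpow_sub_one hs0.ne']
    rw [h9]
    calc M * (|(⌈(v : ℝ) ^ β⌉ : ℝ) - (w : ℝ) ^ β| / s) ≤ M * (7 * s ^ (1 - η) / s) := by
          gcongr; linarith
      _ = 7 * M * (s ^ (1 - η) / s) := by ring
  have hy0 : 1 ≤ y := by
    have : (0 : ℝ) < y := by linarith
    exact_mod_cast this
  have hz0 : 1 ≤ z := by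
    have : (0 : ℝ) < z := by linarith
    exact_mod_cast this
  set S := (Finset.range B).filter (fun b : ℕ => IsFloorPower β (y + b) ∧
    IsFloorPower β (x + σ * (y + b))) with hS
  set g₁ := g ((y : ℝ) ^ β / s) with hg₁
  set g₂ := g ((z : ℝ) ^ β / s) with hg₂
  have hsum : ∑ b ∈ Finset.range B, floorDensity g α s (y + b) *
      floorDensity g α s (x + σ * (y + b)) =
      ∑ b ∈ S, g ((⌈((y + b : ℤ) : ℝ) ^ β⌉ : ℝ) / s) / s *
        (g ((⌈((z + σ * b : ℤ) : ℝ) ^ β⌉ : ℝ) / s) / s) := by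
    rw [hS, Finset.sum_filter]
    refine Finset.sum_congr rfl fun b hb => ?_
    rw [hzb]
    have hb' : (b : ℝ) ≤ B := by exact_mod_cast (Finset.mem_range.1 hb).le
    have h2 : 1 ≤ y + b := by omega
    have h3 : 1 ≤ z + σ * b := by
      have : (0 : ℝ) < ((z + σ * b : ℤ) : ℝ) := by
        push_cast
        have h4 : |(σ : ℝ) * b| ≤ B := by rw [abs_mul, hσ1, one_mul, Nat.abs_cast]; exact hb'
        linarith [(abs_le.1 h4).1]
      exact_mod_cast this
    rw [floorDensity, floorDensity, ← hβdef]
    by_cases ha : IsFloorPower β (y + b) <;> by_cases hc : IsFloorPower β (z + σ * b) <;>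
      simp [ha, hc, h2, h3]
  have hbig : ∀ b ∈ S, ‖g ((⌈((y + b : ℤ) : ℝ) ^ β⌉ : ℝ) / s) / s *
        (g ((⌈((z + σ * b : ℤ) : ℝ) ^ β⌉ : ℝ) / s) / s) - g₁ / s * (g₂ / s)‖ ≤
        14 * M ^ 2 * s ^ (-η) / s ^ 2 := by
    intro b hb
    have hb' : (b : ℝ) ≤ B := by
      exact_mod_cast (Finset.mem_range.1 (Finset.mem_filter.1 hb).1).le
    have h2 := hwt (y + b) y hy1 (by
      push_cast; rw [add_sub_cancel_left, Nat.abs_cast]; exact hb')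
    have h3 := hwt (z + σ * b) z hz1 (by
      push_cast; rw [add_sub_cancel_left, abs_mul, hσ1, one_mul, Nat.abs_cast]; exact hb')
    rw [← hg₁] at h2
    rw [← hg₂] at h3
    have hu := hg.norm_le ((⌈((z + σ * b : ℤ) : ℝ) ^ β⌉ : ℝ) / s)
    have hv := hg.norm_le ((y : ℝ) ^ β / s)
    rw [← hg₁] at hv
    generalize g ((⌈((y + b : ℤ) : ℝ) ^ β⌉ : ℝ) / s) = p at *
    generalize g ((⌈((z + σ * b : ℤ) : ℝ) ^ β⌉ : ℝ) / s) = q at *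
    have e : p / s * (q / s) - g₁ / s * (g₂ / s) =
        ((p - g₁) * q + g₁ * (q - g₂)) / ((s ^ 2 : ℝ) : ℂ) := by
      push_cast
      have : (s : ℂ) ≠ 0 := by exact_mod_cast hs0.ne'
      field_simp
      ring
    rw [e, norm_div, Complex.norm_real, Real.norm_of_nonneg (by positivity)]
    gcongr
    refine (norm_add_le _ _).trans ?_
    rw [norm_mul, norm_mul]
    have h4 := mul_le_mul h2 hu (norm_nonneg _) (by positivity)
    have h5 := mul_le_mul hv h3 (norm_nonneg _) hM
    linarith
  have hmain : smoothDensity g α s y * smoothDensity g α s z =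
      g₁ / s * (g₂ / s) * ((β * (y : ℝ) ^ (β - 1) * (β * (z : ℝ) ^ (β - 1)) : ℝ) : ℂ) := by
    rw [smoothDensity, smoothDensity, if_pos hy0, if_pos hz0, ← hβdef]
    push_cast
    ring
  obtain ⟨dy1, dy2⟩ := density_bounds hN0 hβ2 hβ' hy1 hy2
  obtain ⟨dz1, dz2⟩ := density_bounds hN0 hβ2 hβ' hz1 hz2
  rw [hNβ1] at dy1 dy2 dz1 dz2
  set ρ := β * (y : ℝ) ^ (β - 1) with hρ
  set ρ' := β * (z : ℝ) ^ (β - 1) with hρ'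
  have hρs : 0 < s ^ (1 - α) := by positivity
  have hScard : (S.card : ℝ) ≤ (25 + K) * s ^ (2 - α - η) := by
    have h2 := (abs_le.1 hcard).2
    have h3 : (B : ℝ) * (ρ * ρ') ≤ 25 * s ^ (2 - α - η) := by
      calc (B : ℝ) * (ρ * ρ') ≤ s ^ (α - η) * ((5 * s ^ (1 - α)) * (5 * s ^ (1 - α))) := by
            have : 0 ≤ ρ' := by linarith
            gcongr
        _ = 25 * (s ^ (α - η) * s ^ (1 - α) * s ^ (1 - α)) := by ring
        _ = 25 * s ^ (2 - α - η) := by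
            rw [← Real.rpow_add hs0, ← Real.rpow_add hs0]; congr 2; ring
    have h4 : s ^ (2 - α - 2 * η) ≤ s ^ (2 - α - η) := hpow (by linarith)
    have h5 := mul_le_mul_of_nonneg_left h4 hK.le
    linarith
  have hsq : s ^ 2 = s ^ (2 : ℝ) := by norm_cast
  have hA : ‖∑ b ∈ S, (g ((⌈((y + b : ℤ) : ℝ) ^ β⌉ : ℝ) / s) / s *
        (g ((⌈((z + σ * b : ℤ) : ℝ) ^ β⌉ : ℝ) / s) / s) - g₁ / s * (g₂ / s))‖ ≤
        14 * (25 + K) * M ^ 2 * s ^ (-α - 2 * η) := by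
    refine (norm_sum_le _ _).trans ((Finset.sum_le_card_nsmul _ _ _ hbig).trans ?_)
    rw [nsmul_eq_mul]
    calc (S.card : ℝ) * (14 * M ^ 2 * s ^ (-η) / s ^ 2)
        ≤ (25 + K) * s ^ (2 - α - η) * (14 * M ^ 2 * s ^ (-η) / s ^ 2) := by gcongr
      _ = 14 * (25 + K) * M ^ 2 * (s ^ (2 - α - η) * s ^ (-η) / s ^ 2) := by ring
      _ = 14 * (25 + K) * M ^ 2 * s ^ (-α - 2 * η) := by
        rw [hsq, ← Real.rpow_add hs0, ← Real.rpow_sub hs0]; congr 2; ring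
  have hBd : ‖g₁ / s * (g₂ / s) * (((S.card : ℝ) - B * (ρ * ρ') : ℝ) : ℂ)‖ ≤
      K * M ^ 2 * s ^ (-α - 2 * η) := by
    rw [norm_mul, norm_mul, norm_div, norm_div, Complex.norm_real, Complex.norm_real,
      Real.norm_of_nonneg hs0.le, Real.norm_eq_abs]
    calc ‖g₁‖ / s * (‖g₂‖ / s) * |(S.card : ℝ) - B * (ρ * ρ')|
        ≤ M / s * (M / s) * (K * s ^ (2 - α - 2 * η)) := by
          gcongr
          · exact hg.norm_le _
          · exact hg.norm_le _
      _ = K * M ^ 2 * (s ^ (2 - α - 2 * η) / s ^ 2) := by field_simp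
      _ = K * M ^ 2 * s ^ (-α - 2 * η) := by
        rw [hsq, ← Real.rpow_sub hs0]; congr 2; ring
  rw [hsum, hmain]
  have hfin : ∑ b ∈ S, g ((⌈((y + b : ℤ) : ℝ) ^ β⌉ : ℝ) / s) / s *
        (g ((⌈((z + σ * b : ℤ) : ℝ) ^ β⌉ : ℝ) / s) / s) -
        B * (g₁ / s * (g₂ / s) * ((ρ * ρ' : ℝ) : ℂ)) =
      ∑ b ∈ S, (g ((⌈((y + b : ℤ) : ℝ) ^ β⌉ : ℝ) / s) / s *
        (g ((⌈((z + σ * b : ℤ) : ℝ) ^ β⌉ : ℝ) / s) / s) - g₁ / s * (g₂ / s)) +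
      g₁ / s * (g₂ / s) * (((S.card : ℝ) - B * (ρ * ρ') : ℝ) : ℂ) := by
    rw [Finset.sum_sub_distrib, Finset.sum_const, nsmul_eq_mul]
    push_cast
    ring
  rw [hfin]
  refine (norm_add_le _ _).trans ((add_le_add hA hBd).trans (le_of_eq ?_))
  ring

/-! ### Correlations at large shifts -/

/-- Averaging a finitely supported function over blocks of length `B` does not change its sum. -/
lemma hasSum_block_sum (F : ℤ → ℂ) (hF : F.support.Finite) (B : ℕ) :
    HasSum (fun y : ℤ => ∑ b ∈ Finset.range B, F (y + b)) (B * ∑' y : ℤ, F y) := by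
  have h1 : ∀ b : ℕ, HasSum (fun y : ℤ => F (y + b)) (∑' y : ℤ, F y) := fun b =>
    (Equiv.addRight (b : ℤ)).hasSum_iff.2 (summable_of_hasFiniteSupport hF).hasSum
  have h2 := hasSum_sum (s := Finset.range B) fun b _ => h1 b
  rwa [Finset.sum_const, nsmul_eq_mul, Finset.card_range] at h2

lemma finite_support_mul_of_bound {f : ℤ → ℂ} {R : ℝ} (hf : ∀ y, f y ≠ 0 → 1 ≤ y ∧ (y : ℝ) ≤ R)
    (h : ℤ → ℂ) : (fun y => f y * h y).support.Finite := by
  refine (Finset.finite_toSet (Finset.Icc 1 ⌊R⌋)).subset fun y hy => ?_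
  by_contra hne
  exact hy (by simp [eq_zero_of_notMem_Icc hf hne])

/-- The self-correlations of the two densities agree up to a power of `s`, once the shift is
at least `s ^ (α - 1 + δ)`. -/
lemma norm_selfCorr_sub_le {α δ : ℝ} (hα : 1 < α) (hα' : α < 1 + 1 / 1000) (hδ : 0 < δ) :
    ∃ K ε : ℝ, 1 ≤ K ∧ 0 < ε ∧ ∀ {g : ℝ → ℂ} {M : ℝ}, IsWeight g M → ∀ s : ℝ, 1 ≤ s →
      ∀ σ : ℤ, (σ = 1 ∨ σ = -1) → ∀ x : ℤ, 0 < x → s ^ (α - 1 + δ) ≤ x →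
      ‖selfCorr (floorDensity g α s) σ x - selfCorr (smoothDensity g α s) σ x‖ ≤
        K * M ^ 2 * s ^ (-α - ε) := by
  set δ' := min δ (1 / 1000) with hδ'def
  have hδ'0 : 0 < δ' := lt_min hδ (by norm_num)
  obtain ⟨K, s₀, hK, hs₀, hblock⟩ := norm_block_sum_sub_le hα hα' hδ'0 (min_le_right _ _)
  set η := δ' / 4 with hη
  have hη0 : 0 < η := by positivity
  have hη1 : η ≤ 1 / 4000 := by
    have := min_le_right δ (1 / 1000)
    rw [hη]; linarith
  have hα0 : 0 < α := by linarith
  have hα2 : α ≤ 2 := by linarith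
  have ev1 : ∀ᶠ s : ℝ in Filter.atTop, s ^ (-η) ≤ 1 / 60 :=
    (tendsto_rpow_neg_atTop hη0).eventually (ge_mem_nhds (by norm_num))
  obtain ⟨s₂, hs₂⟩ := Filter.eventually_atTop.1 ev1
  obtain ⟨s₁, hs₁⟩ : ∃ s₁ : ℝ, s₁ = max (max s₀ s₂) 60 := ⟨_, rfl⟩
  have hs₁0 : 0 < s₁ := by rw [hs₁]; exact lt_of_lt_of_le (by norm_num) (le_max_right _ _)
  refine ⟨12 * K + 8 * s₁ ^ (α + η) * s₁ ^ α + 1, η, ?_, hη0, ?_⟩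
  · have : 0 < 12 * K + 8 * s₁ ^ (α + η) * s₁ ^ α := by positivity
    linarith
  intro g M hg s hs1 σ hσ x hx0 hxs
  have hM := hg.nonneg
  have hs0 : 0 < s := by linarith
  have hpow : ∀ {a b : ℝ}, a ≤ b → s ^ a ≤ s ^ b := fun h =>
    Real.rpow_le_rpow_of_exponent_le hs1 h
  have hxs' : s ^ (α - 1 + δ') ≤ x :=
    (hpow (by linarith [min_le_left δ (1 / 1000 : ℝ)])).trans hxs
  have hMs : 0 ≤ M ^ 2 * s ^ (-α - η) := by positivity
  have hfs : ∀ y, floorDensity g α s y ≠ 0 → 1 ≤ y ∧ (y : ℝ) ≤ 4 * s ^ α := fun y hy =>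
    ⟨(floorDensity_support hg hα hα2 hs0 hy).1, (floorDensity_support hg hα hα2 hs0 hy).2.2⟩
  have hss : ∀ y, smoothDensity g α s y ≠ 0 → 1 ≤ y ∧ (y : ℝ) ≤ 4 * s ^ α := fun y hy =>
    ⟨(smoothDensity_support hg hα hα2 hs0 hy).1, (smoothDensity_support hg hα hα2 hs0 hy).2.2⟩
  -- For bounded `s` the constant absorbs everything.
  rcases lt_or_ge s s₁ with hsmall | hlarge
  · have h1 := norm_selfCorr_le (by positivity) (by positivity) hfs
      (norm_floorDensity_le hg hs0) σ x
    have h2 := norm_selfCorr_le (by positivity) (by positivity) hss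
      (norm_smoothDensity_le hg hα hs0) σ x
    have h3 : M / s ≤ M := div_le_self hM hs1
    have h4 : s ^ α ≤ s₁ ^ α := Real.rpow_le_rpow hs0.le hsmall.le hα0.le
    have h5 : 1 ≤ s₁ ^ (α + η) * s ^ (-α - η) := by
      have h6 : s ^ (α + η) ≤ s₁ ^ (α + η) :=
        Real.rpow_le_rpow hs0.le hsmall.le (by positivity)
      have h7 : s ^ (α + η) * s ^ (-α - η) = 1 := by
        rw [← Real.rpow_add hs0, show α + η + (-α - η) = 0 by ring, Real.rpow_zero]
      rw [← h7]
      gcongr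
    refine (norm_sub_le _ _).trans ?_
    have h8 : 4 * s ^ α * (M / s) ^ 2 ≤ 4 * s₁ ^ α * M ^ 2 := by
      have : 0 ≤ M / s := by positivity
      gcongr
    have h9 : 8 * s₁ ^ α * M ^ 2 * 1 ≤ 8 * s₁ ^ α * M ^ 2 * (s₁ ^ (α + η) * s ^ (-α - η)) := by
      gcongr
    have h10 : 0 ≤ (12 * K + 1) * (M ^ 2 * s ^ (-α - η)) := by positivity
    linarith
  · rw [hs₁, max_le_iff, max_le_iff] at hlarge
    obtain ⟨⟨hl1, hl2⟩, hs60⟩ := hlarge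
    have hbl := hblock hg s hl1 σ hσ x
    have hη60 := hs₂ s hl2
    clear hblock
    obtain ⟨B, hB⟩ : ∃ B : ℕ, B = ⌊s ^ (α - η)⌋₊ := ⟨_, rfl⟩
    rw [← hB] at hbl
    obtain ⟨N, hN⟩ : ∃ N : ℝ, N = s ^ α := ⟨_, rfl⟩
    rw [← hN] at hbl hfs hss
    have hN0 : 0 < N := by rw [hN]; positivity
    have hNs : s ≤ N := by
      rw [hN]
      calc s = s ^ (1 : ℝ) := (Real.rpow_one s).symm
        _ ≤ s ^ α := hpow hα.le
    have hone : 1 ≤ s ^ (α - η) := Real.one_le_rpow hs1 (by linarith)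
    have hB1 : 1 ≤ B := by rw [hB]; exact (Nat.one_le_floor_iff _).2 hone
    have hB1' : (1 : ℝ) ≤ B := by exact_mod_cast hB1
    have hBge : s ^ (α - η) / 2 ≤ B := by
      have h4 := Nat.lt_floor_add_one (s ^ (α - η))
      rw [← hB] at h4
      linarith
    have hBN : (B : ℝ) ≤ N / 60 := by
      have h3 : (B : ℝ) ≤ s ^ (α - η) := by rw [hB]; exact Nat.floor_le (by positivity)
      have hsη : s ^ (α - η) = N * s ^ (-η) := by
        rw [hN, ← Real.rpow_add hs0]; congr 1
      rw [hsη] at h3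
      have := mul_le_mul_of_nonneg_left hη60 hN0.le
      linarith
    have hσ1 : |(σ : ℝ)| = 1 := by rcases hσ with rfl | rfl <;> simp
    set F : ℤ → ℂ := fun y => floorDensity g α s y * floorDensity g α s (x + σ * y) with hF
    set W : ℤ → ℂ := fun y => smoothDensity g α s y * smoothDensity g α s (x + σ * y) with hW
    have hsumF := hasSum_block_sum F (finite_support_mul_of_bound hfs _) B
    have hsW : Summable W := summable_of_hasFiniteSupport (finite_support_mul_of_bound hss _)
    have hsumW := hsW.hasSum.mul_left (B : ℂ)
    have hD := hsumF.sub hsumW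
    set D : ℤ → ℂ := fun y => ∑ b ∈ Finset.range B, F (y + b) - B * W y with hDdef
    -- Outside the range of the block estimate, nothing contributes.
    have hrange : ∀ y, D y ≠ 0 → (N / 5 ≤ y ∧ y ≤ 5 * N) ∧
        (N / 5 ≤ ((x + σ * y : ℤ) : ℝ) ∧ ((x + σ * y : ℤ) : ℝ) ≤ 5 * N) := by
      intro y hy
      by_cases hWy : W y = 0
      · have : ∃ b ∈ Finset.range B, F (y + b) ≠ 0 := by
          by_contra hne
          push Not at hne
          apply hy
          simp only [hDdef]
          rw [Finset.sum_eq_zero hne, hWy, mul_zero, sub_zero]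
        obtain ⟨b, hb, hFb⟩ := this
        have hb' : (b : ℝ) ≤ B := by exact_mod_cast (Finset.mem_range.1 hb).le
        have hb0 : (0 : ℝ) ≤ b := Nat.cast_nonneg b
        obtain ⟨_, h1, h2⟩ := floorDensity_support hg hα hα2 hs0 (left_ne_zero_of_mul hFb)
        obtain ⟨_, h3, h4⟩ := floorDensity_support hg hα hα2 hs0 (right_ne_zero_of_mul hFb)
        have h5 : |(σ : ℝ) * b| ≤ B := by rw [abs_mul, hσ1, one_mul, Nat.abs_cast]; exact hb'
        have h6 := abs_le.1 h5
        rw [← hN] at h1 h2 h3 h4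
        push_cast at h1 h2 h3 h4 ⊢
        refine ⟨⟨by linarith, by linarith⟩, by linarith [h6.2], by linarith [h6.1]⟩
      · obtain ⟨_, h1, h2⟩ := smoothDensity_support hg hα hα2 hs0 (left_ne_zero_of_mul hWy)
        obtain ⟨_, h3, h4⟩ := smoothDensity_support hg hα hα2 hs0 (right_ne_zero_of_mul hWy)
        rw [← hN] at h1 h2 h3 h4
        exact ⟨⟨by linarith, by linarith⟩, by linarith, by linarith⟩
    have hDle : ∀ y, ‖D y‖ ≤ K * M ^ 2 * s ^ (-α - 2 * η) := by
      intro y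
      by_cases hy : D y = 0
      · rw [hy, norm_zero]; positivity
      · obtain ⟨⟨h1, h2⟩, h3, h4⟩ := hrange y hy
        exact hbl y hx0 hxs' h1 h2 h3 h4
    have hDz : ∀ y ∉ Finset.Icc 1 ⌊5 * N⌋, D y = 0 := by
      intro y hy
      refine eq_zero_of_notMem_Icc (fun y hy => ?_) hy
      obtain ⟨⟨h1, h2⟩, -⟩ := hrange y hy
      have : (0 : ℝ) < y := by linarith
      exact ⟨by exact_mod_cast this, h2⟩
    have hDsum : ‖∑ y ∈ Finset.Icc 1 ⌊5 * N⌋, D y‖ ≤ 5 * N * (K * M ^ 2 * s ^ (-α - 2 * η)) := by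
      refine (norm_sum_le _ _).trans ((Finset.sum_le_card_nsmul _ _ _ fun y _ => hDle y).trans ?_)
      rw [nsmul_eq_mul]
      gcongr
      rw [Int.card_Icc, add_sub_cancel_right]
      have h2 : ((⌊5 * N⌋.toNat : ℕ) : ℝ) = (⌊5 * N⌋ : ℝ) := by
        exact_mod_cast congrArg (Int.cast : ℤ → ℝ)
          (Int.toNat_of_nonneg (Int.floor_nonneg.2 (by positivity)))
      rw [h2]
      exact Int.floor_le _
    rw [(hasSum_sum_of_ne_finset_zero hDz).unique hD, ← mul_sub, norm_mul, Complex.norm_natCast] at hDsum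
    have hfinal : ‖selfCorr (floorDensity g α s) σ x - selfCorr (smoothDensity g α s) σ x‖ ≤
        10 * K * (M ^ 2 * s ^ (-α - η)) := by
      have h1 : s ^ (α - η) / 2 *
          ‖selfCorr (floorDensity g α s) σ x - selfCorr (smoothDensity g α s) σ x‖ ≤
          5 * N * (K * M ^ 2 * s ^ (-α - 2 * η)) :=
        (mul_le_mul_of_nonneg_right hBge (norm_nonneg _)).trans hDsum
      have h2 : N * s ^ (-α - 2 * η) = s ^ (α - η) * s ^ (-α - η) := by
        rw [hN, ← Real.rpow_add hs0, ← Real.rpow_add hs0]; congr 1; ring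
      have h3 : 5 * N * (K * M ^ 2 * s ^ (-α - 2 * η)) =
          s ^ (α - η) / 2 * (10 * K * (M ^ 2 * s ^ (-α - η))) := by
        linear_combination 5 * K * M ^ 2 * h2
      rw [h3] at h1
      exact le_of_mul_le_mul_left h1 (by positivity)
    have h4 : 0 ≤ (2 * K + 8 * s₁ ^ (α + η) * s₁ ^ α + 1) * (M ^ 2 * s ^ (-α - η)) := by positivity
    linarith

/-! ### Roots of integers of the form `⌊m ^ α⌋` -/

/-- `y = ⌊m ^ α⌋` determines `m` as `⌈y ^ (1 / α)⌉`. -/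
lemma floor_rpow_eq_iff {α : ℝ} (hα : 1 < α) {m y : ℤ} (hm : 1 ≤ m) :
    ⌊(m : ℝ) ^ α⌋ = y ↔ (1 ≤ y ∧ IsFloorPower (1 / α) y) ∧ ⌈(y : ℝ) ^ (1 / α)⌉ = m := by
  have hα0 : 0 < α := by linarith
  have hm1 : (1 : ℝ) ≤ m := by exact_mod_cast hm
  have hm0 : (0 : ℝ) ≤ m := by linarith
  have hinv : ((m : ℝ) ^ α) ^ (1 / α) = m := by
    rw [← Real.rpow_mul hm0, mul_one_div_cancel hα0.ne', Real.rpow_one]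
  have hβ0 : 0 < 1 / α := by positivity
  have hfract : ∀ t : ℝ, Int.fract (-t) = (⌈t⌉ : ℝ) - t := by
    intro t; rw [Int.fract, Int.floor_neg]; push_cast; ring
  constructor
  · intro h
    rw [Int.floor_eq_iff] at h
    have h1 : (1 : ℝ) ≤ (m : ℝ) ^ α := Real.one_le_rpow hm1 hα0.le
    have hy : 1 ≤ y := by
      have : (0 : ℝ) < y := by linarith [h.2]
      exact_mod_cast this
    have hy0 : (0 : ℝ) ≤ y := by exact_mod_cast (by omega : (0 : ℤ) ≤ y)
    have h2 : (y : ℝ) ^ (1 / α) ≤ m := by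
      rw [← hinv]; exact Real.rpow_le_rpow hy0 h.1 hβ0.le
    have h3 : (m : ℝ) < ((y : ℝ) + 1) ^ (1 / α) := by
      rw [← hinv]; exact Real.rpow_lt_rpow (by positivity) h.2 hβ0
    have h4 : ((y : ℝ) + 1) ^ (1 / α) ≤ (y : ℝ) ^ (1 / α) + 1 := by
      have := Real.rpow_add_le_add_rpow hy0 zero_le_one hβ0.le ((div_le_one hα0).2 hα.le)
      rwa [Real.one_rpow] at this
    have h5 : ⌈(y : ℝ) ^ (1 / α)⌉ = m := by
      rw [Int.ceil_eq_iff]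
      exact ⟨by linarith, h2⟩
    refine ⟨⟨hy, ?_⟩, h5⟩
    rw [IsFloorPower, hfract, h5]
    linarith
  · rintro ⟨⟨hy, hfl⟩, hc⟩
    have hy0 : (0 : ℝ) ≤ y := by exact_mod_cast (by omega : (0 : ℤ) ≤ y)
    have h1 := ceil_lt_of_isFloorPower hfl
    have h2 := Int.le_ceil ((y : ℝ) ^ (1 / α))
    rw [hc] at h1 h2
    rw [Int.floor_eq_iff]
    constructor
    · rw [← rpow_inv_rpow' hα0 hy0]
      exact Real.rpow_le_rpow (by positivity) h2 hα0.le
    · rw [← rpow_inv_rpow' hα0 (show (0 : ℝ) ≤ y + 1 by linarith)]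
      exact Real.rpow_lt_rpow hm0 h1 hα0

lemma floorDensity_ne_zero {g : ℝ → ℂ} {M α s : ℝ} (hg : IsWeight g M) (hα : 1 < α) (hs : 0 < s)
    {y : ℤ} (h : floorDensity g α s y ≠ 0) :
    ∃ m : ℕ, 1 ≤ m ∧ ⌊(m : ℝ) ^ α⌋ = y ∧ ⌈(y : ℝ) ^ (1 / α)⌉ = m ∧ s / 2 ≤ m ∧ (m : ℝ) ≤ 2 * s := by
  rw [floorDensity] at h
  split_ifs at h with hc
  · have hne : g ((⌈(y : ℝ) ^ (1 / α)⌉ : ℝ) / s) ≠ 0 := by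
      intro h0; rw [h0, zero_div] at h; exact h rfl
    obtain ⟨h1, h2⟩ := hg.support _ hne
    rw [le_div_iff₀ hs] at h1
    rw [div_le_iff₀ hs] at h2
    have hy : (1 : ℝ) ≤ y := by exact_mod_cast hc.1
    have hpos : 1 ≤ ⌈(y : ℝ) ^ (1 / α)⌉ := by
      have : 0 < (y : ℝ) ^ (1 / α) := by positivity
      exact Int.one_le_ceil_iff.2 this
    obtain ⟨m, hm⟩ := Int.eq_ofNat_of_zero_le (show 0 ≤ ⌈(y : ℝ) ^ (1 / α)⌉ by omega)
    rw [hm] at h1 h2 hpos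
    have h3 := (floor_rpow_eq_iff hα (y := y) hpos).2 ⟨hc, hm⟩
    refine ⟨m, by exact_mod_cast hpos, by simpa using h3, hm, ?_, ?_⟩
    · have : ((m : ℤ) : ℝ) = m := by simp
      linarith
    · have : ((m : ℤ) : ℝ) = m := by simp
      linarith
  · exact absurd rfl h

/-! ### Correlations at small shifts -/

lemma exists_rpow_difference_eq {α : ℝ} (hα : 1 < α) {t h : ℝ} (hh : 0 < h) :
    ∃ ξ ∈ Set.Ioo t (t + h), (t + h) ^ α - t ^ α = α * ξ ^ (α - 1) * h := by
  obtain ⟨ξ, hξ, he⟩ := exists_hasDerivAt_eq_slope (fun t : ℝ => t ^ α)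
    (fun t : ℝ => α * t ^ (α - 1)) (show t < t + h by linarith)
    (fun y _ => (Real.hasDerivAt_rpow_const (x := y) (p := α)
      (Or.inr hα.le)).continuousAt.continuousWithinAt)
    (fun y _ => Real.hasDerivAt_rpow_const (Or.inr hα.le))
  rw [add_sub_cancel_left, eq_div_iff hh.ne'] at he
  exact ⟨ξ, hξ, he.symm⟩

/-- Spacing of the values `(t + h) ^ α - t ^ α` in `t`. -/
lemma le_rpow_second_difference {α : ℝ} (hα : 1 < α) (hα' : α ≤ 2) {t h A : ℝ} (ht : 0 ≤ t)
    (hh : 0 < h) (hA : t + 1 + h ≤ A) :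
    (α - 1) * h * A ^ (α - 2) ≤ ((t + 1 + h) ^ α - (t + 1) ^ α) - ((t + h) ^ α - t ^ α) := by
  have hd : ∀ y : ℝ, HasDerivAt (fun y : ℝ => (y + h) ^ α - y ^ α)
      (α * (y + h) ^ (α - 1) - α * y ^ (α - 1)) y := by
    intro y
    have h1 := (Real.hasDerivAt_rpow_const (x := y + h) (p := α) (Or.inr hα.le)).comp_add_const y h
    exact h1.sub (Real.hasDerivAt_rpow_const (Or.inr hα.le))
  obtain ⟨ξ, hξ, he⟩ := exists_hasDerivAt_eq_slope _ _ (show t < t + 1 by linarith)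
    (fun y _ => (hd y).continuousAt.continuousWithinAt) (fun y _ => hd y)
  have hξ0 : 0 < ξ := by linarith [hξ.1]
  have hd2 : ∀ y ∈ Set.Icc ξ (ξ + h), HasDerivAt (fun y : ℝ => y ^ (α - 1))
      ((α - 1) * y ^ (α - 2)) y := by
    intro y hy
    have := Real.hasDerivAt_rpow_const (x := y) (p := α - 1) (Or.inl (by linarith [hy.1]))
    rwa [show α - 1 - 1 = α - 2 by ring] at this
  obtain ⟨ζ, hζ, he'⟩ := exists_hasDerivAt_eq_slope _ _ (show ξ < ξ + h by linarith)
    (fun y hy => (hd2 y hy).continuousAt.continuousWithinAt)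
    (fun y hy => hd2 y ⟨hy.1.le, hy.2.le⟩)
  rw [add_sub_cancel_left, div_one] at he
  rw [add_sub_cancel_left, eq_div_iff hh.ne'] at he'
  have h1 : A ^ (α - 2) ≤ ζ ^ (α - 2) :=
    Real.rpow_le_rpow_of_nonpos (by linarith [hζ.1]) (by linarith [hζ.2, hξ.2]) (by linarith)
  rw [← he, ← mul_sub, ← he']
  have hα1 : 0 < α - 1 := by linarith
  have hζ0 : 0 < ζ := by linarith [hζ.1]
  calc (α - 1) * h * A ^ (α - 2) ≤ (α - 1) * h * ζ ^ (α - 2) := by gcongr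
    _ = 1 * ((α - 1) * ζ ^ (α - 2) * h) := by ring
    _ ≤ α * ((α - 1) * ζ ^ (α - 2) * h) := by gcongr

/-- An elementary bound for shifts at most `s`: for a fixed difference `h = m - n` the values
`(n + h) ^ α - n ^ α` are well spaced in `n`, and only `O (x * s ^ (1 - α))` values of `h` are
possible. -/
lemma norm_selfCorr_le_of_le {α : ℝ} (hα : 1 < α) (hα' : α ≤ 2) :
    ∃ K : ℝ, 0 < K ∧ ∀ {g : ℝ → ℂ} {M : ℝ}, IsWeight g M → ∀ s : ℝ, 1 ≤ s → ∀ x : ℤ, 0 < x →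
      (x : ℝ) ≤ s → ‖selfCorr (floorDensity g α s) 1 x‖ ≤ K * M ^ 2 * s ^ (-α) := by
  classical
  have hα0 : 0 < α := by linarith
  have hα1 : 0 < α - 1 := by linarith
  refine ⟨1024 / (α - 1) + 4, by positivity, ?_⟩
  intro g M hg s hs1 x hx0 hxs
  have hM := hg.nonneg
  have hs0 : 0 < s := by linarith
  have hx1 : (1 : ℝ) ≤ x := by exact_mod_cast hx0
  have hfs : ∀ y, floorDensity g α s y ≠ 0 → 1 ≤ y ∧ (y : ℝ) ≤ 4 * s ^ α := fun y hy =>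
    ⟨(floorDensity_support hg hα hα' hs0 hy).1, (floorDensity_support hg hα hα' hs0 hy).2.2⟩
  set S := (Finset.Icc 1 ⌊4 * s ^ α⌋).filter (fun y => floorDensity g α s y ≠ 0 ∧
    floorDensity g α s (x + 1 * y) ≠ 0) with hS
  have hsum : ‖selfCorr (floorDensity g α s) 1 x‖ ≤ S.card * (M / s) ^ 2 := by
    rw [selfCorr, tsum_eq_sum (s := S) (fun y hy => by
      by_contra hne
      have h1 := left_ne_zero_of_mul hne
      have h2 := right_ne_zero_of_mul hne
      apply hy
      rw [hS, Finset.mem_filter]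
      refine ⟨?_, h1, h2⟩
      by_contra h3
      exact h1 (eq_zero_of_notMem_Icc hfs h3))]
    have h1 : ∀ y ∈ S, ‖floorDensity g α s y * floorDensity g α s (x + 1 * y)‖ ≤ (M / s) ^ 2 := by
      intro y _
      rw [norm_mul, sq]
      exact mul_le_mul (norm_floorDensity_le hg hs0 _) (norm_floorDensity_le hg hs0 _)
        (norm_nonneg _) (by positivity)
    refine (norm_sum_le _ _).trans ((Finset.sum_le_card_nsmul _ _ _ h1).trans ?_)
    rw [nsmul_eq_mul]
  set H := 2 * ((x : ℝ) + 1) * s ^ (1 - α) with hH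
  have hH0 : 0 ≤ H := by positivity
  -- The roots `n` and `n + h` of an element of `S`, with the resulting bounds on `h`.
  have hroots : ∀ y ∈ S, ∃ n h : ℕ, 1 ≤ h ∧ ⌊(n : ℝ) ^ α⌋ = y ∧ ⌈(y : ℝ) ^ (1 / α)⌉ = n ∧
      ⌈((x + 1 * y : ℤ) : ℝ) ^ (1 / α)⌉ = n + h ∧ ((n : ℝ) + h) ≤ 2 * s ∧
      (x : ℝ) - 1 ≤ ((n : ℝ) + h) ^ α - (n : ℝ) ^ α ∧ ((n : ℝ) + h) ^ α - (n : ℝ) ^ α < x + 1 ∧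
      (h : ℝ) ≤ H ∧ (x : ℝ) + 1 ≤ 16 * h * s ^ (α - 1) := by
    intro y hy
    rw [hS, Finset.mem_filter] at hy
    obtain ⟨n, hn1, hn2, hn3, hn4, hn5⟩ := floorDensity_ne_zero hg hα hs0 hy.2.1
    obtain ⟨m, hm1, hm2, hm3, hm4, hm5⟩ := floorDensity_ne_zero hg hα hs0 hy.2.2
    have hn2' := Int.floor_eq_iff.1 hn2
    have hm2' := Int.floor_eq_iff.1 hm2
    push_cast at hm2'
    have hn0 : (0 : ℝ) ≤ n := Nat.cast_nonneg n
    have hnm : n < m := by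
      by_contra hle
      push Not at hle
      have : (m : ℝ) ^ α ≤ (n : ℝ) ^ α :=
        Real.rpow_le_rpow (Nat.cast_nonneg m) (by exact_mod_cast hle) hα0.le
      linarith
    obtain ⟨h, rfl⟩ := Nat.exists_eq_add_of_lt hnm
    have hh0 : (0 : ℝ) < ((h + 1 : ℕ) : ℝ) := by positivity
    have ecast : ((n + h + 1 : ℕ) : ℝ) = (n : ℝ) + ((h + 1 : ℕ) : ℝ) := by push_cast; ring
    rw [ecast] at hm2' hm4 hm5
    obtain ⟨ξ, hξ, he⟩ := exists_rpow_difference_eq hα hh0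
    have hn1' : (1 : ℝ) ≤ n := by exact_mod_cast hn1
    have hξ1 : 1 ≤ ξ := by linarith [hξ.1]
    set d := ((h + 1 : ℕ) : ℝ) with hd
    have hd1 : 1 ≤ d := by rw [hd]; push_cast; linarith [(Nat.cast_nonneg h : (0 : ℝ) ≤ h)]
    have hsα : 0 < s ^ (α - 1) := by positivity
    have b1 : s ^ (α - 1) / 2 ≤ ξ ^ (α - 1) := by
      calc s ^ (α - 1) / 2 ≤ s ^ (α - 1) / 2 ^ (α - 1) := by
            gcongr
            calc (2 : ℝ) ^ (α - 1) ≤ 2 ^ (1 : ℝ) :=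
                  Real.rpow_le_rpow_of_exponent_le (by norm_num) (by linarith)
              _ = 2 := by norm_num
        _ = (s / 2) ^ (α - 1) := (Real.div_rpow hs0.le (by norm_num) _).symm
        _ ≤ ξ ^ (α - 1) := Real.rpow_le_rpow (by positivity) (by linarith [hξ.1]) hα1.le
    have b2 : ξ ^ (α - 1) ≤ 2 * s ^ (α - 1) := by
      calc ξ ^ (α - 1) ≤ (2 * s) ^ (α - 1) :=
            Real.rpow_le_rpow (by linarith) (by linarith [hξ.2]) hα1.le
        _ = 2 ^ (α - 1) * s ^ (α - 1) := Real.mul_rpow (by norm_num) hs0.le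
        _ ≤ 2 * s ^ (α - 1) := by
            gcongr
            calc (2 : ℝ) ^ (α - 1) ≤ 2 ^ (1 : ℝ) :=
                  Real.rpow_le_rpow_of_exponent_le (by norm_num) (by linarith)
              _ = 2 := by norm_num
    have b3 : 1 ≤ ξ ^ (α - 1) := Real.one_le_rpow hξ1 hα1.le
    have c1 : d * (s ^ (α - 1) / 2) ≤ ((n : ℝ) + d) ^ α - (n : ℝ) ^ α := by
      rw [he]
      have : d * (s ^ (α - 1) / 2) ≤ d * ξ ^ (α - 1) := by gcongr
      have h2 : 0 < d * ξ ^ (α - 1) := by positivity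
      nlinarith
    have c2 : ((n : ℝ) + d) ^ α - (n : ℝ) ^ α ≤ 4 * d * s ^ (α - 1) := by
      rw [he]
      calc α * ξ ^ (α - 1) * d ≤ 2 * (2 * s ^ (α - 1)) * d := by gcongr
        _ = 4 * d * s ^ (α - 1) := by ring
    have c3 : 1 ≤ ((n : ℝ) + d) ^ α - (n : ℝ) ^ α := by
      rw [he]
      have h2 : 1 ≤ ξ ^ (α - 1) * d := one_le_mul_of_one_le_of_one_le b3 hd1
      nlinarith
    refine ⟨n, h + 1, by omega, hn2, hn3, by rw [hm3]; push_cast; ring, hm5, by linarith,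
      by linarith, ?_, ?_⟩
    · have h2 : d * (s ^ (α - 1) / 2) ≤ x + 1 := by linarith
      have h3 : s ^ (1 - α) * s ^ (α - 1) = 1 := by
        rw [← Real.rpow_add hs0, show 1 - α + (α - 1) = 0 by ring, Real.rpow_zero]
      have h4 : 0 < s ^ (1 - α) := by positivity
      have h5 := mul_le_mul_of_nonneg_left h2 h4.le
      have h6 : s ^ (1 - α) * (d * (s ^ (α - 1) / 2)) = d / 2 := by
        linear_combination d / 2 * h3
      rw [h6] at h5
      rw [hH]
      linarith
    · rw [show 16 * d * s ^ (α - 1) = 4 * (4 * d * s ^ (α - 1)) by ring]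
      by_cases h2 : (x : ℝ) ≤ 2
      · linarith
      · linarith
  -- The spacing of the values `(i + h) ^ α - i ^ α`, with `h` at least of order `x * s ^ (1 - α)`.
  set lam := (α - 1) * (x + 1) / (256 * s) with hlam
  have hlam0 : 0 < lam := by positivity
  set f : ℤ → ℕ := fun y =>
    (⌈((x + 1 * y : ℤ) : ℝ) ^ (1 / α)⌉ - ⌈(y : ℝ) ^ (1 / α)⌉).toNat with hf
  have hmaps : ∀ y ∈ S, f y ∈ Finset.Icc 1 ⌊H⌋₊ := by
    intro y hy
    obtain ⟨n, h, h1, h2, h3, h4, h5, h6, h7, h8, h9⟩ := hroots y hy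
    have : f y = h := by simp only [hf]; rw [h3, h4]; simp
    rw [this, Finset.mem_Icc]
    exact ⟨h1, Nat.le_floor h8⟩
  have hfiber : ∀ h ∈ Finset.Icc 1 ⌊H⌋₊, ((S.filter (fun y => f y = h)).card : ℝ) ≤
      2 / lam + 1 := by
    intro h _
    rcases (S.filter (fun y => f y = h)).eq_empty_or_nonempty with hemp | ⟨y₀, hy₀⟩
    · rw [hemp]; simp; positivity
    · rw [Finset.mem_filter] at hy₀
      obtain ⟨n₀, h', h1, h2, h3, h4, h5, h6, h7, h8, h9⟩ := hroots y₀ hy₀.1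
      have e : f y₀ = h' := by simp only [hf]; rw [h3, h4]; simp
      have e' : h' = h := by rw [← e]; exact hy₀.2
      subst e'
      have hh0 : (0 : ℝ) < h' := by exact_mod_cast h1
      have hn₀ : (0 : ℝ) ≤ n₀ := Nat.cast_nonneg n₀
      have hinc : ∀ i, i + 1 < ⌊2 * s⌋₊ + 1 → lam ≤
          (fun i : ℕ => ((i : ℝ) + h') ^ α - (i : ℝ) ^ α) (i + 1) -
          (fun i : ℕ => ((i : ℝ) + h') ^ α - (i : ℝ) ^ α) i := by
        intro i hi
        have hi' : ((i + 1 : ℕ) : ℝ) ≤ 2 * s :=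
          (Nat.le_floor_iff (by positivity)).1 (by omega)
        push_cast at hi' ⊢
        refine le_trans ?_ (le_rpow_second_difference hα hα' (Nat.cast_nonneg i) hh0
          (A := 4 * s) (by linarith))
        have h10 : s ^ (α - 2) / 16 ≤ (4 * s) ^ (α - 2) := by
          rw [Real.mul_rpow (by norm_num) hs0.le]
          have : (1 : ℝ) / 16 ≤ 4 ^ (α - 2) := by
            calc (1 : ℝ) / 16 = 4 ^ (-2 : ℝ) := by
                  rw [Real.rpow_neg (by norm_num)]; norm_num
              _ ≤ 4 ^ (α - 2) := Real.rpow_le_rpow_of_exponent_le (by norm_num) (by linarith)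
          have h11 : 0 < s ^ (α - 2) := by positivity
          nlinarith
        have h12 : s ^ (α - 1) = s ^ (α - 2) * s := by
          rw [← Real.rpow_add_one hs0.ne']; congr 1; ring
        calc lam = (α - 1) * ((x : ℝ) + 1) / (256 * s) := rfl
          _ ≤ (α - 1) * (16 * h' * s ^ (α - 1)) / (256 * s) := by gcongr
          _ = (α - 1) * h' * (s ^ (α - 2) / 16) := by rw [h12]; field_simp; norm_num
          _ ≤ (α - 1) * h' * (4 * s) ^ (α - 2) := by gcongr
      have hwin := card_filter_window_le (fun i : ℕ => ((i : ℝ) + h') ^ α - (i : ℝ) ^ α)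
        (⌊2 * s⌋₊ + 1) hlam0 hinc (a := (x : ℝ) - 1) (b := (x : ℝ) + 1) (by linarith)
      rw [show (x : ℝ) + 1 - (x - 1) = 2 by ring] at hwin
      refine le_trans ?_ hwin
      have hcard : (S.filter (fun y => f y = h')).card ≤ ((Finset.range (⌊2 * s⌋₊ + 1)).filter
          (fun i => (x : ℝ) - 1 ≤ (fun i : ℕ => ((i : ℝ) + h') ^ α - (i : ℝ) ^ α) i ∧
            (fun i : ℕ => ((i : ℝ) + h') ^ α - (i : ℝ) ^ α) i < (x : ℝ) + 1)).card := by
        refine Finset.card_le_card_of_injOn (fun y => ⌈(y : ℝ) ^ (1 / α)⌉.toNat) ?_ ?_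
        · intro y hy
          rw [Finset.mem_coe, Finset.mem_filter] at hy
          obtain ⟨n, k, k1, k2, k3, k4, k5, k6, k7, k8, k9⟩ := hroots y hy.1
          have ek : f y = k := by simp only [hf]; rw [k3, k4]; simp
          have ek' : k = h' := by rw [← ek]; exact hy.2
          subst ek'
          have e3 : ⌈(y : ℝ) ^ (1 / α)⌉.toNat = n := by rw [k3]; simp
          simp only [e3]
          rw [Finset.mem_coe, Finset.mem_filter, Finset.mem_range]
          refine ⟨?_, k6, k7⟩
          have : n ≤ ⌊2 * s⌋₊ := Nat.le_floor (by
            have : (0 : ℝ) ≤ k := Nat.cast_nonneg k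
            linarith)
          omega
        · intro y hy y' hy' heq
          rw [Finset.mem_coe, Finset.mem_filter] at hy hy'
          obtain ⟨n, k, k1, k2, k3, -⟩ := hroots y hy.1
          obtain ⟨n', k', k1', k2', k3', -⟩ := hroots y' hy'.1
          simp only [k3, k3', Int.toNat_natCast] at heq
          rw [← k2, ← k2', heq]
      exact_mod_cast hcard
  have hScard : (S.card : ℝ) ≤ (1024 / (α - 1) + 4) * s ^ (2 - α) := by
    rw [Finset.card_eq_sum_card_fiberwise hmaps]
    push_cast
    refine (Finset.sum_le_card_nsmul _ _ _ hfiber).trans ?_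
    rw [nsmul_eq_mul, Nat.card_Icc, Nat.add_sub_cancel]
    have h1 : s ^ (2 - α) = s ^ (1 - α) * s := by
      rw [← Real.rpow_add_one hs0.ne']; congr 1; ring
    calc (⌊H⌋₊ : ℝ) * (2 / lam + 1) ≤ H * (2 / lam + 1) := by
          gcongr; exact Nat.floor_le hH0
      _ = 1024 / (α - 1) * s ^ (2 - α) + 2 * ((x : ℝ) + 1) * s ^ (1 - α) := by
          rw [hH, hlam, h1]
          field_simp
          ring
      _ ≤ 1024 / (α - 1) * s ^ (2 - α) + 2 * (2 * s) * s ^ (1 - α) := by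
          gcongr; linarith
      _ = (1024 / (α - 1) + 4) * s ^ (2 - α) := by rw [h1]; ring
  refine hsum.trans ?_
  have hsq : s ^ 2 = s ^ (2 : ℝ) := by norm_cast
  calc (S.card : ℝ) * (M / s) ^ 2 ≤ (1024 / (α - 1) + 4) * s ^ (2 - α) * (M / s) ^ 2 := by gcongr
    _ = (1024 / (α - 1) + 4) * M ^ 2 * (s ^ (2 - α) / s ^ 2) := by rw [div_pow]; ring
    _ = (1024 / (α - 1) + 4) * M ^ 2 * s ^ (-α) := by
      rw [hsq, ← Real.rpow_sub hs0]; congr 2; ring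

/-! ### Self-convolutions of odd functions -/

/-- The odd function on `ℤ` that agrees with `f` on the positive integers, for `f` supported
there. -/
def oddExtension (f : ℤ → ℂ) (x : ℤ) : ℂ := f x - f (-x)

lemma oddExtension_neg (f : ℤ → ℂ) (x : ℤ) : oddExtension f (-x) = -oddExtension f x := by
  simp [oddExtension]

lemma intConv_oddExtension_neg (f : ℤ → ℂ) (x : ℤ) :
    intConv (oddExtension f) (oddExtension f) (-x) =
      intConv (oddExtension f) (oddExtension f) x := by
  rw [intConv, intConv, ← (Equiv.neg ℤ).tsum_eq]
  refine tsum_congr fun y => ?_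
  rw [Equiv.neg_apply, show -x - -y = -(x - y) by ring, oddExtension_neg, oddExtension_neg,
    neg_mul_neg]

/-- Expanding the product gives four sums, which shifts and reflections bring to this form. -/
lemma intConv_oddExtension {f : ℤ → ℂ} {R : ℝ} (hf : ∀ y, f y ≠ 0 → 1 ≤ y ∧ (y : ℝ) ≤ R) (x : ℤ) :
    intConv (oddExtension f) (oddExtension f) x =
      selfCorr f (-1) x + selfCorr f (-1) (-x) - 2 * selfCorr f 1 x := by
  have hs : ∀ G : ℤ → ℂ, Summable fun y => f y * G y := fun G =>
    summable_of_hasFiniteSupport (finite_support_mul_of_bound hf G)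
  have h1 : HasSum (fun y => f y * f (x + -1 * y)) (selfCorr f (-1) x) :=
    (hs fun y => f (x + -1 * y)).hasSum
  have h2 : HasSum (fun y => f y * f (x + 1 * y)) (selfCorr f 1 x) :=
    (hs fun y => f (x + 1 * y)).hasSum
  have h3 : HasSum (fun y => f y * f (-x + -1 * y)) (selfCorr f (-1) (-x)) :=
    (hs fun y => f (-x + -1 * y)).hasSum
  have h2' := (Equiv.neg ℤ).hasSum_iff.2 h2
  have h2'' := (Equiv.subRight x).hasSum_iff.2 h2
  have h3' := (Equiv.neg ℤ).hasSum_iff.2 h3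
  have h4 := ((h1.add h3').sub h2').sub h2''
  rw [intConv]
  refine (tsum_congr fun y => ?_).trans (h4.tsum_eq.trans (by ring))
  simp only [oddExtension, Function.comp_apply, Equiv.neg_apply, Equiv.subRight_apply]
  rw [show x + -1 * y = x - y by ring, show -x + -1 * -y = -(x - y) by ring,
    show x + 1 * -y = x - y by ring, show x + 1 * (y - x) = y by ring,
    show y - x = -(x - y) by ring]
  ring

lemma selfCorr_neg_one_eq_zero {f : ℤ → ℂ} (hf : ∀ y, f y ≠ 0 → 1 ≤ y) {x : ℤ} (hx : x ≤ 0) :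
    selfCorr f (-1) x = 0 := by
  rw [selfCorr]
  refine (tsum_congr fun y => ?_).trans tsum_zero
  by_contra h
  have h1 := hf _ (left_ne_zero_of_mul h)
  have h2 := hf _ (right_ne_zero_of_mul h)
  omega

lemma intConv_oddExtension_of_nonneg {f : ℤ → ℂ} {R : ℝ}
    (hf : ∀ y, f y ≠ 0 → 1 ≤ y ∧ (y : ℝ) ≤ R) {x : ℤ} (hx : 0 ≤ x) :
    intConv (oddExtension f) (oddExtension f) x = selfCorr f (-1) x - 2 * selfCorr f 1 x := by
  rw [intConv_oddExtension hf, selfCorr_neg_one_eq_zero (fun y hy => (hf y hy).1)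
    (show -x ≤ 0 by omega), add_zero]

lemma norm_tsum_mul_oddExtension_le {F f : ℤ → ℂ} {R A B : ℝ} (hR : 1 ≤ R)
    (hA : 0 ≤ A) (hB : 0 ≤ B) (hf : ∀ y, f y ≠ 0 → 1 ≤ y ∧ (y : ℝ) ≤ R) (hfA : ∀ y, ‖f y‖ ≤ A)
    (hF : ∀ y, ‖F y‖ ≤ B) :
    (Summable fun y => F y * oddExtension f y) ∧
      ‖∑' y, F y * oddExtension f y‖ ≤ 6 * R * A * B := by
  have hz : ∀ y ∉ Finset.Icc (-⌊R⌋) ⌊R⌋, F y * oddExtension f y = 0 := by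
    intro y hy
    rw [Finset.mem_Icc] at hy
    rw [oddExtension, eq_zero_of_notMem_Icc hf (y := y), eq_zero_of_notMem_Icc hf (y := -y)]
    · simp
    · rw [Finset.mem_Icc]; omega
    · rw [Finset.mem_Icc]; omega
  refine ⟨summable_of_ne_finset_zero hz, ?_⟩
  rw [tsum_eq_sum hz]
  have h1 : ∀ y ∈ Finset.Icc (-⌊R⌋) ⌊R⌋, ‖F y * oddExtension f y‖ ≤ B * (2 * A) := by
    intro y _
    rw [norm_mul]
    refine mul_le_mul (hF y) ?_ (norm_nonneg _) hB
    refine (norm_sub_le _ _).trans ?_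
    linarith [hfA y, hfA (-y)]
  refine (norm_sum_le _ _).trans ((Finset.sum_le_card_nsmul _ _ _ h1).trans ?_)
  rw [nsmul_eq_mul, Int.card_Icc]
  have h0 : 1 ≤ ⌊R⌋ := Int.le_floor.2 (by simpa using hR)
  have h2 : (((⌊R⌋ + 1 - -⌊R⌋).toNat : ℕ) : ℝ) = 2 * (⌊R⌋ : ℝ) + 1 := by
    have h3 : (((⌊R⌋ + 1 - -⌊R⌋).toNat : ℕ) : ℤ) = 2 * ⌊R⌋ + 1 := by omega
    exact_mod_cast congrArg (Int.cast : ℤ → ℝ) h3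
  rw [h2]
  calc (2 * (⌊R⌋ : ℝ) + 1) * (B * (2 * A)) ≤ (3 * R) * (B * (2 * A)) := by
        gcongr
        linarith [Int.floor_le R]
    _ = 6 * R * A * B := by ring

/-! ### The smooth main part -/

section SmoothPart

variable {g : ℝ → ℂ} {M α s : ℝ}

lemma rpow_rpow_one_div_sub {s α : ℝ} (hs : 0 < s) (hα : 0 < α) (k : ℝ) :
    (s ^ α) ^ (1 / α - k) = s ^ (1 - k * α) := by
  rw [← Real.rpow_mul hs.le]
  congr 1
  field_simp

lemma one_div_mul_rpow_le (hα : 1 < α) (hs : 0 < s) {y : ℝ} (hy : s ^ α / 6 ≤ y) :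
    0 ≤ 1 / α * y ^ (1 / α - 1) ∧ 1 / α * y ^ (1 / α - 1) ≤ 6 * s ^ (1 - α) := by
  have hα0 : 0 < α := by linarith
  have hN : 0 < s ^ α := by positivity
  have hy0 : 0 < y := by linarith
  have hβ : 1 / α < 1 := (div_lt_one hα0).2 hα
  have hβ0 : 0 < 1 / α := by positivity
  refine ⟨by positivity, ?_⟩
  have h1 := Real.rpow_le_rpow_of_nonpos (z := 1 / α - 1) (by positivity) hy (by linarith)
  have e : (6 : ℝ) ^ (1 / α - 1) = (6 ^ (1 - 1 / α))⁻¹ := by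
    rw [← Real.rpow_neg (by norm_num)]; congr 1; ring
  rw [Real.div_rpow hN.le (by norm_num), e, div_inv_eq_mul, rpow_rpow_one_div_sub hs hα0,
    one_mul] at h1
  have h2 : (6 : ℝ) ^ (1 - 1 / α) ≤ 6 := by
    calc (6 : ℝ) ^ (1 - 1 / α) ≤ 6 ^ (1 : ℝ) :=
          Real.rpow_le_rpow_of_exponent_le (by norm_num) (by linarith)
      _ = 6 := by norm_num
  have h3 : 0 < y ^ (1 / α - 1) := by positivity
  have h4 : 0 < s ^ (1 - α) := by positivity
  nlinarith

lemma norm_smoothDensity_le_rpow (hg : IsWeight g M) (hα : 1 < α) (hα' : α ≤ 2) (hs : 0 < s)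
    (y : ℤ) : ‖smoothDensity g α s y‖ ≤ 6 * M * s ^ (-α) := by
  have hM := hg.nonneg
  by_cases h : smoothDensity g α s y = 0
  · rw [h, norm_zero]; positivity
  obtain ⟨hy1, hy2, -⟩ := smoothDensity_support hg hα hα' hs h
  have hN : 0 < s ^ α := by positivity
  obtain ⟨h0, h1⟩ := one_div_mul_rpow_le hα hs (y := y) (by linarith)
  rw [smoothDensity, if_pos hy1, norm_mul, norm_div, Complex.norm_real, Complex.norm_real,
    Real.norm_of_nonneg hs.le, Real.norm_of_nonneg h0]
  calc ‖g ((y : ℝ) ^ (1 / α) / s)‖ / s * (1 / α * (y : ℝ) ^ (1 / α - 1))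
      ≤ M / s * (6 * s ^ (1 - α)) := by
        gcongr
        exact hg.norm_le _
    _ = 6 * M * s ^ (-α) := by
        rw [show (1 : ℝ) - α = -α + 1 by ring, Real.rpow_add_one hs.ne']
        field_simp

lemma norm_smoothDensity_sub_le (hg : IsWeight g M) (hα : 1 < α) (hα' : α ≤ 2) (hs : 0 < s)
    (y z : ℤ) : ‖smoothDensity g α s y - smoothDensity g α s z‖ ≤
      72 * M * s ^ (-α) * (|(y : ℝ) - z| * s ^ (-α)) := by
  have hM := hg.nonneg
  have hα0 : 0 < α := by linarith
  obtain ⟨N, hN⟩ : ∃ N : ℝ, N = s ^ α := ⟨_, rfl⟩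
  have hN0 : 0 < N := by rw [hN]; positivity
  have hNinv : s ^ (-α) = N⁻¹ := by rw [hN, Real.rpow_neg hs.le]
  wlog hyz : smoothDensity g α s y ≠ 0 generalizing y z
  · by_cases hz : smoothDensity g α s z = 0
    · push Not at hyz
      rw [hyz, hz, sub_zero, norm_zero]; positivity
    · rw [norm_sub_rev, abs_sub_comm]
      exact this z y hz
  obtain ⟨hy1, hy2, hy3⟩ := smoothDensity_support hg hα hα' hs hyz
  rw [← hN] at hy2 hy3
  -- If `z` is outside this range then `|y - z|` is at least `N / 12`, and the bound on the size of
  -- the density suffices.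
  by_cases hz : N / 6 ≤ (z : ℝ) ∧ (z : ℝ) ≤ 6 * N
  · have hz1 : 1 ≤ z := by
      have : (0 : ℝ) < z := by linarith [hz.1]
      exact_mod_cast this
    have hβ : 1 / α < 1 := (div_lt_one hα0).2 hα
    have hβ0 : 0 < 1 / α := by positivity
    obtain ⟨h0, h1⟩ := one_div_mul_rpow_le hα hs (y := y) (by rw [← hN]; linarith)
    have h2 := abs_rpow_sub_le_of_comparable (y := y) (z := z) hN0 hβ0 hβ (by linarith) hz.1
    have h3 := abs_rpow_sub_rpow_le_of_comparable (y := y) (z := z) hN0 hβ0 hβ (by linarith)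
      (by linarith) hz.1 hz.2
    have h4 := hg.lipschitz ((y : ℝ) ^ (1 / α) / s) ((z : ℝ) ^ (1 / α) / s)
    rw [← sub_div, abs_div, abs_of_pos hs] at h4
    have h5 := hg.norm_le ((z : ℝ) ^ (1 / α) / s)
    have e1 : N ^ (1 / α - 1) = s / N := by
      rw [hN, rpow_rpow_one_div_sub hs hα0, one_mul, Real.rpow_sub hs, Real.rpow_one]
    have e2 : N ^ (1 / α - 2) = s / N ^ 2 := by
      rw [hN, rpow_rpow_one_div_sub hs hα0, Real.rpow_sub hs, Real.rpow_one, mul_comm,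
        Real.rpow_mul hs.le]
      norm_cast
    have e3 : s ^ (1 - α) = s / N := by rw [hN, Real.rpow_sub hs, Real.rpow_one]
    rw [e1] at h2
    rw [e2] at h3
    rw [e3] at h1
    rw [smoothDensity, smoothDensity, if_pos hy1, if_pos hz1, hNinv]
    have h6 : ‖((1 / α * (y : ℝ) ^ (1 / α - 1) : ℝ) : ℂ) -
        ((1 / α * (z : ℝ) ^ (1 / α - 1) : ℝ) : ℂ)‖ ≤ 36 * (s / N ^ 2) * |(y : ℝ) - z| := by
      rw [← Complex.ofReal_sub, Complex.norm_real, Real.norm_eq_abs, ← mul_sub, abs_mul,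
        abs_of_pos hβ0]
      refine le_trans ?_ h3
      exact mul_le_of_le_one_left (abs_nonneg _) hβ.le
    have h7 : ‖((1 / α * (y : ℝ) ^ (1 / α - 1) : ℝ) : ℂ)‖ ≤ 6 * (s / N) := by
      rw [Complex.norm_real, Real.norm_of_nonneg h0]; exact h1
    generalize ((1 / α * (y : ℝ) ^ (1 / α - 1) : ℝ) : ℂ) = p at *
    generalize ((1 / α * (z : ℝ) ^ (1 / α - 1) : ℝ) : ℂ) = q at *
    have h8 : ‖g ((y : ℝ) ^ (1 / α) / s) - g ((z : ℝ) ^ (1 / α) / s)‖ ≤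
        M * (6 * (s / N) * |(y : ℝ) - z| / s) := h4.trans (by gcongr)
    generalize g ((y : ℝ) ^ (1 / α) / s) = a at *
    generalize g ((z : ℝ) ^ (1 / α) / s) = b at *
    have e : a / s * p - b / s * q = ((a - b) * p + b * (p - q)) / (s : ℂ) := by
      have : (s : ℂ) ≠ 0 := by exact_mod_cast hs.ne'
      field_simp
      ring
    rw [e, norm_div, Complex.norm_real, Real.norm_of_nonneg hs.le, div_le_iff₀ hs]
    refine (norm_add_le _ _).trans ?_
    rw [norm_mul, norm_mul]
    calc ‖a - b‖ * ‖p‖ + ‖b‖ * ‖p - q‖ ≤ M * (6 * (s / N) * |(y : ℝ) - z| / s) * (6 * (s / N)) +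
          M * (36 * (s / N ^ 2) * |(y : ℝ) - z|) := by gcongr
      _ = 72 * M * N⁻¹ * (|(y : ℝ) - z| * N⁻¹) * s := by field_simp; ring
  · have hz0 : smoothDensity g α s z = 0 := by
      by_contra h
      obtain ⟨-, h2, h3⟩ := smoothDensity_support hg hα hα' hs h
      rw [← hN] at h2 h3
      exact hz ⟨by linarith, by linarith⟩
    have hdist : N / 12 ≤ |(y : ℝ) - z| := by
      rw [le_abs]
      by_contra! h
      exact hz ⟨by linarith [h.1], by linarith [h.2]⟩
    rw [hz0, sub_zero]
    refine (norm_smoothDensity_le_rpow hg hα hα' hs y).trans ?_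
    rw [hNinv]
    have h1 : 1 / 12 ≤ |(y : ℝ) - z| * N⁻¹ := by
      rw [← div_eq_mul_inv, le_div_iff₀ hN0]; linarith
    have h2 : 0 ≤ M * N⁻¹ := by positivity
    nlinarith

/-- The main part of the self-convolution of the kernel is bounded and Lipschitz at the scale
`s ^ α`. -/
lemma norm_intConv_smoothDensity_le (hg : IsWeight g M) (hα : 1 < α) (hα' : α ≤ 2) (hs : 1 ≤ s) :
    (∀ x, ‖intConv (oddExtension (smoothDensity g α s)) (oddExtension (smoothDensity g α s)) x‖ ≤
      1728 * M ^ 2 * s ^ (-α)) ∧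
    ∀ x u : ℤ,
      ‖intConv (oddExtension (smoothDensity g α s)) (oddExtension (smoothDensity g α s)) (x + u) -
        intConv (oddExtension (smoothDensity g α s)) (oddExtension (smoothDensity g α s)) x‖ ≤
      20736 * M ^ 2 * s ^ (-α) * (|(u : ℝ)| * s ^ (-α)) := by
  have hs0 : 0 < s := by linarith
  have hM := hg.nonneg
  have hN1 : 1 ≤ s ^ α := Real.one_le_rpow hs (by linarith)
  have hNinv : s ^ (-α) = (s ^ α)⁻¹ := Real.rpow_neg hs0.le _
  have hN0 : 0 < s ^ α := by positivity
  set f := smoothDensity g α s with hf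
  have hsupp : ∀ y, f y ≠ 0 → 1 ≤ y ∧ (y : ℝ) ≤ 4 * s ^ α := fun y hy =>
    let h := smoothDensity_support hg hα hα' hs0 hy
    ⟨h.1, h.2.2⟩
  have hA := norm_smoothDensity_le_rpow hg hα hα' hs0
  rw [← hf] at hA
  have hK : ∀ y, ‖oddExtension f y‖ ≤ 12 * M * s ^ (-α) := by
    intro y
    refine (norm_sub_le _ _).trans ?_
    linarith [hA y, hA (-y)]
  have hbd := fun (F : ℤ → ℂ) (B : ℝ) (hB : 0 ≤ B) (hF : ∀ y, ‖F y‖ ≤ B) =>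
    norm_tsum_mul_oddExtension_le (F := F) (R := 4 * s ^ α) (by linarith)
      (show 0 ≤ 6 * M * s ^ (-α) by positivity) hB hsupp hA hF
  constructor
  · intro x
    refine (hbd (fun y => oddExtension f (x - y)) (12 * M * s ^ (-α)) (by positivity)
      fun y => hK _).2.trans ?_
    rw [hNinv]
    refine le_of_eq ?_
    field_simp
    ring
  · intro x u
    have hL : ∀ y, ‖oddExtension f (x + u - y) - oddExtension f (x - y)‖ ≤
        144 * M * s ^ (-α) * (|(u : ℝ)| * s ^ (-α)) := by
      intro y
      have h1 := norm_smoothDensity_sub_le hg hα hα' hs0 (x + u - y) (x - y)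
      have h2 := norm_smoothDensity_sub_le hg hα hα' hs0 (-(x - y)) (-(x + u - y))
      rw [← hf] at h1 h2
      have e1 : ((x + u - y : ℤ) : ℝ) - ((x - y : ℤ) : ℝ) = u := by push_cast; ring
      have e2 : ((-(x - y) : ℤ) : ℝ) - ((-(x + u - y) : ℤ) : ℝ) = u := by push_cast; ring
      rw [e1] at h1
      rw [e2] at h2
      have e : oddExtension f (x + u - y) - oddExtension f (x - y) =
          (f (x + u - y) - f (x - y)) + (f (-(x - y)) - f (-(x + u - y))) := by
        simp only [oddExtension]; ring
      rw [e]
      refine (norm_add_le _ _).trans ?_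
      linarith
    have h0 := fun x : ℤ => (hbd (fun y => oddExtension f (x - y)) (12 * M * s ^ (-α))
      (by positivity) fun y => hK _).1
    rw [intConv, intConv, ← (h0 (x + u)).tsum_sub (h0 x)]
    simp_rw [← sub_mul]
    refine (hbd _ _ (by positivity) hL).2.trans ?_
    rw [hNinv]
    refine le_of_eq ?_
    field_simp
    ring

end SmoothPart

/-! ### The self-convolution of the kernel -/

/-- For `x ≠ 0` the self-convolution of the kernel is as small as the mean size of the kernel
predicts. The only terms not covered by the comparison with the smooth density are correlations at
small shifts, and self-convolutions at points that are below the support once `s` is large. -/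
lemma norm_intConv_floorDensity_le {α : ℝ} (hα : 1 < α) (hα' : α < 1 + 1 / 1000) :
    ∃ K, 0 < K ∧ ∀ {g : ℝ → ℂ} {M : ℝ}, IsWeight g M → ∀ s : ℝ, 1 ≤ s → ∀ x : ℤ, 0 < x →
      ‖intConv (oddExtension (floorDensity g α s)) (oddExtension (floorDensity g α s)) x‖ ≤
        K * M ^ 2 * s ^ (-α) := by
  have hα2 : α ≤ 2 := by linarith
  have hα0 : 0 < α := by linarith
  obtain ⟨K₁, hK₁, h₁⟩ := norm_selfCorr_le_of_le hα hα2
  obtain ⟨K₂, ε, hK₂, hε, h₂⟩ := norm_selfCorr_sub_le hα hα' (δ := 1 / 2) (by norm_num)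
  refine ⟨1728 + 3 * K₂ + 2 * K₁ + 262144, by linarith, ?_⟩
  intro g M hg s hs x hx
  have hM := hg.nonneg
  have hs0 : 0 < s := by linarith
  have hz0 : 0 ≤ M ^ 2 * s ^ (-α) := by positivity
  have hfs : ∀ y, floorDensity g α s y ≠ 0 → 1 ≤ y ∧ (y : ℝ) ≤ 4 * s ^ α := fun y hy =>
    let h := floorDensity_support hg hα hα2 hs0 hy
    ⟨h.1, h.2.2⟩
  have hss : ∀ y, smoothDensity g α s y ≠ 0 → 1 ≤ y ∧ (y : ℝ) ≤ 4 * s ^ α := fun y hy =>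
    let h := smoothDensity_support hg hα hα2 hs0 hy
    ⟨h.1, h.2.2⟩
  by_cases hxs : s ^ (α - 1 + 1 / 2) ≤ x
  · have h3 := h₂ hg s hs 1 (Or.inl rfl) x hx hxs
    have h4 := h₂ hg s hs (-1) (Or.inr rfl) x hx hxs
    have h5 := (norm_intConv_smoothDensity_le hg hα hα2 hs).1 x
    have h6 : s ^ (-α - ε) ≤ s ^ (-α) := Real.rpow_le_rpow_of_exponent_le hs (by linarith)
    rw [intConv_oddExtension_of_nonneg hss hx.le] at h5
    rw [intConv_oddExtension_of_nonneg hfs hx.le]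
    have h7 : K₂ * M ^ 2 * s ^ (-α - ε) ≤ K₂ * (M ^ 2 * s ^ (-α)) := by
      rw [mul_assoc]; gcongr
    have e : ∀ a b c d : ℂ, ‖a - 2 * b‖ ≤ ‖c - 2 * d‖ + ‖a - c‖ + 2 * ‖b - d‖ := by
      intro a b c d
      calc ‖a - 2 * b‖ = ‖(c - 2 * d) + (a - c) - 2 * (b - d)‖ := by congr 1; ring
        _ ≤ ‖c - 2 * d‖ + ‖a - c‖ + ‖2 * (b - d)‖ :=
          (norm_sub_le _ _).trans (by gcongr; exact norm_add_le _ _)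
        _ = _ := by rw [norm_mul, Complex.norm_ofNat]
    refine (e _ _ (selfCorr (smoothDensity g α s) (-1) x)
      (selfCorr (smoothDensity g α s) 1 x)).trans ?_
    nlinarith
  · push Not at hxs
    have hxs' : (x : ℝ) ≤ s := by
      refine hxs.le.trans ?_
      calc s ^ (α - 1 + 1 / 2) ≤ s ^ (1 : ℝ) :=
            Real.rpow_le_rpow_of_exponent_le hs (by linarith)
        _ = s := Real.rpow_one s
    have h3 := h₁ hg s hs x hx hxs'
    have h4 : ‖selfCorr (floorDensity g α s) (-1) x‖ ≤ 262144 * (M ^ 2 * s ^ (-α)) := by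
      by_cases h0 : selfCorr (floorDensity g α s) (-1) x = 0
      · rw [h0, norm_zero]; positivity
      have hN0 : 0 < s ^ α := by positivity
      have hsN : s ≤ s ^ α := by
        calc s = s ^ (1 : ℝ) := (Real.rpow_one s).symm
          _ ≤ s ^ α := Real.rpow_le_rpow_of_exponent_le hs hα.le
      -- Both arguments are at least `s ^ α / 4 - 1`, while their sum `x` is below
      -- `s ^ (α - 1 / 2)`.
      have hs16 : s < 16 := by
        by_contra! hs16
        have : ∃ y, floorDensity g α s y * floorDensity g α s (x + -1 * y) ≠ 0 := by
          by_contra! hall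
          exact h0 ((tsum_congr hall).trans tsum_zero)
        obtain ⟨y, hy⟩ := this
        obtain ⟨-, h5, -⟩ := floorDensity_support hg hα hα2 hs0 (left_ne_zero_of_mul hy)
        obtain ⟨-, h6, -⟩ := floorDensity_support hg hα hα2 hs0 (right_ne_zero_of_mul hy)
        have h7 : s ^ (α - 1 + 1 / 2) * s ^ (1 / 2 : ℝ) = s ^ α := by
          rw [← Real.rpow_add hs0]; congr 1; ring
        have h8 : (4 : ℝ) ≤ s ^ (1 / 2 : ℝ) := by
          rw [← Real.sqrt_eq_rpow]
          exact Real.le_sqrt_of_sq_le (by linarith)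
        have h9 : 0 < s ^ (α - 1 + 1 / 2) := by positivity
        push_cast at h5 h6
        nlinarith
      have h5 := norm_selfCorr_le (f := floorDensity g α s) (by positivity)
        (show 0 ≤ M / s by positivity) hfs (norm_floorDensity_le hg hs0) (-1) x
      refine h5.trans ?_
      have h6 : s ^ α ≤ 256 := by
        calc s ^ α ≤ s ^ (2 : ℝ) := Real.rpow_le_rpow_of_exponent_le hs hα2
          _ = s ^ 2 := by norm_cast
          _ ≤ 16 ^ 2 := by gcongr
          _ = 256 := by norm_num
      have h7 : (M / s) ^ 2 ≤ M ^ 2 := by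
        gcongr
        exact div_le_self hM hs
      rw [Real.rpow_neg hs0.le, ← div_eq_mul_inv, ← mul_div_assoc, le_div_iff₀ hN0]
      calc 4 * s ^ α * (M / s) ^ 2 * s ^ α ≤ 4 * 256 * M ^ 2 * 256 := by gcongr
        _ = 262144 * M ^ 2 := by ring
    rw [intConv_oddExtension_of_nonneg hfs hx.le]
    refine (norm_sub_le _ _).trans ?_
    rw [norm_mul, Complex.norm_ofNat]
    nlinarith

/-- At the origin the self-convolution of the kernel is a Riemann sum. -/
lemma norm_intConv_floorDensity_zero_sub_le {g : ℝ → ℂ} {M α s : ℝ} (hg : IsWeight g M)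
    (hα : 1 < α) (hα' : α ≤ 2) (hs : 1 ≤ s) :
    ‖intConv (oddExtension (floorDensity g α s)) (oddExtension (floorDensity g α s)) 0 -
      (-2 * ∫ t in (0 : ℝ)..2, g t ^ 2) / s‖ ≤ 12 * M ^ 2 * s ^ (-α) := by
  have hs0 : 0 < s := by linarith
  have hM := hg.nonneg
  have hα0 : 0 < α := by linarith
  have hsC : (s : ℂ) ≠ 0 := by exact_mod_cast hs0.ne'
  set f := floorDensity g α s with hf
  have hfs : ∀ y, f y ≠ 0 → 1 ≤ y ∧ (y : ℝ) ≤ 4 * s ^ α := fun y hy =>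
    let h := floorDensity_support hg hα hα' hs0 hy
    ⟨h.1, h.2.2⟩
  have hval : ∀ n : ℕ, f ⌊((n : ℝ) + 1) ^ α⌋ = g ((n + 1) / s) / s := by
    intro n
    have h1 := (floor_rpow_eq_iff hα (m := (n : ℤ) + 1) (y := ⌊((n : ℝ) + 1) ^ α⌋) (by omega)).1
      (by push_cast; rfl)
    rw [hf, floorDensity, if_pos h1.1, h1.2]
    push_cast
    rfl
  have hinj : Function.Injective fun n : ℕ => ⌊((n : ℝ) + 1) ^ α⌋ := by
    intro a b hab
    have h1 := (floor_rpow_eq_iff hα (m := (a : ℤ) + 1) (y := ⌊((a : ℝ) + 1) ^ α⌋) (by omega)).1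
      (by push_cast; rfl)
    have h2 := (floor_rpow_eq_iff hα (m := (b : ℤ) + 1) (y := ⌊((a : ℝ) + 1) ^ α⌋) (by omega)).1
      (by push_cast; exact hab.symm)
    have h3 := h1.2.symm.trans h2.2
    omega
  have hsum : selfCorr f 1 0 = ∑' n : ℕ, (g ((n + 1) / s) / s) ^ 2 := by
    rw [selfCorr, ← hinj.tsum_eq]
    · refine tsum_congr fun n => ?_
      rw [zero_add, one_mul, hval, sq]
    · intro y hy
      obtain ⟨m, hm, hmy, -⟩ := floorDensity_ne_zero hg hα hs0 (left_ne_zero_of_mul hy)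
      obtain ⟨n, rfl⟩ := Nat.exists_eq_add_of_le' hm
      exact ⟨n, by rw [← hmy]; push_cast; rfl⟩
  set B := ⌈2 * s⌉₊ with hB
  have hB1 : 2 * s ≤ B := Nat.le_ceil _
  have hB2 : (B : ℝ) ≤ 3 * s := by
    have := Nat.ceil_lt_add_one (show 0 ≤ 2 * s by linarith)
    rw [← hB] at this
    linarith
  have hvan : ∀ t, 2 < t → g t = 0 := by
    intro t ht
    by_contra h
    linarith [(hg.support t h).2]
  have hsum' : selfCorr f 1 0 = ∑ n ∈ Finset.range B, (g ((n + 1) / s) / s) ^ 2 := by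
    rw [hsum]
    refine tsum_eq_sum fun n hn => ?_
    rw [Finset.mem_range, not_lt] at hn
    have h1 : (B : ℝ) ≤ n := by exact_mod_cast hn
    rw [hvan]
    · simp
    · rw [lt_div_iff₀ hs0]; linarith
  have hlip : ∀ t u, ‖g t ^ 2 - g u ^ 2‖ ≤ 2 * M ^ 2 * |t - u| := by
    intro t u
    rw [sq_sub_sq, norm_mul]
    calc ‖g t + g u‖ * ‖g t - g u‖ ≤ (M + M) * (M * |t - u|) := by
          gcongr
          · exact (norm_add_le _ _).trans (add_le_add (hg.norm_le _) (hg.norm_le _))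
          · exact hg.lipschitz _ _
      _ = _ := by ring
  have hcont : Continuous g := by
    have : LipschitzWith ⟨M, hM⟩ g := LipschitzWith.of_dist_le_mul fun t u => by
      rw [dist_eq_norm, Real.dist_eq]; exact hg.lipschitz t u
    exact this.continuous
  have hcont2 : Continuous fun t => g t ^ 2 := hcont.pow 2
  have hint : ∀ a b : ℝ, IntervalIntegrable (fun t => g t ^ 2) MeasureTheory.volume a b :=
    fun a b => hcont2.intervalIntegrable a b
  have hI : ∫ t in (0 : ℝ)..2, g t ^ 2 =
      ∑ n ∈ Finset.range B, ∫ t in ((n : ℝ) / s)..((n + 1) / s), g t ^ 2 := by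
    have h1 := intervalIntegral.sum_integral_adjacent_intervals (f := fun t => g t ^ 2)
      (μ := MeasureTheory.volume) (a := fun n : ℕ => (n : ℝ) / s) (n := B) fun k _ => hint _ _
    simp only [Nat.cast_add, Nat.cast_one, Nat.cast_zero, zero_div] at h1
    rw [h1, ← intervalIntegral.integral_add_adjacent_intervals (hint 0 2) (hint 2 (B / s))]
    have h2 : ∫ t in (2 : ℝ)..(B / s), g t ^ 2 = 0 := by
      refine intervalIntegral.integral_zero_ae (Filter.Eventually.of_forall fun t ht => ?_)
      rw [Set.uIoc_of_le ((le_div_iff₀ hs0).2 hB1)] at ht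
      rw [hvan t ht.1]; simp
    rw [h2, add_zero]
  have hterm : ∀ n : ℕ, ‖(g ((n + 1) / s) / s) ^ 2 -
      (∫ t in ((n : ℝ) / s)..((n + 1) / s), g t ^ 2) / s‖ ≤ 2 * M ^ 2 / s ^ 3 := by
    intro n
    have hlen : ((n : ℝ) + 1) / s - n / s = 1 / s := by rw [← sub_div]; simp
    have h1 : (∫ _ in ((n : ℝ) / s)..((n + 1) / s), g ((n + 1) / s) ^ 2) =
        g ((n + 1) / s) ^ 2 / s := by
      rw [intervalIntegral.integral_const, hlen, Complex.real_smul]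
      push_cast
      rw [mul_comm, mul_one_div]
    have e : (g ((n + 1) / s) / s) ^ 2 - (∫ t in ((n : ℝ) / s)..((n + 1) / s), g t ^ 2) / s =
        (∫ t in ((n : ℝ) / s)..((n + 1) / s), (g ((n + 1) / s) ^ 2 - g t ^ 2)) / s := by
      rw [intervalIntegral.integral_sub (by simp) (hint _ _), h1]
      field_simp
    have hle : (n : ℝ) / s ≤ (n + 1) / s := by gcongr; linarith
    have h2 := intervalIntegral.norm_integral_le_of_norm_le_const (C := 2 * M ^ 2 * (1 / s))
      (f := fun t => g ((n + 1) / s) ^ 2 - g t ^ 2) (a := (n : ℝ) / s) (b := (n + 1) / s) (by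
        intro t ht
        rw [Set.uIoc_of_le hle] at ht
        refine (hlip _ _).trans ?_
        gcongr
        rw [abs_of_nonneg (by linarith [ht.2])]
        linarith [ht.1])
    rw [hlen, abs_of_pos (by positivity)] at h2
    rw [e, norm_div, Complex.norm_real, Real.norm_of_nonneg hs0.le]
    calc _ ≤ 2 * M ^ 2 * (1 / s) * (1 / s) / s := by gcongr
      _ = 2 * M ^ 2 / s ^ 3 := by field_simp
  have hmain : ‖selfCorr f 1 0 - (∫ t in (0 : ℝ)..2, g t ^ 2) / s‖ ≤ 6 * M ^ 2 / s ^ 2 := by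
    rw [hsum', hI, Finset.sum_div, ← Finset.sum_sub_distrib]
    refine (norm_sum_le _ _).trans ((Finset.sum_le_card_nsmul _ _ _ fun n _ => hterm n).trans ?_)
    rw [nsmul_eq_mul, Finset.card_range]
    calc (B : ℝ) * (2 * M ^ 2 / s ^ 3) ≤ 3 * s * (2 * M ^ 2 / s ^ 3) := by gcongr
      _ = 6 * M ^ 2 / s ^ 2 := by field_simp; ring
  rw [intConv_oddExtension_of_nonneg hfs le_rfl,
    selfCorr_neg_one_eq_zero (fun y hy => (hfs y hy).1) le_rfl]
  have e : 0 - 2 * selfCorr f 1 0 - (-2 * ∫ t in (0 : ℝ)..2, g t ^ 2) / s =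
      -2 * (selfCorr f 1 0 - (∫ t in (0 : ℝ)..2, g t ^ 2) / s) := by ring
  rw [e, norm_mul, norm_neg, Complex.norm_ofNat]
  have h1 : (1 : ℝ) / s ^ 2 ≤ s ^ (-α) := by
    have h2 : s ^ (-(2 : ℝ)) ≤ s ^ (-α) := Real.rpow_le_rpow_of_exponent_le hs (by linarith)
    rw [Real.rpow_neg hs0.le] at h2
    rw [one_div]
    exact_mod_cast h2
  calc 2 * ‖selfCorr f 1 0 - (∫ t in (0 : ℝ)..2, g t ^ 2) / s‖ ≤ 2 * (6 * M ^ 2 / s ^ 2) := by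
        gcongr
    _ = 12 * M ^ 2 * (1 / s ^ 2) := by ring
    _ ≤ 12 * M ^ 2 * s ^ (-α) := by gcongr

/-- Test functions on `(1/2, 2)`, divided by the identity, are admissible weights. -/
lemma exists_isWeight_div {φ : ℝ → ℂ} (hφ : ContDiff ℝ ∞ φ)
    (hsupp : tsupport φ ⊆ Set.Ioo (1 / 2) 2) : ∃ M, IsWeight (fun t => φ t / t) M := by
  have hcpt : HasCompactSupport φ :=
    HasCompactSupport.intro (isCompact_Icc (a := (1 / 2 : ℝ)) (b := 2)) fun t ht => by
      by_contra h
      have := hsupp (subset_tsupport _ h)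
      exact ht ⟨this.1.le, this.2.le⟩
  obtain ⟨A, hA⟩ := hcpt.exists_bound_of_continuous hφ.continuous
  obtain ⟨L, hL⟩ := ContDiff.lipschitzWith_of_hasCompactSupport hcpt hφ (by simp)
  have hL' : ∀ t u, ‖φ t - φ u‖ ≤ L * |t - u| := fun t u => by
    have := hL.dist_le_mul t u
    rwa [dist_eq_norm, Real.dist_eq] at this
  have hs : ∀ t, φ t ≠ 0 → 1 / 2 ≤ t ∧ t ≤ 2 := fun t ht =>
    let h := hsupp (subset_tsupport _ ht)
    ⟨h.1.le, h.2.le⟩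
  have hA0 : 0 ≤ A := (norm_nonneg _).trans (hA 0)
  have hL0 : 0 ≤ (L : ℝ) := L.2
  have hone : ∀ t, ‖φ t / (t : ℂ)‖ ≤ 2 * ‖φ t‖ := by
    intro t
    by_cases h : φ t = 0
    · simp [h]
    · have := (hs t h).1
      rw [norm_div, Complex.norm_real, Real.norm_of_nonneg (by linarith),
        div_le_iff₀ (by linarith)]
      nlinarith [norm_nonneg (φ t)]
  refine ⟨2 * L + 4 * A, ⟨fun t => ?_, fun t u => ?_, fun t ht => ?_⟩⟩
  · linarith [hone t, hA t]
  · have hd : 0 ≤ |t - u| := abs_nonneg _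
    have h0 : 0 ≤ A * |t - u| := by positivity
    by_cases ht : φ t = 0
    · have h1 := hone u
      have h2 := hL' t u
      rw [ht, zero_sub, norm_neg] at h2
      simp only [ht, zero_div, zero_sub, norm_neg]
      linarith
    by_cases hu : φ u = 0
    · have h1 := hone t
      have h2 := hL' t u
      rw [hu, sub_zero] at h2
      simp only [hu, zero_div, sub_zero]
      linarith
    have h1 := (hs t ht).1
    have h2 := (hs u hu).1
    have ht0 : (t : ℂ) ≠ 0 := by exact_mod_cast (by linarith : t ≠ 0)
    have hu0 : (u : ℂ) ≠ 0 := by exact_mod_cast (by linarith : u ≠ 0)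
    have e : φ t / (t : ℂ) - φ u / (u : ℂ) =
        ((φ t - φ u) * u + φ u * ((u - t : ℝ) : ℂ)) / ((t * u : ℝ) : ℂ) := by
      push_cast
      field_simp
      ring
    have h3 : 0 < t * u := by positivity
    have h4 := hL' t u
    have h5 := hA u
    rw [e, norm_div, Complex.norm_real, Real.norm_of_nonneg h3.le, div_le_iff₀ h3]
    refine (norm_add_le _ _).trans ?_
    rw [norm_mul, norm_mul, Complex.norm_real, Complex.norm_real, Real.norm_of_nonneg (by linarith),
      Real.norm_eq_abs, abs_sub_comm u t]
    calc ‖φ t - φ u‖ * u + ‖φ u‖ * |t - u| ≤ L * |t - u| * u + A * |t - u| := by gcongr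
      _ ≤ L * |t - u| * (2 * (t * u)) + A * |t - u| * (4 * (t * u)) := by
        refine add_le_add (mul_le_mul_of_nonneg_left (by nlinarith) (mul_nonneg hL0 hd)) ?_
        refine le_mul_of_one_le_right h0 ?_
        nlinarith
      _ = _ := by ring
  · refine hs t fun h => ht ?_
    simp [h]

/-- The kernel of the operator is the odd extension of the push-forward of the weights
`φ (m / s) / m`. -/
lemma waringKernel_eq {φ : ℝ → ℂ} {α s : ℝ} (hα : 1 < α) (hs : 0 < s) :
    waringKernel φ α s = oddExtension (floorDensity (fun t => φ t / t) α s) := by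
  have hsC : (s : ℂ) ≠ 0 := by exact_mod_cast hs.ne'
  have key : ∀ x : ℤ, HasSum (fun m : ℕ+ => φ ((m : ℝ) / s) / (m : ℂ) *
      deltaZero (x - ⌊(m : ℝ) ^ α⌋)) (floorDensity (fun t => φ t / t) α s x) := by
    intro x
    by_cases hc : 1 ≤ x ∧ IsFloorPower (1 / α) x
    · have hx : (1 : ℝ) ≤ x := by exact_mod_cast hc.1
      have hpos : 1 ≤ ⌈(x : ℝ) ^ (1 / α)⌉ := by
        have : 0 < (x : ℝ) ^ (1 / α) := by positivity
        exact Int.one_le_ceil_iff.2 this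
      obtain ⟨n, hn⟩ := Int.eq_ofNat_of_zero_le (show 0 ≤ ⌈(x : ℝ) ^ (1 / α)⌉ by omega)
      obtain ⟨m, rfl⟩ : ∃ m : ℕ+, (m : ℕ) = n := ⟨⟨n, by omega⟩, rfl⟩
      have h1 := (floor_rpow_eq_iff hα (m := ((m : ℕ) : ℤ)) (y := x) (by omega)).2 ⟨hc, hn⟩
      have h2 := hasSum_single (f := fun m : ℕ+ => φ ((m : ℝ) / s) / (m : ℂ) *
        deltaZero (x - ⌊(m : ℝ) ^ α⌋)) m (by
          intro k hk
          have : x - ⌊(k : ℝ) ^ α⌋ ≠ 0 := by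
            intro h
            have h3 := (floor_rpow_eq_iff hα (m := ((k : ℕ) : ℤ)) (y := x)
              (by have := k.pos; omega)).1 (by rw [Int.cast_natCast]; exact (sub_eq_zero.1 h).symm)
            apply hk
            rw [hn] at h3
            exact PNat.coe_injective (by exact_mod_cast h3.2.symm)
          simp [deltaZero, this])
      convert h2 using 1
      rw [floorDensity, if_pos hc, hn]
      have h4 : x - ⌊(m : ℝ) ^ α⌋ = 0 := by
        rw [← h1]; push_cast; ring
      rw [h4]
      have hmC : (m : ℂ) ≠ 0 := by exact_mod_cast m.ne_zero
      simp only [deltaZero, Pi.single_eq_same, Int.cast_natCast]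
      push_cast
      field_simp
    · have h0 : ∀ m : ℕ+, φ ((m : ℝ) / s) / (m : ℂ) * deltaZero (x - ⌊(m : ℝ) ^ α⌋) = 0 := by
        intro m
        have : x - ⌊(m : ℝ) ^ α⌋ ≠ 0 := by
          intro h
          exact hc ((floor_rpow_eq_iff hα (m := ((m : ℕ) : ℤ)) (y := x)
            (by have := m.pos; omega)).1 (by rw [Int.cast_natCast]; exact (sub_eq_zero.1 h).symm)).1
        simp [deltaZero, this]
      rw [floorDensity, if_neg hc]
      simp_rw [h0]
      exact hasSum_zero
  funext x
  rw [waringKernel, waringOp, oddExtension]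
  refine (tsum_congr fun m => ?_).trans ((key x).sub (key (-x))).tsum_eq
  have : deltaZero (x + ⌊(m : ℝ) ^ α⌋) = deltaZero (-x - ⌊(m : ℝ) ^ α⌋) := by
    simp only [deltaZero, Pi.single_apply]
    refine if_congr ?_ rfl rfl
    omega
  rw [this]
  ring

/-! ### The decomposition -/

/-- Away from a window of length `s ^ (α - 1 + δ)` the self-convolution of the kernel is its main
part up to a power saving. The saving `ε` is shrunk until its constant no longer depends
on `δ`, by interpolation with the uniform bound. -/
lemma exists_norm_intConv_sub_le {α : ℝ} (hα : 1 < α) (hα' : α < 1 + 1 / 1000) :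
    ∃ K : ℝ, 0 < K ∧
      (∀ {g : ℝ → ℂ} {M : ℝ}, IsWeight g M → ∀ s : ℝ, 1 ≤ s → ∀ x : ℤ, x ≠ 0 →
        ‖intConv (oddExtension (floorDensity g α s)) (oddExtension (floorDensity g α s)) x -
          intConv (oddExtension (smoothDensity g α s)) (oddExtension (smoothDensity g α s)) x‖ ≤
          K * M ^ 2 * s ^ (-α)) ∧
      ∀ δ : ℝ, 0 < δ → ∃ ε : ℝ, 0 < ε ∧ ∀ {g : ℝ → ℂ} {M : ℝ}, IsWeight g M →
        ∀ s : ℝ, 1 ≤ s → ∀ x : ℤ, s ^ (α - 1 + δ) ≤ |(x : ℝ)| →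
        ‖intConv (oddExtension (floorDensity g α s)) (oddExtension (floorDensity g α s)) x -
          intConv (oddExtension (smoothDensity g α s)) (oddExtension (smoothDensity g α s)) x‖ ≤
          K * M ^ 2 * s ^ (-α) * s ^ (-ε) := by
  have hα2 : α ≤ 2 := by linarith
  obtain ⟨K₀, hK₀, h₀⟩ := norm_intConv_floorDensity_le hα hα'
  -- Both self-convolutions are even.
  have heven : ∀ {g : ℝ → ℂ} {s : ℝ} (x : ℤ),
      intConv (oddExtension (floorDensity g α s)) (oddExtension (floorDensity g α s)) x -
        intConv (oddExtension (smoothDensity g α s)) (oddExtension (smoothDensity g α s)) x =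
      intConv (oddExtension (floorDensity g α s)) (oddExtension (floorDensity g α s)) |x| -
        intConv (oddExtension (smoothDensity g α s)) (oddExtension (smoothDensity g α s)) |x| := by
    intro g s x
    rcases abs_choice x with h | h <;> rw [h]
    rw [intConv_oddExtension_neg, intConv_oddExtension_neg]
  have hunif : ∀ {g : ℝ → ℂ} {M : ℝ}, IsWeight g M → ∀ s : ℝ, 1 ≤ s → ∀ x : ℤ, x ≠ 0 →
      ‖intConv (oddExtension (floorDensity g α s)) (oddExtension (floorDensity g α s)) x -
        intConv (oddExtension (smoothDensity g α s)) (oddExtension (smoothDensity g α s)) x‖ ≤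
        (K₀ + 1728) * M ^ 2 * s ^ (-α) := by
    intro g M hg s hs x hx
    rw [heven]
    refine (norm_sub_le _ _).trans ?_
    have h1 := h₀ hg s hs |x| (abs_pos.2 hx)
    have h2 := (norm_intConv_smoothDensity_le hg hα hα2 hs).1 |x|
    linarith
  refine ⟨(K₀ + 1728) * (3 * Real.exp 1), by positivity, ?_, ?_⟩
  · intro g M hg s hs x hx
    have hM := hg.nonneg
    have hs0 : 0 < s := by linarith
    refine (hunif hg s hs x hx).trans ?_
    have h1 : 1 ≤ 3 * Real.exp 1 := by linarith [Real.add_one_le_exp 1]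
    have h2 : K₀ + 1728 ≤ (K₀ + 1728) * (3 * Real.exp 1) := le_mul_of_one_le_right (by linarith) h1
    gcongr
  intro δ hδ
  obtain ⟨K, ε, hK, hε, h₁⟩ := norm_selfCorr_sub_le hα hα' hδ
  have hlog : 0 ≤ Real.log K := Real.log_nonneg hK
  set t := 1 / (1 + Real.log K) with ht
  have ht0 : 0 < t := by positivity
  have ht1 : t ≤ 1 := by rw [ht, div_le_one (by linarith)]; linarith
  have hKt : K ^ t ≤ Real.exp 1 := by
    rw [Real.rpow_def_of_pos (by linarith), Real.exp_le_exp, ht, mul_one_div,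
      div_le_one (by linarith)]
    linarith
  refine ⟨ε * t, by positivity, ?_⟩
  intro g M hg s hs x hx
  have hM := hg.nonneg
  have hs0 : 0 < s := by linarith
  have hx1 : 1 ≤ |(x : ℝ)| := (Real.one_le_rpow hs (by linarith)).trans hx
  have hx0 : x ≠ 0 := by
    rintro rfl
    norm_num at hx1
  have hz : 0 ≤ M ^ 2 * s ^ (-α) := by positivity
  have h2 := hunif hg s hs x hx0
  have h3 : ‖intConv (oddExtension (floorDensity g α s)) (oddExtension (floorDensity g α s)) x -
      intConv (oddExtension (smoothDensity g α s)) (oddExtension (smoothDensity g α s)) x‖ ≤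
      3 * (M ^ 2 * s ^ (-α)) * (K * s ^ (-ε)) := by
    have hfs : ∀ y, floorDensity g α s y ≠ 0 → 1 ≤ y ∧ (y : ℝ) ≤ 4 * s ^ α := fun y hy =>
      let h := floorDensity_support hg hα hα2 hs0 hy
      ⟨h.1, h.2.2⟩
    have hss : ∀ y, smoothDensity g α s y ≠ 0 → 1 ≤ y ∧ (y : ℝ) ≤ 4 * s ^ α := fun y hy =>
      let h := smoothDensity_support hg hα hα2 hs0 hy
      ⟨h.1, h.2.2⟩
    have hxa : s ^ (α - 1 + δ) ≤ ((|x| : ℤ) : ℝ) := by push_cast; exact hx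
    have h4 := h₁ hg s hs 1 (Or.inl rfl) |x| (abs_pos.2 hx0) hxa
    have h5 := h₁ hg s hs (-1) (Or.inr rfl) |x| (abs_pos.2 hx0) hxa
    rw [heven, intConv_oddExtension_of_nonneg hfs (abs_nonneg x),
      intConv_oddExtension_of_nonneg hss (abs_nonneg x)]
    have e : ∀ a b c d : ℂ, ‖a - 2 * b - (c - 2 * d)‖ ≤ ‖a - c‖ + 2 * ‖b - d‖ := by
      intro a b c d
      calc ‖a - 2 * b - (c - 2 * d)‖ = ‖(a - c) - 2 * (b - d)‖ := by congr 1; ring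
        _ ≤ ‖a - c‖ + ‖2 * (b - d)‖ := norm_sub_le _ _
        _ = _ := by rw [norm_mul, Complex.norm_ofNat]
    refine (e _ _ _ _).trans ?_
    have h6 : s ^ (-α - ε) = s ^ (-α) * s ^ (-ε) := by
      rw [← Real.rpow_add hs0]; congr 1
    rw [h6] at h4 h5
    linarith
  -- This holds since `0 < t ≤ 1`, and `t` was chosen so that `K ^ t` is bounded by `exp 1`.
  have h4 : ∀ z : ℝ, 0 < z → min 1 z ≤ z ^ t := by
    intro z hz
    rcases le_total z 1 with h | h
    · refine (min_le_right _ _).trans ?_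
      calc z = z ^ (1 : ℝ) := (Real.rpow_one z).symm
        _ ≤ z ^ t := Real.rpow_le_rpow_of_exponent_ge hz h ht1
    · exact (min_le_left _ _).trans (Real.one_le_rpow h ht0.le)
  have hz0 : 0 < K * s ^ (-ε) := by positivity
  have h5 : (K * s ^ (-ε)) ^ t ≤ Real.exp 1 * s ^ (-(ε * t)) := by
    rw [Real.mul_rpow (by linarith) (by positivity), ← Real.rpow_mul hs0.le,
      show -ε * t = -(ε * t) by ring]
    gcongr
  have h6 : ‖intConv (oddExtension (floorDensity g α s)) (oddExtension (floorDensity g α s)) x -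
      intConv (oddExtension (smoothDensity g α s)) (oddExtension (smoothDensity g α s)) x‖ ≤
      (K₀ + 1728) * 3 * (M ^ 2 * s ^ (-α)) * min 1 (K * s ^ (-ε)) := by
    rcases le_total 1 (K * s ^ (-ε)) with h | h
    · rw [min_eq_left h]
      nlinarith
    · rw [min_eq_right h]
      refine h3.trans ?_
      have : 3 ≤ (K₀ + 1728) * 3 := by linarith
      gcongr
  calc _ ≤ (K₀ + 1728) * 3 * (M ^ 2 * s ^ (-α)) * min 1 (K * s ^ (-ε)) := h6
    _ ≤ (K₀ + 1728) * 3 * (M ^ 2 * s ^ (-α)) * (Real.exp 1 * s ^ (-(ε * t))) := by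
      gcongr
      exact (h4 _ hz0).trans h5
    _ = (K₀ + 1728) * (3 * Real.exp 1) * M ^ 2 * s ^ (-α) * s ^ (-(ε * t)) := by ring

theorem mainTheorem5 (α : ℝ) (hα : 1 < α) (hα' : α < 1 + 1 / 1000) :
    ∃ γ : ℝ → ℝ, (∀ δ : ℝ, 0 < δ → 0 < γ δ) ∧
      ∀ φ : ℝ → ℂ, ContDiff ℝ ∞ φ → tsupport φ ⊆ Set.Ioo (1 / 2) 2 →
        ∃ (C : ℝ) (c : ℂ), ∀ δ : ℝ, 0 < δ → ∀ s : ℝ, 1 ≤ s →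
          ∃ G E : ℤ → ℂ,
            (∀ x : ℤ, intConv (waringKernel φ α s) (waringKernel φ α s) x
              = G x + E x + c / (s : ℂ) * deltaZero x) ∧
            (∀ x : ℤ, ‖G x‖ + ‖E x‖ ≤ C * s ^ (-α)) ∧
            (∀ x : ℤ, E x ≠ 0 → |(x : ℝ)| ≤ s ^ (α - 1 + δ)) ∧
            (∀ x u : ℤ, ‖G (x + u) - G x‖ ≤ C * s ^ (-α) * |(u : ℝ) * s ^ (-α)| ^ γ δ) := by
  classical
  have hα2 : α ≤ 2 := by linarith
  have hα0 : 0 < α := by linarith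
  obtain ⟨K, hK, hunif, hoff⟩ := exists_norm_intConv_sub_le hα hα'
  have hoff' : ∀ δ : ℝ, ∃ ε : ℝ, 0 < δ → (0 < ε ∧ _) := fun δ =>
    if h : 0 < δ then (hoff δ h).imp fun _ h' _ => h' else ⟨0, fun h' => absurd h' h⟩
  choose ε hε using hoff'
  refine ⟨fun δ => min 1 (ε δ / α), fun δ hδ => lt_min one_pos (div_pos (hε δ hδ).1 hα0), ?_⟩
  intro φ hφ hφs
  obtain ⟨M, hg⟩ := exists_isWeight_div hφ hφs
  set g : ℝ → ℂ := fun t => φ t / t with hgdef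
  have hM := hg.nonneg
  refine ⟨(2 * K + 41472) * M ^ 2, -2 * ∫ t in (0 : ℝ)..2, g t ^ 2, ?_⟩
  intro δ hδ s hs
  obtain ⟨hε0, hεδ⟩ := hε δ hδ
  have hs0 : 0 < s := by linarith
  have hz : 0 ≤ M ^ 2 * s ^ (-α) := by positivity
  rw [waringKernel_eq hα hs0]
  set H := intConv (oddExtension (floorDensity g α s)) (oddExtension (floorDensity g α s)) with hH
  set P := intConv (oddExtension (smoothDensity g α s)) (oddExtension (smoothDensity g α s)) with hP
  set c : ℂ := -2 * ∫ t in (0 : ℝ)..2, g t ^ 2 with hc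
  obtain ⟨hPle, hPlip⟩ := norm_intConv_smoothDensity_le hg hα hα2 hs
  rw [← hP] at hPle hPlip
  have hHP : ∀ x : ℤ, x ≠ 0 → ‖H x - P x‖ ≤ K * M ^ 2 * s ^ (-α) := fun x hx => hunif hg s hs x hx
  have hH0 : ‖H 0 - c / s‖ ≤ 12 * M ^ 2 * s ^ (-α) :=
    norm_intConv_floorDensity_zero_sub_le hg hα hα2 hs
  have hd0 : deltaZero 0 = 1 := by simp [deltaZero]
  have hd : ∀ x : ℤ, x ≠ 0 → deltaZero x = 0 := fun x hx => by simp [deltaZero, hx]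
  set R := s ^ (α - 1 + δ) with hR
  have hR0 : 0 < R := by positivity
  -- The part of `G` that is not smooth.
  set D : ℤ → ℂ := fun x => if |(x : ℝ)| ≤ R then 0 else H x - P x with hD
  have hDle : ∀ x, ‖D x‖ ≤ K * M ^ 2 * s ^ (-α) := by
    intro x
    simp only [hD]
    split_ifs with h
    · rw [norm_zero]; positivity
    · refine hHP x ?_
      rintro rfl
      simp [hR0.le] at h
  have hDsmall : ∀ x, ‖D x‖ ≤ K * M ^ 2 * s ^ (-α) * s ^ (-ε δ) := by
    intro x
    simp only [hD]
    split_ifs with h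
    · rw [norm_zero]; positivity
    · exact hεδ hg s hs x (not_le.1 h).le
  refine ⟨fun x => P x + D x, fun x => H x - (P x + D x) - c / s * deltaZero x, ?_, ?_, ?_, ?_⟩
  · intro x; ring
  · intro x
    have h1 : ‖P x + D x‖ ≤ (1728 + K) * M ^ 2 * s ^ (-α) := by
      refine (norm_add_le _ _).trans ?_
      linarith [hPle x, hDle x]
    have h2 : ‖H x - (P x + D x) - c / s * deltaZero x‖ ≤ (1740 + K) * M ^ 2 * s ^ (-α) := by
      by_cases hx : x = 0
      · subst hx
        have hD0 : D 0 = 0 := by simp [hD, hR0.le]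
        rw [hd0, hD0, mul_one, add_zero, sub_right_comm]
        refine (norm_sub_le _ _).trans ?_
        nlinarith [hPle 0]
      · rw [hd x hx, mul_zero, sub_zero]
        by_cases h : |(x : ℝ)| ≤ R
        · have : D x = 0 := by simp only [hD, if_pos h]
          rw [this, add_zero]
          linarith [hHP x hx]
        · have : D x = H x - P x := by simp only [hD, if_neg h]
          rw [this, add_sub_cancel, sub_self, norm_zero]
          positivity
    linarith
  · intro x hx
    by_contra h
    apply hx
    have h1 : D x = H x - P x := by simp only [hD, if_neg h]
    have h2 : x ≠ 0 := by
      rintro rfl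
      simp [hR0.le] at h
    beta_reduce
    rw [h1, hd x h2]
    ring
  · intro x u
    by_cases hu : u = 0
    · subst hu
      rw [add_zero, sub_self, norm_zero]
      positivity
    have hu1 : 1 ≤ |(u : ℝ)| := by exact_mod_cast Int.one_le_abs hu
    set γ := min 1 (ε δ / α) with hγ
    have hγ0 : 0 < γ := lt_min one_pos (div_pos hε0 hα0)
    have hγ1 : γ ≤ 1 := min_le_left _ _
    have hsα : 0 < s ^ (-α) := by positivity
    rw [abs_mul, abs_of_pos hsα]
    set v := |(u : ℝ)| * s ^ (-α) with hv
    have hv0 : 0 < v := by positivity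
    -- Since `|u| ≥ 1`, the power saving is within the modulus of continuity.
    have hsγ : s ^ (-ε δ) ≤ v ^ γ := by
      calc s ^ (-ε δ) ≤ s ^ (-α * γ) := by
            refine Real.rpow_le_rpow_of_exponent_le hs ?_
            have h1 : γ ≤ ε δ / α := min_le_right _ _
            rw [le_div_iff₀ hα0] at h1
            linarith
        _ = (s ^ (-α)) ^ γ := Real.rpow_mul hs0.le _ _
        _ ≤ v ^ γ := by
            refine Real.rpow_le_rpow hsα.le ?_ hγ0.le
            exact le_mul_of_one_le_left hsα.le hu1
    have hPγ : ‖P (x + u) - P x‖ ≤ 20736 * M ^ 2 * s ^ (-α) * v ^ γ := by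
      rcases le_total v 1 with h | h
      · refine (hPlip x u).trans ?_
        gcongr
        calc v = v ^ (1 : ℝ) := (Real.rpow_one v).symm
          _ ≤ v ^ γ := Real.rpow_le_rpow_of_exponent_ge hv0 h hγ1
      · have h1 : 1 ≤ v ^ γ := Real.one_le_rpow h hγ0.le
        calc ‖P (x + u) - P x‖ ≤ ‖P (x + u)‖ + ‖P x‖ := norm_sub_le _ _
          _ ≤ 20736 * M ^ 2 * s ^ (-α) * 1 := by nlinarith [hPle (x + u), hPle x]
          _ ≤ 20736 * M ^ 2 * s ^ (-α) * v ^ γ := by gcongr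
    have hDγ : ∀ y, ‖D y‖ ≤ K * M ^ 2 * s ^ (-α) * v ^ γ := fun y =>
      (hDsmall y).trans (by gcongr)
    have e : P (x + u) + D (x + u) - (P x + D x) = (P (x + u) - P x) + (D (x + u) - D x) := by
      ring
    simp only
    rw [e]
    have h0 : 0 ≤ M ^ 2 * s ^ (-α) * v ^ γ := by positivity
    calc ‖(P (x + u) - P x) + (D (x + u) - D x)‖
        ≤ ‖P (x + u) - P x‖ + (‖D (x + u)‖ + ‖D x‖) :=
          (norm_add_le _ _).trans (by gcongr; exact norm_sub_le _ _)
      _ ≤ (2 * K + 41472) * M ^ 2 * s ^ (-α) * v ^ γ := by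
          nlinarith [hDγ (x + u), hDγ x]
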